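/- Conventions. Rings are associative and unital. In a category with finite coproducts, an object $X$ divides $Y$ if $X$ is a retract of the coproduct $Y^n$ of $n$ copies of $Y$ for some $n>0$; $X\sim Y$ ($X$ and $Y$ are similar) if each divides the other. This applies to bimodules and to functors (as objects of a functor category). A functor $F$ is quasi-Frobenius if it has a left adjoint $L$ and a right adjoint $R$ with $L\sim R$. An $(R,S)$-bimodule $M$ is quasi-Frobenius if ${}_RM$ and $M_S$ are finitely generated projective and $\mathrm{Hom}_R({}_RM,{}_RR)\sim\mathrm{Hom}_S(M_S,S_S)$ as $(S,R)$-bimodules. A ring homomorphism $R\to S$ is a quasi-Frobenius extension if ${}_RS$ is finitely generated projective and $S\sim\mathrm{Hom}_R({}_RS,{}_RR)$ as $(S,R)$-bimodules. Let $A$ be a ring and $\mathfrak C$ an $A$-coring with comultiplication $\Delta(c)=c_{(1)}\otimes_A c_{(2)}$ and counit $\varepsilon$. Write $\mathcal M_A$, ${}_A\mathcal M$ for the categories of right and left $A$-modules and $\mathcal M^{\mathfrak C}$, ${}^{\mathfrak C}\mathcal M$ for those of right and left $\mathfrak C$-comodules. The left dual ${}^*\mathfrak C=\mathrm{Hom}_A({}_A\mathfrak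 C,{}_AA)$ is a ring with product $(f*g)(c)=g(c_{(1)}f(c_{(2)}))$ and unit $\varepsilon$, with ring homomorphism $i:A\to{}^*\mathfrak C$, $i(a)(c)=\varepsilon(c)a$, and acts on $\mathfrak C$ on the right by $c\cdot f=c_{(1)}f(c_{(2)})$. The right dual $\mathfrak C^*=\mathrm{Hom}_A(\mathfrak C_A,A_A)$ is a ring with product $(f*g)(c)=f(g(c_{(1)})c_{(2)})$ and unit $\varepsilon$, with ring homomorphism $i':A\to\mathfrak C^*$, $i'(a)(c)=a\varepsilon(c)$, and acts on $\mathfrak C$ on the left by $f\cdot c=f(c_{(1)})c_{(2)}$. The duals are $A$-modules on both sides via $i$ and $i'$. Theorem. Suppose that ${}_A\mathfrak C$ is flat. Then the following are equivalent. 1. The induction functor $-\otimes_A\mathfrak C:\mathcal M_A\to\mathcal M^{\mathfrak C}$ is quasi-Frobenius. 2. The induction functor $\mathfrak C\otimes_A-:{}_A\mathcal M\to{}^{\mathfrak C}\mathcal M$ is quasi-Frobenius. 3. ${}_A\mathfrak C$ is finitely generated projective and $\mathfrak C\sim{}^*\mathfrak C$ as $(A,{}^*\mathfrak C)$-bimodules.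 4. $\mathfrak C_A$ is finitely generated projective and $\mathfrak C\sim\mathfrak C^*$ as $(\mathfrak C^*,A)$-bimodules. 5. ${}_A\mathfrak C$ is finitely generated projective and the forgetful functor $\mathcal M^{\mathfrak C}\to\mathcal M_A$ is quasi-Frobenius. 6. ${}_A\mathfrak C$ is finitely generated projective and $i:A\to{}^*\mathfrak C$ is a quasi-Frobenius extension. 7. $\mathfrak C$ is a quasi-Frobenius $(A,{}^*\mathfrak C)$-bimodule. 8. ${}_A\mathfrak C$ is finitely generated projective and ${}^*\mathfrak C$ is a quasi-Frobenius $({}^*\mathfrak C,A)$-bimodule. 9. $\mathfrak C_A$ is finitely generated projective and the forgetful functor ${}^{\mathfrak C}\mathcal M\to{}_A\mathcal M$ is quasi-Frobenius. 10. $\mathfrak C_A$ is finitely generated projective and $i':A\to\mathfrak C^*$ is a quasi-Frobenius extension. 11. $\mathfrak C$ is a quasi-Frobenius $(\mathfrak C^*,A)$-bimodule. 12. $\mathfrak C_A$ is finitely generated projective and $\mathfrak C^*$ is a quasi-Frobenius $(A,\mathfrak C^*)$-bimodule. -/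

import Mathlib

open CategoryTheory MulOpposite

universe u v₁ v₂ w₁ w₂

namespace QF

/-! ## Divisibility, similarity and quasi-Frobenius functors -/

section Functors

variable {𝒜 : Type w₁} [Category.{v₁} 𝒜] {ℬ : Type w₂} [Category.{v₂} ℬ]

/-- `X` divides `Y`: for some `n > 0`, the object `X` is a retract of a coproduct of `n` copies of
`Y` (here `c` is such a coproduct). -/
def Divides (X Y : 𝒜) : Prop :=
  ∃ n : ℕ, 0 < n ∧ ∃ c : Limits.Cofan (fun _ : Fin n => Y), Nonempty (Limits.IsColimit c) ∧
    ∃ (φ : X ⟶ c.pt) (ψ : c.pt ⟶ X), φ ≫ ψ = 𝟙 X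

/-- Two objects are similar if each divides the other. -/
def Similar (X Y : 𝒜) : Prop := Divides X Y ∧ Divides Y X

/-- `(L, F, R)` is a quasi-Frobenius triple: `L ⊣ F ⊣ R`, and `L`, `R` are similar as objects of
the functor category. -/
def IsQFTriple (L : ℬ ⥤ 𝒜) (F : 𝒜 ⥤ ℬ) (R : ℬ ⥤ 𝒜) : Prop :=
  Nonempty (L ⊣ F) ∧ Nonempty (F ⊣ R) ∧ Similar L R

/-- A functor is quasi-Frobenius if it is the middle term of a quasi-Frobenius triple. -/
def IsQFFunctor (F : 𝒜 ⥤ ℬ) : Prop :=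
  ∃ L R : ℬ ⥤ 𝒜, IsQFTriple L F R

end Functors

/-! ## Bimodules over noncommutative rings

A right `S`-module is a `Module Sᵐᵒᵖ M`, with `m s` written `op s • m`. An `(R, S)`-bimodule is
given by `Module R M`, `Module Sᵐᵒᵖ M` and `SMulCommClass R Sᵐᵒᵖ M`. -/

section Bimodules

/-- The `(R, S)`-bimodule `M` divides the `(R, S)`-bimodule `N`: it is a retract, by bimodule maps,
of the direct sum `Nⁿ` for some `n > 0`. -/
def BimodDivides (R S M N : Type u) [Ring R] [Ring S]
    [AddCommGroup M] [Module R M] [Module Sᵐᵒᵖ M] [SMulCommClass R Sᵐᵒᵖ M]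
    [AddCommGroup N] [Module R N] [Module Sᵐᵒᵖ N] [SMulCommClass R Sᵐᵒᵖ N] : Prop :=
  ∃ n : ℕ, 0 < n ∧ ∃ (φ : M →ₗ[R] (Fin n → N)) (ψ : (Fin n → N) →ₗ[R] M),
    (∀ (s : Sᵐᵒᵖ) (m : M), φ (s • m) = s • φ m) ∧
    (∀ (s : Sᵐᵒᵖ) (x : Fin n → N), ψ (s • x) = s • ψ x) ∧
    ∀ m : M, ψ (φ m) = m

/-- Similarity of `(R, S)`-bimodules. -/
def BimodSimilar (R S M N : Type u) [Ring R] [Ring S]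
    [AddCommGroup M] [Module R M] [Module Sᵐᵒᵖ M] [SMulCommClass R Sᵐᵒᵖ M]
    [AddCommGroup N] [Module R N] [Module Sᵐᵒᵖ N] [SMulCommClass R Sᵐᵒᵖ N] : Prop :=
  BimodDivides R S M N ∧ BimodDivides R S N M

/-- Finitely generated projective (left) modules. -/
def IsFGProjective (R M : Type u) [Ring R] [AddCommGroup M] [Module R M] : Prop :=
  Module.Finite R M ∧ Module.Projective R M

/-- The left dual `Hom_R(_R M, _R R)`. -/
def LeftDual (R M : Type u) [Ring R] [AddCommGroup M] [Module R M] : Type u := M →ₗ[R] R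

/-- The right dual `Hom_S(M_S, S_S)`. -/
def RightDual (S M : Type u) [Ring S] [AddCommGroup M] [Module Sᵐᵒᵖ M] : Type u := M →ₗ[Sᵐᵒᵖ] S

namespace LeftDual

variable {R S M : Type u} [Ring R] [Ring S] [AddCommGroup M] [Module R M]

instance : AddCommGroup (LeftDual R M) := inferInstanceAs (AddCommGroup (M →ₗ[R] R))
instance : FunLike (LeftDual R M) M R := inferInstanceAs (FunLike (M →ₗ[R] R) M R)

@[ext] theorem ext {f g : LeftDual R M} (h : ∀ m, f m = g m) : f = g := LinearMap.ext h

/-- The right `R`-action `(f r)(m) = f(m) r`. -/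
instance : Module Rᵐᵒᵖ (LeftDual R M) := inferInstanceAs (Module Rᵐᵒᵖ (M →ₗ[R] R))

variable [Module Sᵐᵒᵖ M] [SMulCommClass R Sᵐᵒᵖ M]

/-- The left `S`-action `(s f)(m) = f(m s)`. -/
instance : Module S (LeftDual R M) where
  smul s f :=
    ({  toFun := fun m => f (op s • m)
        map_add' := fun x y => by rw [smul_add]; exact LinearMap.map_add (show M →ₗ[R] R from f) _ _
        map_smul' := fun r x => by
          rw [← smul_comm]; exact LinearMap.map_smul (show M →ₗ[R] R from f) _ _ } : M →ₗ[R] R)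
  one_smul f := by ext m; change f (op 1 • m) = f m; simp
  mul_smul s t f := by
    ext m; change f (op (s * t) • m) = f (op t • op s • m); rw [MulOpposite.op_mul, mul_smul]
  smul_zero s := rfl
  smul_add s f g := rfl
  add_smul s t f := by
    ext m
    change f (op (s + t) • m) = f (op s • m) + f (op t • m)
    rw [MulOpposite.op_add, add_smul]; exact LinearMap.map_add (show M →ₗ[R] R from f) _ _
  zero_smul f := by
    ext m
    change f (op 0 • m) = 0
    rw [MulOpposite.op_zero, zero_smul]; exact LinearMap.map_zero (show M →ₗ[R] R from f)

instance : SMulCommClass S Rᵐᵒᵖ (LeftDual R M) := ⟨fun _ _ _ => rfl⟩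

end LeftDual

namespace RightDual

variable {R S M : Type u} [Ring R] [Ring S] [AddCommGroup M] [Module Sᵐᵒᵖ M]

instance : AddCommGroup (RightDual S M) := inferInstanceAs (AddCommGroup (M →ₗ[Sᵐᵒᵖ] S))
instance : FunLike (RightDual S M) M S := inferInstanceAs (FunLike (M →ₗ[Sᵐᵒᵖ] S) M S)

@[ext] theorem ext {f g : RightDual S M} (h : ∀ m, f m = g m) : f = g := LinearMap.ext h

/-- The left `S`-action `(s f)(m) = s f(m)`. -/
instance : Module S (RightDual S M) := inferInstanceAs (Module S (M →ₗ[Sᵐᵒᵖ] S))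

variable [Module R M] [SMulCommClass R Sᵐᵒᵖ M]

/-- The right `R`-action `(f r)(m) = f(r m)`. -/
instance : Module Rᵐᵒᵖ (RightDual S M) where
  smul r f :=
    ({  toFun := fun m => f (unop r • m)
        map_add' := fun x y => by
          rw [smul_add]; exact LinearMap.map_add (show M →ₗ[Sᵐᵒᵖ] S from f) _ _
        map_smul' := fun r x => by
          rw [smul_comm]
          exact LinearMap.map_smul (show M →ₗ[Sᵐᵒᵖ] S from f) _ _ } : M →ₗ[Sᵐᵒᵖ] S)
  one_smul f := by ext m; change f (unop 1 • m) = f m; simp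
  mul_smul s t f := by
    ext m; change f (unop (s * t) • m) = f (unop t • unop s • m); rw [MulOpposite.unop_mul, mul_smul]
  smul_zero s := rfl
  smul_add s f g := rfl
  add_smul s t f := by
    ext m
    change f (unop (s + t) • m) = f (unop s • m) + f (unop t • m)
    rw [MulOpposite.unop_add, add_smul]; exact LinearMap.map_add (show M →ₗ[Sᵐᵒᵖ] S from f) _ _
  zero_smul f := by
    ext m
    change f (unop 0 • m) = 0
    rw [MulOpposite.unop_zero, zero_smul]; exact LinearMap.map_zero (show M →ₗ[Sᵐᵒᵖ] S from f)

instance : SMulCommClass S Rᵐᵒᵖ (RightDual S M) := ⟨fun _ _ _ => rfl⟩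

end RightDual

/-- Quasi-Frobenius `(R, S)`-bimodules: finitely generated projective on both sides, with similar
left and right duals as `(S, R)`-bimodules. -/
def IsQFBimodule (R S M : Type u) [Ring R] [Ring S]
    [AddCommGroup M] [Module R M] [Module Sᵐᵒᵖ M] [SMulCommClass R Sᵐᵒᵖ M] : Prop :=
  IsFGProjective R M ∧ IsFGProjective Sᵐᵒᵖ M ∧
    BimodSimilar S R (LeftDual R M) (RightDual S M)

/-- Quasi-Frobenius ring extensions `φ : R → S`: the left `R`-module `S` is finitely generated
projective, and the `(S, R)`-bimodules `S` and `Hom_R(_R S, _R R)` are similar. -/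
def IsQFExtension {R S : Type u} [Ring R] [Ring S] (φ : R →+* S) : Prop :=
  letI : Module R S := Module.compHom S φ
  letI : Module Rᵐᵒᵖ S := Module.compHom S φ.op
  haveI : SMulCommClass R Sᵐᵒᵖ S := ⟨fun r s x => (smul_comm (φ r) s x :)⟩
  haveI : SMulCommClass S Rᵐᵒᵖ S := ⟨fun s r x => (smul_comm s (φ.op r) x :)⟩
  IsFGProjective R S ∧ BimodSimilar S R S (LeftDual R S)

end Bimodules

/-! ## The tensor product over a noncommutative ring -/

section Tensor

open scoped TensorProduct

variable (A : Type u) [Ring A]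

/-- The subgroup of `M ⊗[ℤ] N` generated by the elements `m a ⊗ n - m ⊗ a n`. -/
def BTensor.rel (M N : Type u) [AddCommGroup M] [Module Aᵐᵒᵖ M] [AddCommGroup N] [Module A N] :
    AddSubgroup (M ⊗[ℤ] N) :=
  AddSubgroup.closure {x | ∃ (m : M) (a : A) (n : N), x = (op a • m) ⊗ₜ[ℤ] n - m ⊗ₜ[ℤ] (a • n)}

/-- The tensor product `M ⊗_A N` of a right `A`-module and a left `A`-module. -/
def BTensor (M N : Type u) [AddCommGroup M] [Module Aᵐᵒᵖ M] [AddCommGroup N] [Module A N] :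
    Type u :=
  (M ⊗[ℤ] N) ⧸ BTensor.rel A M N

namespace BTensor

variable {M M' M'' N N' N'' P X : Type u}
  [AddCommGroup M] [Module Aᵐᵒᵖ M] [AddCommGroup M'] [Module Aᵐᵒᵖ M']
  [AddCommGroup M''] [Module Aᵐᵒᵖ M'']
  [AddCommGroup N] [Module A N] [AddCommGroup N'] [Module A N'] [AddCommGroup N''] [Module A N'']
  [AddCommGroup P] [Module A P] [AddCommGroup X]

instance : AddCommGroup (BTensor A M N) :=
  inferInstanceAs (AddCommGroup ((M ⊗[ℤ] N) ⧸ BTensor.rel A M N))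

/-- The pure tensor `m ⊗ n`. -/
def mk (m : M) (n : N) : BTensor A M N := QuotientAddGroup.mk (m ⊗ₜ[ℤ] n)

theorem mk_smul (m : M) (a : A) (n : N) : mk A (op a • m) n = mk A m (a • n) := by
  refine (QuotientAddGroup.eq_iff_sub_mem).2 (AddSubgroup.subset_closure ⟨m, a, n, rfl⟩)

theorem mk_add_left (m m' : M) (n : N) : mk A (m + m') n = mk A m n + mk A m' n := by
  simp only [mk, TensorProduct.add_tmul]; rfl

theorem mk_add_right (m : M) (n n' : N) : mk A m (n + n') = mk A m n + mk A m n' := by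
  simp only [mk, TensorProduct.tmul_add]; rfl

@[simp] theorem mk_zero_left (n : N) : mk A (0 : M) n = 0 := by
  simp only [mk, TensorProduct.zero_tmul]; rfl

@[simp] theorem mk_zero_right (m : M) : mk A m (0 : N) = 0 := by
  simp only [mk, TensorProduct.tmul_zero]; rfl

variable {A}

theorem hom_ext {f g : BTensor A M N →+ X} (h : ∀ m n, f (mk A m n) = g (mk A m n)) : f = g := by
  refine QuotientAddGroup.addMonoidHom_ext _ ?_
  ext t
  induction t using TensorProduct.induction_on with
  | zero => simp
  | tmul m n => exact h m n
  | add x y hx hy => simp only [map_add, hx, hy]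

theorem hom_ext_apply {f g : BTensor A M N →+ X} (h : ∀ m n, f (mk A m n) = g (mk A m n))
    (t : BTensor A M N) : f t = g t := by rw [hom_ext h]

theorem induction {p : BTensor A M N → Prop} (t : BTensor A M N) (h0 : p 0)
    (hmk : ∀ m n, p (mk A m n)) (hadd : ∀ x y, p x → p y → p (x + y)) : p t := by
  induction t using QuotientAddGroup.induction_on with
  | H t =>
    induction t using TensorProduct.induction_on with
    | zero => exact h0
    | tmul m n => exact hmk m n
    | add x y hx hy => exact hadd _ _ hx hy

/-- The universal property: additive maps out of `M ⊗_A N` from `A`-balanced biadditive maps. -/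
def lift (f : M →+ N →+ X) (hf : ∀ (m : M) (a : A) (n : N), f (op a • m) n = f m (a • n)) :
    BTensor A M N →+ X :=
  QuotientAddGroup.lift _
    (TensorProduct.liftAddHom (R := ℤ) f (fun r m n => by rw [map_zsmul, map_zsmul]; rfl))
    ((AddSubgroup.closure_le _).2 (by
      rintro _ ⟨m, a, n, rfl⟩
      simp [hf]))

@[simp] theorem lift_mk (f : M →+ N →+ X)
    (hf : ∀ (m : M) (a : A) (n : N), f (op a • m) n = f m (a • n)) (m : M) (n : N) :
    lift f hf (mk A m n) = f m n := rfl

/-- A biadditive function, as a homomorphism into homomorphisms. -/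
def biadd (f : M → N → X) (h1 : ∀ m m' n, f (m + m') n = f m n + f m' n)
    (h2 : ∀ m n n', f m (n + n') = f m n + f m n') : M →+ N →+ X :=
  AddMonoidHom.mk' (fun m => AddMonoidHom.mk' (f m) (h2 m))
    (fun m m' => AddMonoidHom.ext (fun n => h1 m m' n))

/-- The map `f ⊗ g`. -/
def map (f : M →ₗ[Aᵐᵒᵖ] M') (g : N →ₗ[A] N') : BTensor A M N →+ BTensor A M' N' :=
  lift (biadd (fun m n => mk A (f m) (g n))
      (fun m m' n => by rw [map_add, mk_add_left]) (fun m n n' => by rw [map_add, mk_add_right]))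
    (fun m a n => by
      change mk A (f _) (g _) = mk A (f _) (g _)
      rw [map_smul, mk_smul, map_smul])

@[simp] theorem map_mk (f : M →ₗ[Aᵐᵒᵖ] M') (g : N →ₗ[A] N') (m : M) (n : N) :
    map f g (mk A m n) = mk A (f m) (g n) := rfl

theorem map_map (f' : M' →ₗ[Aᵐᵒᵖ] M'') (g' : N' →ₗ[A] N'') (f : M →ₗ[Aᵐᵒᵖ] M') (g : N →ₗ[A] N')
    (t : BTensor A M N) : map f' g' (map f g t) = map (f' ∘ₗ f) (g' ∘ₗ g) t :=
  hom_ext_apply (f := (map f' g').comp (map f g)) (g := map (f' ∘ₗ f) (g' ∘ₗ g))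
    (fun _ _ => rfl) t

theorem map_id (t : BTensor A M N) :
    map (LinearMap.id : M →ₗ[Aᵐᵒᵖ] M) (LinearMap.id : N →ₗ[A] N) t = t :=
  hom_ext_apply (f := map (LinearMap.id : M →ₗ[Aᵐᵒᵖ] M) (LinearMap.id : N →ₗ[A] N))
    (g := AddMonoidHom.id _) (fun _ _ => rfl) t

section LeftAction

variable [Module A M] [SMulCommClass A Aᵐᵒᵖ M] [Module A M'] [SMulCommClass A Aᵐᵒᵖ M']

/-- For a bimodule `M`, the left action `a (m ⊗ n) = a m ⊗ n`. -/
instance : Module A (BTensor A M N) where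
  smul a t := map (DistribSMul.toLinearMap Aᵐᵒᵖ M a) LinearMap.id t
  one_smul t := by
    refine hom_ext_apply (f := map (DistribSMul.toLinearMap Aᵐᵒᵖ M (1 : A)) LinearMap.id)
      (g := AddMonoidHom.id _) (fun m n => ?_) t
    simp
  mul_smul a b t := by
    refine hom_ext_apply (f := map (DistribSMul.toLinearMap Aᵐᵒᵖ M (a * b)) LinearMap.id)
      (g := (map (DistribSMul.toLinearMap Aᵐᵒᵖ M a) LinearMap.id).comp
        (map (DistribSMul.toLinearMap Aᵐᵒᵖ M b) LinearMap.id)) (fun m n => ?_) t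
    simp [mul_smul]
  smul_zero a := AddMonoidHom.map_zero _
  smul_add a s t := AddMonoidHom.map_add _ _ _
  add_smul a b t := by
    refine hom_ext_apply (f := map (DistribSMul.toLinearMap Aᵐᵒᵖ M (a + b)) LinearMap.id)
      (g := map (DistribSMul.toLinearMap Aᵐᵒᵖ M a) LinearMap.id +
        map (DistribSMul.toLinearMap Aᵐᵒᵖ M b) LinearMap.id) (fun m n => ?_) t
    simp [add_smul, mk_add_left]
  zero_smul t := by
    refine hom_ext_apply (f := map (DistribSMul.toLinearMap Aᵐᵒᵖ M (0 : A)) LinearMap.id)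
      (g := 0) (fun m n => ?_) t
    simp

@[simp] theorem smul_mk (a : A) (m : M) (n : N) : a • mk A m n = mk A (a • m) n := rfl

theorem map_smul_left (f : M →ₗ[Aᵐᵒᵖ] M') (hf : ∀ (a : A) m, f (a • m) = a • f m)
    (g : N →ₗ[A] N') (a : A) (t : BTensor A M N) : map f g (a • t) = a • map f g t := by
  induction t using induction with
  | h0 => simp
  | hmk m n => simp [hf]
  | hadd x y hx hy => simp only [smul_add, map_add, hx, hy]

end LeftAction

section RightAction

variable [Module Aᵐᵒᵖ N] [SMulCommClass A Aᵐᵒᵖ N] [Module Aᵐᵒᵖ N'] [SMulCommClass A Aᵐᵒᵖ N']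

/-- Right multiplication by `a`, as a left linear map. -/
def rmul (N : Type u) [AddCommGroup N] [Module A N] [Module Aᵐᵒᵖ N] [SMulCommClass A Aᵐᵒᵖ N]
    (s : Aᵐᵒᵖ) : N →ₗ[A] N where
  toFun n := s • n
  map_add' := smul_add s
  map_smul' a n := (smul_comm a s n).symm

/-- For a bimodule `N`, the right action `(m ⊗ n) a = m ⊗ n a`. -/
instance : Module Aᵐᵒᵖ (BTensor A M N) where
  smul s t := map LinearMap.id (rmul N s) t
  one_smul t := by
    refine hom_ext_apply (f := map LinearMap.id (rmul N (1 : Aᵐᵒᵖ)))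
      (g := AddMonoidHom.id _) (fun m n => ?_) t
    simp [rmul]
  mul_smul a b t := by
    refine hom_ext_apply (f := map LinearMap.id (rmul N (a * b)))
      (g := (map LinearMap.id (rmul N a)).comp (map LinearMap.id (rmul N b))) (fun m n => ?_) t
    simp [rmul, mul_smul]
  smul_zero a := AddMonoidHom.map_zero _
  smul_add a s t := AddMonoidHom.map_add _ _ _
  add_smul a b t := by
    refine hom_ext_apply (f := map LinearMap.id (rmul N (a + b)))
      (g := map LinearMap.id (rmul N a) + map LinearMap.id (rmul N b)) (fun m n => ?_) t
    simp [rmul, add_smul, mk_add_right]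
  zero_smul t := by
    refine hom_ext_apply (f := map LinearMap.id (rmul N (0 : Aᵐᵒᵖ))) (g := 0) (fun m n => ?_) t
    simp [rmul]

@[simp] theorem op_smul_mk (s : Aᵐᵒᵖ) (m : M) (n : N) : s • mk A m n = mk A m (s • n) := rfl

theorem map_smul_right (f : M →ₗ[Aᵐᵒᵖ] M') (g : N →ₗ[A] N')
    (hg : ∀ (s : Aᵐᵒᵖ) n, g (s • n) = s • g n) (s : Aᵐᵒᵖ) (t : BTensor A M N) :
    map f g (s • t) = s • map f g t := by
  induction t using induction with
  | h0 => simp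
  | hmk m n => simp [hg]
  | hadd x y hx hy => simp only [smul_add, map_add, hx, hy]

instance [Module A M] [SMulCommClass A Aᵐᵒᵖ M] : SMulCommClass A Aᵐᵒᵖ (BTensor A M N) where
  smul_comm a s t := by
    induction t using induction with
    | h0 => simp
    | hmk m n => simp
    | hadd x y hx hy => simp only [smul_add, hx, hy]

end RightAction

section Assoc

variable [Module Aᵐᵒᵖ N] [SMulCommClass A Aᵐᵒᵖ N]

/-- `n ↦ m ⊗ n` as a right linear map. -/
def mkRight (m : M) : N →ₗ[Aᵐᵒᵖ] BTensor A M N where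
  toFun n := mk A m n
  map_add' n n' := mk_add_right A m n n'
  map_smul' _ _ := rfl

/-- `n ↦ n ⊗ p` as a left linear map. -/
def mkLeft (p : P) : N →ₗ[A] BTensor A N P where
  toFun n := mk A n p
  map_add' n n' := mk_add_left A n n' p
  map_smul' _ _ := rfl

@[simp] theorem mkRight_apply (m : M) (n : N) : mkRight m n = mk A m n := rfl

@[simp] theorem mkLeft_apply (n : N) (p : P) : mkLeft p n = mk A n p := rfl

variable (A M N P) in
/-- The canonical map `(M ⊗ N) ⊗ P → M ⊗ (N ⊗ P)`. -/
def assocHom : BTensor A (BTensor A M N) P →+ BTensor A M (BTensor A N P) :=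
  lift (biadd (fun t p => map LinearMap.id (mkLeft p) t) (fun t t' p => map_add _ _ _)
      (fun t p p' => by
        induction t using induction with
        | h0 => simp
        | hmk m n => simp [mk_add_right]
        | hadd x y hx hy => simp only [map_add, hx, hy]; abel))
    (fun t a p => by
      change map _ _ (op a • t) = map _ _ t
      induction t using induction with
      | h0 => simp
      | hmk m n => simp [mk_smul]
      | hadd x y hx hy => simp only [smul_add, map_add, hx, hy])

variable (A M N P) in
/-- The canonical map `M ⊗ (N ⊗ P) → (M ⊗ N) ⊗ P`. -/
def assocInv : BTensor A M (BTensor A N P) →+ BTensor A (BTensor A M N) P :=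
  lift (biadd (fun m t => map (mkRight m) LinearMap.id t)
      (fun m m' t => by
        induction t using induction with
        | h0 => simp
        | hmk n p => simp [mk_add_left]
        | hadd x y hx hy => simp only [map_add, hx, hy]; abel)
      (fun t p p' => map_add _ _ _))
    (fun m a t => by
      change map _ _ t = map _ _ (a • t)
      induction t using induction with
      | h0 => simp
      | hmk n p => simp [mk_smul]
      | hadd x y hx hy => simp only [smul_add, map_add, hx, hy])

variable (A M N P) in
/-- The associativity isomorphism `(M ⊗ N) ⊗ P ≃ M ⊗ (N ⊗ P)`. -/
def assoc : BTensor A (BTensor A M N) P ≃+ BTensor A M (BTensor A N P) where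
  __ := assocHom A M N P
  invFun := assocInv A M N P
  left_inv x := by
    change assocInv A M N P (assocHom A M N P x) = x
    induction x using induction with
    | h0 => simp
    | hmk t p =>
      induction t using induction with
      | h0 => simp
      | hmk m n => rfl
      | hadd x y hx hy => rw [mk_add_left, map_add, map_add, hx, hy]
    | hadd x y hx hy => rw [map_add, map_add, hx, hy]
  right_inv x := by
    change assocHom A M N P (assocInv A M N P x) = x
    induction x using induction with
    | h0 => simp
    | hmk m t =>
      induction t using induction with
      | h0 => simp
      | hmk n p => rfl
      | hadd x y hx hy => rw [mk_add_right, map_add, map_add, hx, hy]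
    | hadd x y hx hy => rw [map_add, map_add, hx, hy]

@[simp] theorem assoc_mk_mk (m : M) (n : N) (p : P) :
    assoc A M N P (mk A (mk A m n) p) = mk A m (mk A n p) := rfl

theorem assoc_mk (t : BTensor A M N) (p : P) :
    assoc A M N P (mk A t p) = map LinearMap.id (mkLeft p) t := rfl

@[simp] theorem assoc_symm_mk_mk (m : M) (n : N) (p : P) :
    (assoc A M N P).symm (mk A m (mk A n p)) = mk A (mk A m n) p := rfl

theorem assoc_symm_mk (m : M) (t : BTensor A N P) :
    (assoc A M N P).symm (mk A m t) = map (mkRight m) LinearMap.id t := rfl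

end Assoc

variable (A M) in
/-- The canonical map (an isomorphism) `M ⊗ A → M`, `m ⊗ a ↦ m a`. -/
def rid : BTensor A M A →+ M :=
  lift (biadd (fun m a => op a • m) (fun m m' a => smul_add _ _ _)
      (fun m a a' => by rw [MulOpposite.op_add, add_smul]))
    (fun m a b => by
      change op b • op a • m = op (a * b) • m
      rw [MulOpposite.op_mul, mul_smul])

@[simp] theorem rid_mk (m : M) (a : A) : rid A M (mk A m a) = op a • m := rfl

variable (A N) in
/-- The canonical map (an isomorphism) `A ⊗ N → N`, `a ⊗ n ↦ a n`. -/
def lid : BTensor A A N →+ N :=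
  lift (biadd (fun a n => a • n) (fun a a' n => add_smul _ _ _) (fun a n n' => smul_add _ _ _))
    (fun b a n => by
      change (b * a) • n = b • a • n
      rw [mul_smul])

@[simp] theorem lid_mk (a : A) (n : N) : lid A N (mk A a n) = a • n := rfl

end BTensor

/-- The left `A`-module `N` is flat: `- ⊗_A N` preserves injective maps of right `A`-modules. -/
def IsFlatLeft (N : Type u) [AddCommGroup N] [Module A N] : Prop :=
  ∀ (X Y : Type u) [AddCommGroup X] [Module Aᵐᵒᵖ X] [AddCommGroup Y] [Module Aᵐᵒᵖ Y]
    (f : X →ₗ[Aᵐᵒᵖ] Y), Function.Injective f →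
      Function.Injective (BTensor.map f (LinearMap.id : N →ₗ[A] N))

end Tensor

/-! ## Corings and comodules -/

open BTensor in
/-- An `A`-coring structure on the `A`-bimodule `C`: bimodule maps `Δ : C → C ⊗_A C` and
`ε : C → A`, coassociative and counital. -/
class Coring (A C : Type u) [Ring A] [AddCommGroup C] [Module A C] [Module Aᵐᵒᵖ C]
    [SMulCommClass A Aᵐᵒᵖ C] where
  comul : C →ₗ[A] BTensor A C C
  comulR : C →ₗ[Aᵐᵒᵖ] BTensor A C C
  /-- `comul` and `comulR` are the same map `Δ`. -/
  comulR_eq : ∀ c, comulR c = comul c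
  counit : C →ₗ[A] A
  counitR : C →ₗ[Aᵐᵒᵖ] A
  /-- `counit` and `counitR` are the same map `ε`. -/
  counitR_eq : ∀ c, counitR c = counit c
  coassoc : ∀ c, assoc A C C C (map comulR LinearMap.id (comul c)) =
    map LinearMap.id comul (comul c)
  counit_comul : ∀ c, lid A C (map counitR LinearMap.id (comul c)) = c
  comul_counit : ∀ c, rid A C (map LinearMap.id counit (comul c)) = c

section Coring

open BTensor Coring

variable (A C : Type u) [Ring A] [AddCommGroup C] [Module A C] [Module Aᵐᵒᵖ C]
  [SMulCommClass A Aᵐᵒᵖ C] [Coring A C]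

theorem comul_op_smul (s : Aᵐᵒᵖ) (c : C) :
    (comul (s • c) : BTensor A C C) = s • (comul c : BTensor A C C) := by
  rw [← comulR_eq, map_smul, comulR_eq]

theorem comulR_smul (a : A) (c : C) :
    (comulR (a • c) : BTensor A C C) = a • (comulR c : BTensor A C C) := by
  rw [comulR_eq, map_smul, comulR_eq]

theorem counit_op_smul (s : Aᵐᵒᵖ) (c : C) : (counit (s • c) : A) = counit c * unop s := by
  rw [← counitR_eq, map_smul, counitR_eq]; rfl

/-! ### Right comodules -/

/-- Right `C`-comodules. -/
structure RightComodule where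
  carrier : Type u
  [addCommGroup : AddCommGroup carrier]
  [module : Module Aᵐᵒᵖ carrier]
  coact : carrier →ₗ[Aᵐᵒᵖ] BTensor A carrier C
  coassoc : ∀ m, assoc A carrier C C (map coact LinearMap.id (coact m)) =
    map LinearMap.id comul (coact m)
  coact_counit : ∀ m, rid A carrier (map LinearMap.id counit (coact m)) = m

attribute [instance] RightComodule.addCommGroup RightComodule.module

namespace RightComodule

variable {A C}

/-- Right `C`-colinear maps. -/
@[ext] structure Hom (M N : RightComodule A C) where
  lin : M.carrier →ₗ[Aᵐᵒᵖ] N.carrier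
  colinear : ∀ m, N.coact (lin m) = map lin LinearMap.id (M.coact m)

instance : Category (RightComodule A C) where
  Hom := Hom
  id M := ⟨LinearMap.id, fun m => (map_id _).symm⟩
  comp f g := ⟨g.lin ∘ₗ f.lin, fun m => by
    rw [LinearMap.comp_apply, g.colinear, f.colinear, map_map]; rfl⟩

variable (A C)

/-- The forgetful functor `U : M^C ⥤ M_A`. -/
def forget : RightComodule A C ⥤ ModuleCat.{u} Aᵐᵒᵖ where
  obj M := ModuleCat.of Aᵐᵒᵖ M.carrier
  map f := ModuleCat.ofHom (Hom.lin f)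

/-- The induced comodule `N ⊗_A C`, with coaction `N ⊗ Δ`. -/
def induced (N : Type u) [AddCommGroup N] [Module Aᵐᵒᵖ N] : RightComodule A C where
  carrier := BTensor A N C
  coact :=
    { toFun := fun t => (assoc A N C C).symm (map LinearMap.id comul t)
      map_add' := fun x y => by rw [map_add, map_add]
      map_smul' := fun s t => by
        rw [map_smul_right _ _ (comul_op_smul A C)]
        generalize map LinearMap.id (comul : C →ₗ[A] BTensor A C C) t = t'
        induction t' using BTensor.induction with
        | h0 => simp
        | hmk n d =>
          rw [op_smul_mk, assoc_symm_mk, assoc_symm_mk]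
          exact map_smul_right _ _ (fun _ _ => rfl) s d
        | hadd x y hx hy => simp only [smul_add, map_add, hx, hy] }
  coassoc t := by
    induction t using BTensor.induction with
    | h0 => simp only [map_zero]
    | hmk n c =>
      simp only [LinearMap.coe_mk, AddHom.coe_mk, map_mk, LinearMap.id_apply, assoc_symm_mk]
      rw [map_map, map_map]
      have key : ∀ x : BTensor A (BTensor A C C) C,
          assoc A (BTensor A N C) C C
            (map (show BTensor A C C →ₗ[Aᵐᵒᵖ] BTensor A (BTensor A N C) C from
              { toFun := map (mkRight n) LinearMap.id
                map_add' := map_add _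
                map_smul' := map_smul_right _ _ (fun _ _ => rfl) }) LinearMap.id x) =
          map (mkRight n) LinearMap.id (assoc A C C C x) := by
        intro x
        induction x using BTensor.induction with
        | h0 => simp
        | hmk y e =>
          induction y using BTensor.induction with
          | h0 => simp
          | hmk c d => rfl
          | hadd x y hx hy => simp only [mk_add_left, map_add, hx, hy]
        | hadd x y hx hy => simp only [map_add, hx, hy]
      have h := key (map comulR LinearMap.id (comul c))
      rw [Coring.coassoc, map_map, map_map] at h
      rw [LinearMap.comp_id, LinearMap.id_comp] at h ⊢
      refine Eq.trans ?_ h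
      congr 2
      refine congrArg (fun f => map f _) ?_
      refine LinearMap.ext fun d => ?_
      change map (mkRight n) _ (comul d) = map (mkRight n) _ (comulR d)
      rw [comulR_eq]
    | hadd x y hx hy => simp only [map_add, hx, hy]
  coact_counit t := by
    induction t using BTensor.induction with
    | h0 => simp only [map_zero]
    | hmk n c =>
      simp only [LinearMap.coe_mk, AddHom.coe_mk, map_mk, LinearMap.id_apply, assoc_symm_mk]
      rw [map_map]
      have key : ∀ x : BTensor A C A, rid A (BTensor A N C) (map (mkRight n) LinearMap.id x) =
          BTensor.mk A n (rid A C x) := by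
        intro x
        induction x using BTensor.induction with
        | h0 => simp
        | hmk c a => rfl
        | hadd x y hx hy => simp only [map_add, hx, hy, mk_add_right]
      have h := key (map LinearMap.id counit (comul c))
      rw [comul_counit, map_map] at h
      exact h
    | hadd x y hx hy => simp only [map_add, hx, hy]

/-- `f ⊗ C` as a right linear map, for `f : N → N'` right linear. -/
def mapLin {N N' : Type u} [AddCommGroup N] [Module Aᵐᵒᵖ N] [AddCommGroup N'] [Module Aᵐᵒᵖ N']
    (f : N →ₗ[Aᵐᵒᵖ] N') : BTensor A N C →ₗ[Aᵐᵒᵖ] BTensor A N' C where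
  toFun := BTensor.map f LinearMap.id
  map_add' := map_add _
  map_smul' := map_smul_right _ _ (fun _ _ => rfl)

theorem mapLin_colinear {N N' : Type u} [AddCommGroup N] [Module Aᵐᵒᵖ N] [AddCommGroup N']
    [Module Aᵐᵒᵖ N'] (f : N →ₗ[Aᵐᵒᵖ] N') (t : BTensor A N C) :
    (assoc A N' C C).symm (BTensor.map LinearMap.id comul (mapLin A C f t)) =
      BTensor.map (mapLin A C f) LinearMap.id
        ((assoc A N C C).symm (BTensor.map LinearMap.id comul t)) := by
  induction t using BTensor.induction with
  | h0 => simp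
  | hmk n c =>
    change (assoc A N' C C).symm (BTensor.mk A (f n) (comul c)) =
      BTensor.map _ LinearMap.id ((assoc A N C C).symm (BTensor.mk A n (comul c)))
    rw [assoc_symm_mk, assoc_symm_mk, map_map]
    rfl
  | hadd x y hx hy => simp only [map_add, hx, hy]

/-- The induction functor `- ⊗_A C : M_A ⥤ M^C`. -/
def induction : ModuleCat.{u} Aᵐᵒᵖ ⥤ RightComodule A C where
  obj N := induced A C N
  map f := ⟨mapLin A C f.hom, mapLin_colinear A C f.hom⟩
  map_id _ := Hom.ext (LinearMap.ext fun t => BTensor.map_id t)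
  map_comp f g := Hom.ext (LinearMap.ext fun t =>
    (BTensor.map_map g.hom LinearMap.id f.hom LinearMap.id t).symm)

end RightComodule

/-! ### Left comodules -/

/-- Left `C`-comodules. -/
structure LeftComodule where
  carrier : Type u
  [addCommGroup : AddCommGroup carrier]
  [module : Module A carrier]
  coact : carrier →ₗ[A] BTensor A C carrier
  coassoc : ∀ m, assoc A C C carrier (map comulR LinearMap.id (coact m)) =
    map LinearMap.id coact (coact m)
  coact_counit : ∀ m, lid A carrier (map counitR LinearMap.id (coact m)) = m

attribute [instance] LeftComodule.addCommGroup LeftComodule.module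

namespace LeftComodule

variable {A C}

/-- Left `C`-colinear maps. -/
@[ext] structure Hom (M N : LeftComodule A C) where
  lin : M.carrier →ₗ[A] N.carrier
  colinear : ∀ m, N.coact (lin m) = map LinearMap.id lin (M.coact m)

instance : Category (LeftComodule A C) where
  Hom := Hom
  id M := ⟨LinearMap.id, fun m => (map_id _).symm⟩
  comp f g := ⟨g.lin ∘ₗ f.lin, fun m => by
    rw [LinearMap.comp_apply, g.colinear, f.colinear, map_map]; rfl⟩

variable (A C)

/-- The forgetful functor `U' : ^C M ⥤ _A M`. -/
def forget : LeftComodule A C ⥤ ModuleCat.{u} A where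
  obj M := ModuleCat.of A M.carrier
  map f := ModuleCat.ofHom (Hom.lin f)

/-- The induced comodule `C ⊗_A N`, with coaction `Δ ⊗ N`. -/
def induced (N : Type u) [AddCommGroup N] [Module A N] : LeftComodule A C where
  carrier := BTensor A C N
  coact :=
    { toFun := fun t => assoc A C C N (map comulR LinearMap.id t)
      map_add' := fun x y => by rw [map_add, map_add]
      map_smul' := fun a t => by
        rw [map_smul_left _ (comulR_smul A C)]
        generalize map (comulR : C →ₗ[Aᵐᵒᵖ] BTensor A C C) LinearMap.id t = t'
        induction t' using BTensor.induction with
        | h0 => simp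
        | hmk d n =>
          rw [smul_mk, assoc_mk, assoc_mk]
          exact map_smul_left _ (fun _ _ => rfl) _ a d
        | hadd x y hx hy => simp only [smul_add, map_add, hx, hy] }
  coassoc t := by
    induction t using BTensor.induction with
    | h0 => simp only [map_zero]
    | hmk c n =>
      simp only [LinearMap.coe_mk, AddHom.coe_mk, map_mk, LinearMap.id_apply, assoc_mk, comulR_eq]
      rw [map_map, map_map]
      have key : ∀ x : BTensor A (BTensor A C C) C,
          assoc A C C (BTensor A C N) (map LinearMap.id (mkLeft n) x) =
          map LinearMap.id (show BTensor A C C →ₗ[A] BTensor A C (BTensor A C N) from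
              { toFun := map LinearMap.id (mkLeft n)
                map_add' := map_add _
                map_smul' := map_smul_left _ (fun _ _ => rfl) _ }) (assoc A C C C x) := by
        intro x
        induction x using BTensor.induction with
        | h0 => simp
        | hmk y e =>
          induction y using BTensor.induction with
          | h0 => simp
          | hmk c d => rfl
          | hadd x y hx hy => simp only [mk_add_left, map_add, hx, hy]
        | hadd x y hx hy => simp only [map_add, hx, hy]
      have h := key (map comulR LinearMap.id (comul c))
      rw [Coring.coassoc, map_map, map_map] at h
      rw [LinearMap.comp_id, LinearMap.id_comp] at h ⊢
      refine h.trans ?_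
      refine congrArg (fun f => map _ f _) ?_
      refine LinearMap.ext fun d => ?_
      change map _ (mkLeft n) (comul d) = assoc A C C N (BTensor.mk A (comulR d) n)
      rw [assoc_mk, comulR_eq]
    | hadd x y hx hy => simp only [map_add, hx, hy]
  coact_counit t := by
    induction t using BTensor.induction with
    | h0 => simp only [map_zero]
    | hmk c n =>
      simp only [LinearMap.coe_mk, AddHom.coe_mk, map_mk, LinearMap.id_apply, assoc_mk, comulR_eq]
      rw [map_map]
      have key : ∀ x : BTensor A A C, lid A (BTensor A C N) (map LinearMap.id (mkLeft n) x) =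
          BTensor.mk A (lid A C x) n := by
        intro x
        induction x using BTensor.induction with
        | h0 => simp
        | hmk c a => rfl
        | hadd x y hx hy => simp only [map_add, hx, hy, mk_add_left]
      have h := key (map counitR LinearMap.id (comul c))
      rw [counit_comul, map_map] at h
      exact h
    | hadd x y hx hy => simp only [map_add, hx, hy]

/-- `C ⊗ f` as a left linear map, for `f : N → N'` left linear. -/
def mapLin {N N' : Type u} [AddCommGroup N] [Module A N] [AddCommGroup N'] [Module A N']
    (f : N →ₗ[A] N') : BTensor A C N →ₗ[A] BTensor A C N' where
  toFun := BTensor.map LinearMap.id f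
  map_add' := map_add _
  map_smul' := map_smul_left _ (fun _ _ => rfl) _

theorem mapLin_colinear {N N' : Type u} [AddCommGroup N] [Module A N] [AddCommGroup N']
    [Module A N'] (f : N →ₗ[A] N') (t : BTensor A C N) :
    assoc A C C N' (BTensor.map comulR LinearMap.id (mapLin A C f t)) =
      BTensor.map LinearMap.id (mapLin A C f)
        (assoc A C C N (BTensor.map comulR LinearMap.id t)) := by
  induction t using BTensor.induction with
  | h0 => simp
  | hmk c n =>
    change assoc A C C N' (BTensor.mk A (comulR c) (f n)) =
      BTensor.map LinearMap.id _ (assoc A C C N (BTensor.mk A (comulR c) n))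
    rw [assoc_mk, assoc_mk, map_map]
    rfl
  | hadd x y hx hy => simp only [map_add, hx, hy]

/-- The induction functor `C ⊗_A - : _A M ⥤ ^C M`. -/
def induction : ModuleCat.{u} A ⥤ LeftComodule A C where
  obj N := induced A C N
  map f := ⟨mapLin A C f.hom, mapLin_colinear A C f.hom⟩
  map_id _ := Hom.ext (LinearMap.ext fun t => BTensor.map_id t)
  map_comp f g := Hom.ext (LinearMap.ext fun t =>
    (BTensor.map_map LinearMap.id g.hom LinearMap.id f.hom t).symm)

end LeftComodule

end Coring

/-! ### The dual rings `*C` and `C*` -/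

section DualRings

open BTensor Coring

variable (A C : Type u) [Ring A] [AddCommGroup C] [Module A C] [Module Aᵐᵒᵖ C]
  [SMulCommClass A Aᵐᵒᵖ C]

/-- `*C = Hom_A(_A C, _A A)`, to be equipped with its convolution product. -/
def LeftDualRing : Type u := C →ₗ[A] A

/-- `C* = Hom_A(C_A, A_A)`, to be equipped with its convolution product. -/
def RightDualRing : Type u := C →ₗ[Aᵐᵒᵖ] A

variable {A C}

namespace LeftDualRing

instance : AddCommGroup (LeftDualRing A C) := inferInstanceAs (AddCommGroup (C →ₗ[A] A))
instance : FunLike (LeftDualRing A C) C A := inferInstanceAs (FunLike (C →ₗ[A] A) C A)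

/-- The linear map underlying an element of `*C`. -/
def lin (f : LeftDualRing A C) : C →ₗ[A] A := f

@[ext] theorem ext {f g : LeftDualRing A C} (h : ∀ c, f c = g c) : f = g := LinearMap.ext h

/-- For `f ∈ *C`, the left linear map `C ⊗ C → C`, `c ⊗ d ↦ c f(d)`. -/
def contract (f : LeftDualRing A C) : BTensor A C C →ₗ[A] C where
  toFun x := rid A C (map LinearMap.id f.lin x)
  map_add' x y := by rw [map_add, map_add]
  map_smul' a x := by
    induction x using BTensor.induction with
    | h0 => simp
    | hmk c d => exact (smul_comm a (op (f.lin d)) c).symm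
    | hadd x y hx hy => simp only [smul_add, map_add, hx, hy]

theorem contract_mk (f : LeftDualRing A C) (c d : C) :
    contract f (BTensor.mk A c d) = op (f d) • c := rfl

variable [Coring A C]

/-- The right action `c f = c₁ f(c₂)` of `f ∈ *C` on `C`. -/
def act (f : LeftDualRing A C) : C →ₗ[A] C := contract f ∘ₗ comul

/-- The convolution product `(f * g)(c) = g(c₁ f(c₂))`. -/
instance : Mul (LeftDualRing A C) := ⟨fun f g => g.lin ∘ₗ act f⟩

/-- The unit is the counit of `C`. -/
instance : One (LeftDualRing A C) := ⟨(counit : C →ₗ[A] A)⟩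

theorem mul_apply (f g : LeftDualRing A C) (c : C) : (f * g) c = g (act f c) := rfl

theorem one_apply (c : C) : (1 : LeftDualRing A C) c = counit c := rfl

theorem act_one (c : C) : act (1 : LeftDualRing A C) c = c := comul_counit c

theorem act_add (f g : LeftDualRing A C) (c : C) : act (f + g) c = act f c + act g c := by
  change contract (f + g) (comul c) = contract f (comul c) + contract g (comul c)
  induction (comul c : BTensor A C C) using BTensor.induction with
  | h0 => simp
  | hmk c d =>
    rw [contract_mk, contract_mk, contract_mk, ← add_smul, ← MulOpposite.op_add]; rfl
  | hadd x y hx hy => simp only [map_add, hx, hy]; abel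

theorem act_zero (c : C) : act (0 : LeftDualRing A C) c = 0 := by
  have h := act_add (0 : LeftDualRing A C) 0 c
  rw [add_zero] at h
  exact left_eq_add.1 h

theorem act_mul (f g : LeftDualRing A C) (c : C) : act (f * g) c = act g (act f c) := by
  have key : ∀ x : BTensor A C C,
      rid A C (map LinearMap.id (g.lin ∘ₗ contract f)
        (assoc A C C C (map comulR LinearMap.id x))) = act g (contract f x) := by
    intro x
    induction x using BTensor.induction with
    | h0 => simp
    | hmk c d =>
      change rid A C (map LinearMap.id _ (assoc A C C C (BTensor.mk A (comulR c) d))) =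
        contract g (comul (op (f d) • c))
      rw [comul_op_smul, comulR_eq]
      induction (comul c : BTensor A C C) using BTensor.induction with
      | h0 => simp
      | hmk p q => rfl
      | hadd x y hx hy => simp only [mk_add_left, smul_add, map_add, hx, hy]
    | hadd x y hx hy => simp only [map_add, hx, hy]
  have h := key (comul c)
  rw [Coring.coassoc, map_map] at h
  exact h

instance : Ring (LeftDualRing A C) where
  __ := (inferInstance : AddCommGroup (LeftDualRing A C))
  left_distrib f g h := rfl
  right_distrib f g h := by
    ext c
    change h (act (f + g) c) = h (act f c) + h (act g c)
    rw [act_add]; exact map_add h.lin _ _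
  zero_mul f := by
    ext c
    change f (act 0 c) = 0
    rw [act_zero]; exact map_zero f.lin
  mul_zero f := rfl
  mul_assoc f g h := by
    ext c
    rw [mul_apply, mul_apply, mul_apply, act_mul]
  one_mul f := by
    ext c
    rw [mul_apply, act_one]
  mul_one f := by
    ext c
    rw [mul_apply, one_apply]
    have key : ∀ x : BTensor A C C,
        (counit (contract f x) : A) = f.lin (lid A C (map counitR LinearMap.id x)) := by
      intro x
      induction x using BTensor.induction with
      | h0 => simp
      | hmk c d =>
        change (counit (op (f d) • c) : A) = f.lin ((counitR c : A) • d)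
        rw [counit_op_smul, map_smul, counitR_eq]; rfl
      | hadd x y hx hy => simp only [map_add, hx, hy]
    exact (key (comul c)).trans (congrArg f.lin (counit_comul (A := A) c))

/-- The right `*C`-module structure `c f = c₁ f(c₂)` on `C`. -/
instance : Module (LeftDualRing A C)ᵐᵒᵖ C where
  smul f c := act (unop f) c
  one_smul c := act_one c
  mul_smul f g c := act_mul (unop g) (unop f) c
  smul_zero f := map_zero (act (unop f))
  smul_add f := map_add (act (unop f))
  add_smul f g c := act_add (unop f) (unop g) c
  zero_smul c := act_zero c

instance : SMulCommClass A (LeftDualRing A C)ᵐᵒᵖ C :=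
  ⟨fun a f c => (map_smul (act (unop f)) a c).symm⟩

/-- The left linear map `c ↦ ε(c) a`. -/
def iLin (a : A) : C →ₗ[A] A where
  toFun c := counit c * a
  map_add' x y := by rw [map_add, add_mul]
  map_smul' r x := by rw [map_smul]; exact mul_assoc _ _ _

variable (A C) in
/-- The ring homomorphism `i : A → *C`, `i(a)(c) = ε(c) a`. -/
def i : A →+* LeftDualRing A C where
  toFun a := iLin a
  map_one' := ext fun c => mul_one _
  map_mul' a b := ext fun c => by
    change counit c * (a * b) = counit (rid A C (map LinearMap.id (iLin a) (comul c))) * b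
    rw [← mul_assoc]
    congr 1
    have key : ∀ x : BTensor A C C,
        rid A C (map LinearMap.id (iLin a) x) =
        op a • rid A C (map LinearMap.id counit x) := by
      intro x
      induction x using BTensor.induction with
      | h0 => simp
      | hmk c d => exact mul_smul (op a) (op (counit d)) c
      | hadd x y hx hy => simp only [map_add, smul_add, hx, hy]
    rw [key, comul_counit, counit_op_smul]; rfl
  map_zero' := ext fun c => mul_zero _
  map_add' a b := ext fun c => mul_add _ _ _

/-- `*C` as a left `A`-module via `i`. -/
instance : Module A (LeftDualRing A C) := Module.compHom _ (i A C)

/-- `*C` as a right `A`-module via `i`. -/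
instance : Module Aᵐᵒᵖ (LeftDualRing A C) := Module.compHom _ (i A C).op

instance : SMulCommClass A (LeftDualRing A C)ᵐᵒᵖ (LeftDualRing A C) :=
  ⟨fun a f g => (smul_comm (i A C a) f g :)⟩

instance : SMulCommClass (LeftDualRing A C) Aᵐᵒᵖ (LeftDualRing A C) :=
  ⟨fun f a g => (smul_comm f ((i A C).op a) g :)⟩

end LeftDualRing

namespace RightDualRing

instance : AddCommGroup (RightDualRing A C) := inferInstanceAs (AddCommGroup (C →ₗ[Aᵐᵒᵖ] A))
instance : FunLike (RightDualRing A C) C A := inferInstanceAs (FunLike (C →ₗ[Aᵐᵒᵖ] A) C A)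

/-- The linear map underlying an element of `C*`. -/
def lin (f : RightDualRing A C) : C →ₗ[Aᵐᵒᵖ] A := f

@[ext] theorem ext {f g : RightDualRing A C} (h : ∀ c, f c = g c) : f = g := LinearMap.ext h

/-- For `f ∈ C*`, the right linear map `C ⊗ C → C`, `c ⊗ d ↦ f(c) d`. -/
def contract (f : RightDualRing A C) : BTensor A C C →ₗ[Aᵐᵒᵖ] C where
  toFun x := lid A C (map f.lin LinearMap.id x)
  map_add' x y := by rw [map_add, map_add]
  map_smul' a x := by
    induction x using BTensor.induction with
    | h0 => simp
    | hmk c d => exact smul_comm (f.lin c) a d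
    | hadd x y hx hy => simp only [smul_add, map_add, hx, hy]

theorem contract_mk (f : RightDualRing A C) (c d : C) :
    contract f (BTensor.mk A c d) = f c • d := rfl

variable [Coring A C]

/-- The left action `f c = f(c₁) c₂` of `f ∈ C*` on `C`. -/
def act (f : RightDualRing A C) : C →ₗ[Aᵐᵒᵖ] C := contract f ∘ₗ comulR

/-- The convolution product `(f * g)(c) = f(g(c₁) c₂)`. -/
instance : Mul (RightDualRing A C) := ⟨fun f g => f.lin ∘ₗ act g⟩

/-- The unit is the counit of `C`. -/
instance : One (RightDualRing A C) := ⟨(counitR : C →ₗ[Aᵐᵒᵖ] A)⟩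

theorem mul_apply (f g : RightDualRing A C) (c : C) : (f * g) c = f (act g c) := rfl

theorem one_apply (c : C) : (1 : RightDualRing A C) c = counitR c := rfl

theorem act_apply (f : RightDualRing A C) (c : C) : act f c = contract f (comul c) :=
  congrArg (contract f) (comulR_eq c)

theorem act_one (c : C) : act (1 : RightDualRing A C) c = c :=
  (act_apply 1 c).trans (counit_comul c)

theorem act_add (f g : RightDualRing A C) (c : C) : act (f + g) c = act f c + act g c := by
  rw [act_apply, act_apply, act_apply]
  induction (comul c : BTensor A C C) using BTensor.induction with
  | h0 => simp
  | hmk c d =>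
    rw [contract_mk, contract_mk, contract_mk, ← add_smul]; rfl
  | hadd x y hx hy => simp only [map_add, hx, hy]; abel

theorem act_zero (c : C) : act (0 : RightDualRing A C) c = 0 := by
  have h := act_add (0 : RightDualRing A C) 0 c
  rw [add_zero] at h
  exact left_eq_add.1 h

theorem act_mul (f g : RightDualRing A C) (c : C) : act (f * g) c = act f (act g c) := by
  have key : ∀ x : BTensor A C C,
      lid A C (map (f.lin ∘ₗ contract g) LinearMap.id
        ((assoc A C C C).symm (map LinearMap.id comul x))) = act f (contract g x) := by
    intro x
    induction x using BTensor.induction with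
    | h0 => simp
    | hmk c d =>
      rw [act_apply, contract_mk, map_smul]
      change lid A C (map _ LinearMap.id ((assoc A C C C).symm (BTensor.mk A c (comul d)))) = _
      induction (comul d : BTensor A C C) using BTensor.induction with
      | h0 => simp
      | hmk p q => rfl
      | hadd x y hx hy => simp only [mk_add_right, smul_add, map_add, hx, hy]
    | hadd x y hx hy => simp only [map_add, hx, hy]
  have h := key (comul c)
  rw [← Coring.coassoc, AddEquiv.symm_apply_apply, map_map, ← act_apply] at h
  rw [act_apply]
  exact h

instance : Ring (RightDualRing A C) where
  __ := (inferInstance : AddCommGroup (RightDualRing A C))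
  left_distrib f g h := by
    ext c
    change f (act (g + h) c) = f (act g c) + f (act h c)
    rw [act_add]; exact map_add f.lin _ _
  right_distrib f g h := rfl
  zero_mul f := rfl
  mul_zero f := by
    ext c
    change f (act 0 c) = 0
    rw [act_zero]; exact map_zero f.lin
  mul_assoc f g h := by
    ext c
    rw [mul_apply, mul_apply, mul_apply, act_mul]
  one_mul f := by
    ext c
    rw [mul_apply, one_apply, act_apply]
    have key : ∀ x : BTensor A C C,
        (counitR (contract f x) : A) = f.lin (rid A C (map LinearMap.id counit x)) := by
      intro x
      induction x using BTensor.induction with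
      | h0 => simp
      | hmk c d =>
        change (counitR (f c • d) : A) = f.lin (op (counit d : A) • c)
        rw [counitR_eq, map_smul, map_smul]; rfl
      | hadd x y hx hy => simp only [map_add, hx, hy]
    exact (key (comul c)).trans (congrArg f.lin (comul_counit (A := A) c))
  mul_one f := by
    ext c
    rw [mul_apply, act_one]

/-- The left `C*`-module structure `f c = f(c₁) c₂` on `C`. -/
instance : Module (RightDualRing A C) C where
  smul f c := act f c
  one_smul c := act_one c
  mul_smul f g c := act_mul f g c
  smul_zero f := map_zero (act f)
  smul_add f := map_add (act f)
  add_smul f g c := act_add f g c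
  zero_smul c := act_zero c

instance : SMulCommClass (RightDualRing A C) Aᵐᵒᵖ C :=
  ⟨fun f s c => map_smul (act f) s c⟩

/-- The right linear map `c ↦ a ε(c)`. -/
def iLin (a : A) : C →ₗ[Aᵐᵒᵖ] A where
  toFun c := a * counitR c
  map_add' x y := by rw [map_add, mul_add]
  map_smul' r x := by rw [map_smul]; exact (mul_assoc _ _ _).symm

variable (A C) in
/-- The ring homomorphism `i' : A → C*`, `i'(a)(c) = a ε(c)`. -/
def i : A →+* RightDualRing A C where
  toFun a := iLin a
  map_one' := ext fun c => one_mul _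
  map_mul' a b := ext fun c => by
    change a * b * counitR c = a * counitR (lid A C (map (iLin b) LinearMap.id (comulR c)))
    rw [mul_assoc, comulR_eq]
    congr 1
    have key : ∀ x : BTensor A C C,
        lid A C (map (iLin b) LinearMap.id x) =
        b • lid A C (map counitR LinearMap.id x) := by
      intro x
      induction x using BTensor.induction with
      | h0 => simp
      | hmk c d => exact mul_smul b (counitR c) d
      | hadd x y hx hy => simp only [map_add, smul_add, hx, hy]
    rw [key, counit_comul, counitR_eq, counitR_eq, map_smul]; rfl
  map_zero' := ext fun c => zero_mul _
  map_add' a b := ext fun c => add_mul _ _ _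

/-- `C*` as a left `A`-module via `i'`. -/
instance : Module A (RightDualRing A C) := Module.compHom _ (i A C)

/-- `C*` as a right `A`-module via `i'`. -/
instance : Module Aᵐᵒᵖ (RightDualRing A C) := Module.compHom _ (i A C).op

instance : SMulCommClass A (RightDualRing A C)ᵐᵒᵖ (RightDualRing A C) :=
  ⟨fun a f g => (smul_comm (i A C a) f g :)⟩

instance : SMulCommClass (RightDualRing A C) Aᵐᵒᵖ (RightDualRing A C) :=
  ⟨fun f a g => (smul_comm f ((i A C).op a) g :)⟩

end RightDualRing

end DualRings

end QF

namespace QF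

open Limits

/-! ## Divisibility in preadditive categories -/

section Divides

variable {𝒜 : Type w₁} [Category.{v₁} 𝒜] [Preadditive 𝒜]

/-! Every condition in the list is a statement about the same two kinds of data: elements d of C
with a d = d a for all a in A, and A-bimodule maps B : C ⊗_A C → A satisfying x₁ B(x₂, y) = B(x, y₁)
y₂ (`FrobeniusForm`). Each condition turns out to mean that there are finite families with ∑ Bᵢ(c,
dᵢ) = ε(c) (`CounitSumRight`) and also finite families with ∑ Bᵢ(dᵢ, c) = ε(c) (`CounitSumLeft`).
Passing from right to left comodules, or from `*C` to `C*`, only interchanges these two conditions,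
so their conjunction is left-right symmetric.

Functors. Let U be the forgetful functor and G its right adjoint, induction. If one of them has the
further adjoint that the quasi-Frobenius property asks for, transposing along the adjunctions turns
similarity of the two outer functors into finite families of transformations 1 ⟶ UG and GU ⟶ 1 whose
triangle composites add up to the identity of U (`SumsToIdRight`), respectively of G
(`SumsToIdLeft`). The further adjoint need not be given: such families define an idempotent on Gⁿ or
Uⁿ, and a splitting of it is the adjoint (`isRightAdjoint_of_left_inverse`). Hence U and G are
quasi-Frobenius under the same condition. For right comodules a transformation 1 ⟶ UG is n ↦ n ⊗ d
with d central, and a Frobenius form yields m ⊗ c ↦ m₀ B(m₁, c); conversely a transformation θ : GU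
⟶ 1 yields the form ε(θ_C(x ⊗ y)). The triangle sums then become the two counit sums.

Bimodules. When C is finitely generated projective over A on the relevant side, bimodule maps `*C` →
C are s ↦ d s with d central, and bimodule maps C → `*C` are y ↦ B(-, y) with B a Frobenius form.
Evaluating the composites gives the counit sums again (`similar_leftDualRing_iff`,
`similar_rightDualRing_iff`), and a counit sum forces finite generation and projectivity by itself.
The conditions on quasi-Frobenius bimodules and extensions reduce to similarity of C with its dual
ring by taking duals and using reflexivity of finitely generated projective modules. -/

theorem Divides.exists_sum {X Y : 𝒜} (h : Divides X Y) :
    ∃ (n : ℕ) (f : Fin n → (X ⟶ Y)) (g : Fin n → (Y ⟶ X)), ∑ i, f i ≫ g i = 𝟙 X := by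
  classical
  obtain ⟨n, -, c, ⟨hc⟩, φ, ψ, h⟩ := h
  -- In a preadditive category a finite coproduct is a biproduct; these are its projections.
  let π (i : Fin n) : c.pt ⟶ Y := Cofan.IsColimit.desc hc fun j => if j = i then 𝟙 Y else 0
  have hπ (i j : Fin n) : c.inj j ≫ π i = if j = i then 𝟙 Y else 0 :=
    Cofan.IsColimit.fac hc _ _
  have hsum : ∑ i, π i ≫ c.inj i = 𝟙 c.pt := by
    refine Cofan.IsColimit.hom_ext hc _ _ fun j => ?_
    simp [Preadditive.comp_sum, reassoc_of% hπ, ite_comp]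
  refine ⟨n, fun i => φ ≫ π i, fun i => c.inj i ≫ ψ, ?_⟩
  simp_rw [Category.assoc]
  rw [← Preadditive.comp_sum, ← h]
  congr 1
  simp_rw [← Category.assoc]
  rw [← Preadditive.sum_comp, hsum, Category.id_comp]

theorem Divides.of_sum [HasFiniteCoproducts 𝒜] {X Y : 𝒜} {n : ℕ} (f : Fin n → (X ⟶ Y))
    (g : Fin n → (Y ⟶ X)) (h : ∑ i, f i ≫ g i = 𝟙 X) : Divides X Y := by
  -- A zero summand is added because `Divides` asks for a positive number of copies while the family
  -- may be empty.
  let f' : Fin (n + 1) → (X ⟶ Y) := Fin.cons 0 f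
  let g' : Fin (n + 1) → (Y ⟶ X) := Fin.cons 0 g
  refine ⟨n + 1, n.succ_pos, _, ⟨colimit.isColimit (Discrete.functor fun _ : Fin (n + 1) => Y)⟩,
    ∑ i, f' i ≫ Sigma.ι (fun _ : Fin (n + 1) => Y) i,
    Sigma.desc (f := fun _ : Fin (n + 1) => Y) g', ?_⟩
  have h' (i : Fin (n + 1)) : Sigma.ι (fun _ : Fin (n + 1) => Y) i ≫
      Sigma.desc (f := fun _ : Fin (n + 1) => Y) g' = g' i := Sigma.ι_desc _ _
  rw [Preadditive.sum_comp]
  simp_rw [Category.assoc]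
  rw [Fin.sum_univ_succ]
  refine (congrArg₂ (· + ·) (by rw [h']; exact zero_comp)
    (Finset.sum_congr rfl fun i _ => ?_)).trans ((zero_add _).trans h)
  rw [h']; rfl

end Divides

/-! ## Adjoints from one triangle identity -/

section Adjoints

variable {𝒞 : Type w₁} [Category.{v₁} 𝒞] {𝒟 : Type w₂} [Category.{v₂} 𝒟]

/-- With only one triangle identity, the other composite H ⟶ HUH ⟶ H is an idempotent e rather than
the identity. Replacing H by the image L of e makes it the identity, so L is left adjoint to U. -/
theorem isRightAdjoint_of_left_inverse [IsIdempotentComplete 𝒞] {U : 𝒞 ⥤ 𝒟} {H : 𝒟 ⥤ 𝒞}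
    (d : ∀ N, N ⟶ U.obj (H.obj N)) (t : ∀ M, H.obj (U.obj M) ⟶ M)
    (hd : ∀ {X Y : 𝒟} (f : X ⟶ Y), f ≫ d Y = d X ≫ U.map (H.map f))
    (ht : ∀ {X Y : 𝒞} (f : X ⟶ Y), H.map (U.map f) ≫ t Y = t X ≫ f)
    (h : ∀ M, d (U.obj M) ≫ U.map (t M) = 𝟙 (U.obj M)) : U.IsRightAdjoint := by
  let e : H ⟶ H :=
    { app := fun N => H.map (d N) ≫ t (H.obj N)
      naturality := fun X Y f => by
        rw [Category.assoc, ← ht, ← H.map_comp_assoc, ← H.map_comp_assoc, hd] }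
  have he (N : 𝒟) : e.app N = H.map (d N) ≫ t (H.obj N) := rfl
  -- Naturality of t and d brings the two inner factors together, at an object of the form H N,
  -- where `h` cancels them.
  have hee : e ≫ e = e := by
    ext N
    rw [NatTrans.comp_app, he, Category.assoc, ← Category.assoc (t _), ← ht, Category.assoc,
      ← ht (t _), ← H.map_comp_assoc, ← H.map_comp_assoc, ← hd, Category.assoc, h,
      Category.comp_id]
  obtain ⟨L, i, p, hip, hpi⟩ := IsIdempotentComplete.idempotents_split H e hee
  have hip' (N : 𝒟) : i.app N ≫ p.app N = 𝟙 _ := by rw [← NatTrans.comp_app, hip]; rfl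
  have hpi' (N : 𝒟) : p.app N ≫ i.app N = H.map (d N) ≫ t (H.obj N) := by
    rw [← NatTrans.comp_app, hpi]
  have hpe (N : 𝒟) : H.map (d N) ≫ t (H.obj N) ≫ p.app N = p.app N := by
    rw [← Category.assoc, ← hpi', Category.assoc, hip', Category.comp_id]
  refine ⟨L, ⟨Adjunction.mkOfUnitCounit
    { unit := { app := fun N => d N ≫ U.map (p.app N), naturality := fun X Y f => ?_ }
      counit := { app := fun M => i.app (U.obj M) ≫ t M, naturality := fun X Y f => ?_ }
      left_triangle := ?_
      right_triangle := ?_ }⟩⟩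
  · change f ≫ d Y ≫ U.map (p.app Y) = (d X ≫ U.map (p.app X)) ≫ U.map (L.map f)
    rw [← Category.assoc, hd, Category.assoc, Category.assoc, ← U.map_comp, ← U.map_comp,
      p.naturality]
  · change L.map (U.map f) ≫ i.app _ ≫ t Y = (i.app _ ≫ t X) ≫ f
    rw [i.naturality_assoc, ht, Category.assoc]
  · ext N
    change L.map (d N ≫ U.map (p.app N)) ≫ 𝟙 _ ≫ i.app (U.obj (L.obj N)) ≫ t (L.obj N) = 𝟙 _
    rw [Category.id_comp]
    -- Writing the identity of L N as i ≫ p leaves an equation between maps out of H N, in which e =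
    -- p ≫ i becomes explicit and is absorbed by `hpe`.
    refine (Category.id_comp _).symm.trans ?_
    rw [← hip' N, Category.assoc]
    refine congrArg (i.app N ≫ ·) ?_
    rw [← p.naturality_assoc, ← Category.assoc (p.app _), hpi', Category.assoc, ← ht,
      ← H.map_comp_assoc (d _), h, H.map_id, Category.id_comp, H.map_comp_assoc, ht, hpe]
  · ext M
    change (d (U.obj M) ≫ U.map (p.app (U.obj M))) ≫ 𝟙 _ ≫ U.map (i.app (U.obj M) ≫ t M) = 𝟙 _
    rw [Category.id_comp, Category.assoc, ← U.map_comp, ← Category.assoc (p.app _), hpi',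
      Category.assoc, U.map_comp, ← Category.assoc, ← hd, U.map_comp, Category.assoc,
      ← Category.assoc (d _) (U.map _), h, Category.id_comp, h]

/-- This is the previous statement in the opposite categories, where d and t exchange roles. -/
theorem isLeftAdjoint_of_right_inverse [IsIdempotentComplete 𝒟] {G : 𝒟 ⥤ 𝒞} {K : 𝒞 ⥤ 𝒟}
    (d : ∀ N, N ⟶ K.obj (G.obj N)) (t : ∀ M, G.obj (K.obj M) ⟶ M)
    (hd : ∀ {X Y : 𝒟} (f : X ⟶ Y), f ≫ d Y = d X ≫ K.map (G.map f))
    (ht : ∀ {X Y : 𝒞} (f : X ⟶ Y), G.map (K.map f) ≫ t Y = t X ≫ f)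
    (h : ∀ N, G.map (d N) ≫ t (G.obj N) = 𝟙 (G.obj N)) : G.IsLeftAdjoint := by
  have : G.op.IsRightAdjoint := isRightAdjoint_of_left_inverse (U := G.op) (H := K.op)
    (fun M => (t M.unop).op) (fun M => (d M.unop).op)
    (fun f => Quiver.Hom.unop_inj (ht f.unop).symm)
    (fun f => Quiver.Hom.unop_inj (hd f.unop).symm)
    (fun M => Quiver.Hom.unop_inj (h M.unop))
  exact ⟨_, ⟨(Adjunction.ofIsRightAdjoint G.op).unop⟩⟩

end Adjoints

/-! ## Quasi-Frobenius functors and adjoint pairs -/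

section Quasi

variable {𝒞 : Type w₁} [Category.{v₁} 𝒞] {𝒟 : Type w₂} [Category.{v₂} 𝒟]

/-- Finite families of transformations `1 ⟶ UG` and `GU ⟶ 1` whose triangle composites
`U ⟶ UGU ⟶ U` add up to the identity. -/
def SumsToIdRight [Preadditive 𝒟] (U : 𝒞 ⥤ 𝒟) (G : 𝒟 ⥤ 𝒞) : Prop :=
  ∃ (n : ℕ) (δ : Fin n → (𝟭 𝒟 ⟶ G ⋙ U)) (θ : Fin n → (U ⋙ G ⟶ 𝟭 𝒞)),
    ∀ M, ∑ i, (δ i).app (U.obj M) ≫ U.map ((θ i).app M) = 𝟙 (U.obj M)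

/-- Finite families of transformations `1 ⟶ UG` and `GU ⟶ 1` whose triangle composites
`G ⟶ GUG ⟶ G` add up to the identity. -/
def SumsToIdLeft [Preadditive 𝒞] (U : 𝒞 ⥤ 𝒟) (G : 𝒟 ⥤ 𝒞) : Prop :=
  ∃ (n : ℕ) (δ : Fin n → (𝟭 𝒟 ⟶ G ⋙ U)) (θ : Fin n → (U ⋙ G ⟶ 𝟭 𝒞)),
    ∀ N, ∑ i, G.map ((δ i).app N) ≫ (θ i).app (G.obj N) = 𝟙 (G.obj N)

variable [Preadditive 𝒞] [Preadditive 𝒟] {U : 𝒞 ⥤ 𝒟} {G : 𝒟 ⥤ 𝒞}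

/-- The n pairs (δᵢ, θᵢ) are packed into a single pair for the biproduct Gⁿ. Its triangle composite
is the sum of the given ones, because the cross terms pass through ι_i ≫ π_j = 0. The left adjoint
of U is thus a retract of Gⁿ. -/
theorem SumsToIdRight.isRightAdjoint [HasFiniteCoproducts 𝒞] [U.Additive] [IsIdempotentComplete 𝒞]
    (h : SumsToIdRight U G) : U.IsRightAdjoint := by
  classical
  obtain ⟨n, δ, θ, h⟩ := h
  have := HasFiniteBiproducts.of_hasFiniteCoproducts (C := 𝒟 ⥤ 𝒞)
  let b := biproduct.bicone fun _ : Fin n => G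
  let D : 𝟭 𝒟 ⟶ b.pt ⋙ U := ∑ i, δ i ≫ Functor.whiskerRight (b.ι i) U
  let T : U ⋙ b.pt ⟶ 𝟭 𝒞 := ∑ i, Functor.whiskerLeft U (b.π i) ≫ θ i
  refine isRightAdjoint_of_left_inverse D.app T.app (fun f => D.naturality f) (fun f => T.naturality f) fun M => ?_
  rw [← h M]
  have hι (i j : Fin n) : (b.ι i).app (U.obj M) ≫ (b.π j).app (U.obj M) =
      if i = j then 𝟙 _ else 0 := by
    rw [← NatTrans.comp_app, b.ι_π]
    split_ifs with hij
    · subst hij; rfl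
    · rfl
  simp only [D, T, NatTrans.app_sum, NatTrans.comp_app, Functor.whiskerRight_app,
    Functor.whiskerLeft_app, Functor.map_sum, Functor.map_comp, Preadditive.sum_comp,
    Preadditive.comp_sum, Category.assoc]
  refine Finset.sum_congr rfl fun i _ => ?_
  rw [Finset.sum_eq_single i]
  · rw [← U.map_comp_assoc, hι, if_pos rfl, U.map_id, Category.id_comp]
  · intro j _ hj
    rw [← U.map_comp_assoc, hι, if_neg hj, U.map_zero, zero_comp, comp_zero]
  · simp

/-- Here the copies are taken of U, and the right adjoint of G is a retract of Uⁿ. -/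
theorem SumsToIdLeft.isLeftAdjoint [HasFiniteCoproducts 𝒟] [G.Additive] [IsIdempotentComplete 𝒟]
    (h : SumsToIdLeft U G) : G.IsLeftAdjoint := by
  classical
  obtain ⟨n, δ, θ, h⟩ := h
  have := HasFiniteBiproducts.of_hasFiniteCoproducts (C := 𝒞 ⥤ 𝒟)
  let b := biproduct.bicone fun _ : Fin n => U
  let D : 𝟭 𝒟 ⟶ G ⋙ b.pt := ∑ i, δ i ≫ Functor.whiskerLeft G (b.ι i)
  let T : b.pt ⋙ G ⟶ 𝟭 𝒞 := ∑ i, Functor.whiskerRight (b.π i) G ≫ θ i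
  refine isLeftAdjoint_of_right_inverse D.app T.app (fun f => D.naturality f) (fun f => T.naturality f) fun N => ?_
  rw [← h N]
  have hι (i j : Fin n) : (b.ι i).app (G.obj N) ≫ (b.π j).app (G.obj N) =
      if i = j then 𝟙 _ else 0 := by
    rw [← NatTrans.comp_app, b.ι_π]
    split_ifs with hij
    · subst hij; rfl
    · rfl
  have key (i j : Fin n) {X : 𝒞} (k : G.obj (U.obj (G.obj N)) ⟶ X) :
      G.map ((b.ι i).app (G.obj N)) ≫ G.map ((b.π j).app (G.obj N)) ≫ k =
      G.map (if i = j then 𝟙 (U.obj (G.obj N)) else 0) ≫ k := by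
    rw [← hι, G.map_comp, Category.assoc]
  simp only [D, T, NatTrans.app_sum, NatTrans.comp_app, Functor.whiskerRight_app,
    Functor.whiskerLeft_app, Functor.map_sum, Functor.map_comp, Preadditive.sum_comp,
    Preadditive.comp_sum, Category.assoc]
  rw [Finset.sum_comm]
  refine Finset.sum_congr rfl fun i _ => ?_
  rw [Finset.sum_eq_single i]
  · rw [key, if_pos rfl, G.map_id, Category.id_comp]
  · intro j _ hj
    rw [key, if_neg hj.symm, G.map_zero, zero_comp, comp_zero]
  · simp

/-- Between the left and right adjoints of `U`, families of maps correspond to families of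
transformations `1 ⟶ UG` and `GU ⟶ 1`. -/
theorem divides_right_adjoint_iff [HasFiniteCoproducts 𝒞] [U.Additive] {L : 𝒟 ⥤ 𝒞} (adj : L ⊣ U) :
    Divides L G ↔ SumsToIdRight U G := by
  constructor
  · intro h
    obtain ⟨n, f, g, h⟩ := h.exists_sum
    refine ⟨n, fun i => adj.unit ≫ Functor.whiskerRight (f i) U,
      fun i => Functor.whiskerLeft U (g i) ≫ adj.counit, fun M => ?_⟩
    have h' := congrArg (fun t => t.app (U.obj M)) h
    simp only [NatTrans.app_sum, NatTrans.comp_app] at h'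
    have : ∀ i, (adj.unit ≫ Functor.whiskerRight (f i) U).app (U.obj M) ≫
        U.map ((Functor.whiskerLeft U (g i) ≫ adj.counit).app M) =
        adj.unit.app (U.obj M) ≫ U.map ((f i).app (U.obj M) ≫ (g i).app (U.obj M)) ≫
          U.map (adj.counit.app M) := by
      intro i; simp
    simp_rw [this]
    rw [← Preadditive.comp_sum, ← Preadditive.sum_comp, ← Functor.map_sum, h']
    simp
  · rintro ⟨n, δ, θ, h⟩
    refine Divides.of_sum (n := n)
      (fun i => Functor.whiskerRight (δ i) L ≫ Functor.whiskerLeft G adj.counit)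
      (fun i => Functor.whiskerRight adj.unit G ≫ Functor.whiskerLeft L (θ i)) ?_
    ext N
    -- Maps out of L N are compared after transposition along L ⊣ U; the triangle sum at L N then
    -- appears and collapses by `h`.
    refine (adj.homEquiv _ _).injective ?_
    rw [NatTrans.app_sum, Adjunction.homEquiv_unit, Adjunction.homEquiv_unit, Functor.map_sum,
      Preadditive.comp_sum]
    have : ∀ i, adj.unit.app N ≫ U.map (((Functor.whiskerRight (δ i) L ≫
        Functor.whiskerLeft G adj.counit) ≫ Functor.whiskerRight adj.unit G ≫
        Functor.whiskerLeft L (θ i)).app N) =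
        adj.unit.app N ≫ (δ i).app (U.obj (L.obj N)) ≫ U.map ((θ i).app (L.obj N)) := by
      intro i
      have h1 : adj.unit.app N ≫ (δ i).app (U.obj (L.obj N)) =
        (δ i).app N ≫ U.map (G.map (adj.unit.app N)) := (δ i).naturality (adj.unit.app N)
      have h2 : adj.unit.app N ≫ U.map (L.map ((δ i).app N)) =
        (δ i).app N ≫ adj.unit.app _ := (adj.unit.naturality ((δ i).app N)).symm
      simp only [NatTrans.comp_app, Functor.whiskerRight_app, Functor.whiskerLeft_app,
        Functor.map_comp, Category.assoc]
      rw [reassoc_of% h1, reassoc_of% h2]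
      simp
    simp_rw [this]
    rw [← Preadditive.comp_sum, h]
    simp

/-- Whiskering with unit and counit of L ⊣ U turns maps L ⟶ G into transformations 1 ⟶ UG and maps G
⟶ L into transformations GU ⟶ 1. The composite G ⟶ L ⟶ G becomes the triangle composite at G. -/
theorem right_adjoint_divides_iff [HasFiniteCoproducts 𝒞] [G.Additive] {L : 𝒟 ⥤ 𝒞} (adj : L ⊣ U) :
    Divides G L ↔ SumsToIdLeft U G := by
  constructor
  · intro h
    obtain ⟨n, f, g, h⟩ := h.exists_sum
    refine ⟨n, fun i => adj.unit ≫ Functor.whiskerRight (g i) U,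
      fun i => Functor.whiskerLeft U (f i) ≫ adj.counit, fun N => ?_⟩
    have h' := congrArg (fun t => t.app N) h
    simp only [NatTrans.app_sum, NatTrans.comp_app] at h'
    rw [NatTrans.id_app] at h'
    rw [← h']
    refine Finset.sum_congr rfl fun i _ => ?_
    have h1 := (f i).naturality (U.map ((g i).app N))
    have h2 := (f i).naturality (adj.unit.app N)
    have h3 := adj.counit.naturality ((g i).app N)
    simp only [Functor.comp_obj, Functor.id_obj, Functor.comp_map, Functor.id_map] at h1 h2 h3
    simp only [NatTrans.comp_app, Functor.whiskerRight_app, Functor.whiskerLeft_app,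
      Functor.map_comp, Category.assoc]
    rw [← Category.assoc (G.map (U.map _)), h1, Category.assoc, h3, ← Category.assoc, h2]
    simp
  · rintro ⟨n, δ, θ, h⟩
    refine Divides.of_sum (n := n)
      (fun i => Functor.whiskerRight adj.unit G ≫ Functor.whiskerLeft L (θ i))
      (fun i => Functor.whiskerRight (δ i) L ≫ Functor.whiskerLeft G adj.counit) ?_
    ext N
    rw [NatTrans.app_sum, NatTrans.id_app, ← h N]
    refine Finset.sum_congr rfl fun i _ => ?_
    have h1 := (θ i).naturality (L.map ((δ i).app N) ≫ adj.counit.app (G.obj N))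
    simp only [Functor.comp_obj, Functor.id_obj, Functor.comp_map, Functor.id_map] at h1
    simp only [NatTrans.comp_app, Functor.whiskerRight_app, Functor.whiskerLeft_app,
      Category.assoc]
    rw [← h1, ← G.map_comp_assoc]
    simp

/-- The same dictionary on the other side of G: along G ⊣ R, maps U ⟶ R correspond to GU ⟶ 1 and
maps R ⟶ U to 1 ⟶ UG. The composite U ⟶ R ⟶ U becomes the triangle composite at U. -/
theorem divides_left_adjoint_iff [HasFiniteCoproducts 𝒟] [U.Additive] {R : 𝒞 ⥤ 𝒟} (adj : G ⊣ R) :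
    Divides U R ↔ SumsToIdRight U G := by
  constructor
  · intro h
    obtain ⟨n, f, g, h⟩ := h.exists_sum
    refine ⟨n, fun i => adj.unit ≫ Functor.whiskerLeft G (g i),
      fun i => Functor.whiskerRight (f i) G ≫ adj.counit, fun M => ?_⟩
    have h' := congrArg (fun t => t.app M) h
    simp only [NatTrans.app_sum, NatTrans.comp_app] at h'
    rw [NatTrans.id_app] at h'
    rw [← h']
    refine Finset.sum_congr rfl fun i _ => ?_
    have h1 := (g i).naturality (G.map ((f i).app M))
    have h2 := (g i).naturality (adj.counit.app M)
    have h3 := adj.unit.naturality ((f i).app M)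
    simp only [Functor.comp_obj, Functor.id_obj, Functor.comp_map, Functor.id_map] at h1 h2 h3
    simp only [NatTrans.comp_app, Functor.whiskerRight_app, Functor.whiskerLeft_app,
      Functor.map_comp, Category.assoc]
    rw [← reassoc_of% h1, ← reassoc_of% h3, ← h2]
    simp only [← Category.assoc]
    simp
  · rintro ⟨n, δ, θ, h⟩
    refine Divides.of_sum (n := n)
      (fun i => Functor.whiskerLeft U adj.unit ≫ Functor.whiskerRight (θ i) R)
      (fun i => Functor.whiskerLeft R (δ i) ≫ Functor.whiskerRight adj.counit U) ?_
    ext M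
    rw [NatTrans.app_sum, NatTrans.id_app, ← h M]
    refine Finset.sum_congr rfl fun i _ => ?_
    have h1 := (δ i).naturality (adj.unit.app (U.obj M) ≫ R.map ((θ i).app M))
    simp only [Functor.comp_obj, Functor.id_obj, Functor.comp_map, Functor.id_map] at h1
    simp only [NatTrans.comp_app, Functor.whiskerRight_app, Functor.whiskerLeft_app,
      Category.assoc]
    simp only [Category.assoc] at h1
    rw [reassoc_of% h1, ← U.map_comp]
    simp

theorem left_adjoint_divides_iff [HasFiniteCoproducts 𝒟] [G.Additive] {R : 𝒞 ⥤ 𝒟} (adj : G ⊣ R) :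
    Divides R U ↔ SumsToIdLeft U G := by
  constructor
  · intro h
    obtain ⟨n, f, g, h⟩ := h.exists_sum
    refine ⟨n, fun i => adj.unit ≫ Functor.whiskerLeft G (f i),
      fun i => Functor.whiskerRight (g i) G ≫ adj.counit, fun N => ?_⟩
    have h' := congrArg (fun t => t.app (G.obj N)) h
    simp only [NatTrans.app_sum, NatTrans.comp_app] at h'
    have : ∀ i, G.map ((adj.unit ≫ Functor.whiskerLeft G (f i)).app N) ≫
        (Functor.whiskerRight (g i) G ≫ adj.counit).app (G.obj N) =
        G.map (adj.unit.app N) ≫ G.map ((f i).app (G.obj N) ≫ (g i).app (G.obj N)) ≫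
          adj.counit.app (G.obj N) := by
      intro i; simp
    simp_rw [this]
    rw [← Preadditive.comp_sum, ← Preadditive.sum_comp, ← Functor.map_sum, h']
    simp
  · rintro ⟨n, δ, θ, h⟩
    refine Divides.of_sum (n := n)
      (fun i => Functor.whiskerLeft R (δ i) ≫ Functor.whiskerRight adj.counit U)
      (fun i => Functor.whiskerLeft U adj.unit ≫ Functor.whiskerRight (θ i) R) ?_
    ext M
    -- Maps into R M are compared after transposition along G ⊣ R, where the triangle sum at R M
    -- appears.
    refine (adj.homEquiv _ _).symm.injective ?_
    rw [NatTrans.app_sum, Adjunction.homEquiv_counit, Adjunction.homEquiv_counit, Functor.map_sum,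
      Preadditive.sum_comp]
    have : ∀ i, G.map (((Functor.whiskerLeft R (δ i) ≫ Functor.whiskerRight adj.counit U) ≫
        Functor.whiskerLeft U adj.unit ≫ Functor.whiskerRight (θ i) R).app M) ≫
        adj.counit.app M =
        (G.map ((δ i).app (R.obj M)) ≫ (θ i).app (G.obj (R.obj M))) ≫ adj.counit.app M := by
      intro i
      have h1 := (θ i).naturality (adj.counit.app M)
      simp only [Functor.comp_obj, Functor.id_obj, Functor.comp_map, Functor.id_map] at h1
      refine Eq.trans ?_ ((congrArg _ h1).trans (Category.assoc _ _ _).symm)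
      simp
    simp_rw [this]
    rw [← Preadditive.sum_comp, h]
    simp

/-! ### Invariance of divisibility under isomorphism -/

section

variable {𝒜 : Type w₁} [Category.{v₁} 𝒜]

theorem Divides.congr {X X' Y Y' : 𝒜} (e : X ≅ X') (e' : Y ≅ Y') (h : Divides X Y) :
    Divides X' Y' := by
  obtain ⟨n, hn, c, ⟨hc⟩, φ, ψ, h⟩ := h
  refine ⟨n, hn, Cofan.mk c.pt fun i => e'.inv ≫ c.inj i,
    ⟨Cofan.IsColimit.mk _ (fun s => Cofan.IsColimit.desc hc fun i => e'.hom ≫ s.inj i) ?_ ?_⟩,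
    e.inv ≫ φ, ψ ≫ e.hom, ?_⟩
  · intro s j
    have : c.inj j ≫ Cofan.IsColimit.desc hc (fun i => e'.hom ≫ s.inj i) = e'.hom ≫ s.inj j :=
      Cofan.IsColimit.fac hc _ _
    simp [Cofan.inj, Cofan.mk] at this ⊢
    rw [this]; simp
  · intro s m hm
    refine Cofan.IsColimit.hom_ext hc _ _ fun j => ?_
    have : c.inj j ≫ Cofan.IsColimit.desc hc (fun i => e'.hom ≫ s.inj i) = e'.hom ≫ s.inj j :=
      Cofan.IsColimit.fac hc _ _
    rw [this, ← hm j]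
    simp [Cofan.inj, Cofan.mk]
  · change (e.inv ≫ φ) ≫ ψ ≫ e.hom = _
    rw [Category.assoc, reassoc_of% h, e.inv_hom_id]

theorem Similar.congr {X X' Y Y' : 𝒜} (e : X ≅ X') (e' : Y ≅ Y') (h : Similar X Y) :
    Similar X' Y' :=
  ⟨h.1.congr e e', h.2.congr e' e⟩

end

/-- Left adjoints are unique up to isomorphism, so the one in the triple may be taken to be U.
Conversely, the second family of transformations already constructs the right adjoint of G. -/
theorem Adjunction.isQFFunctor_right_iff [HasFiniteCoproducts 𝒞] [HasFiniteCoproducts 𝒟]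
    [U.Additive] [G.Additive] [IsIdempotentComplete 𝒟] (adj : U ⊣ G) :
    IsQFFunctor G ↔ SumsToIdRight U G ∧ SumsToIdLeft U G := by
  constructor
  · rintro ⟨L, R, ⟨hL⟩, ⟨hR⟩, h⟩
    have h' := h.congr (hL.leftAdjointUniq adj) (Iso.refl R)
    exact ⟨(divides_left_adjoint_iff hR).1 h'.1, (left_adjoint_divides_iff hR).1 h'.2⟩
  · rintro ⟨h₁, h₂⟩
    have := h₂.isLeftAdjoint
    let hR := Adjunction.ofIsLeftAdjoint G
    exact ⟨U, _, ⟨adj⟩, ⟨hR⟩, (divides_left_adjoint_iff hR).2 h₁,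
      (left_adjoint_divides_iff hR).2 h₂⟩

/-- Now the right adjoint in the triple may be taken to be G, and the first family constructs the
left adjoint of U. The resulting condition is the same as for G. -/
theorem Adjunction.isQFFunctor_left_iff [HasFiniteCoproducts 𝒞]
    [U.Additive] [G.Additive] [IsIdempotentComplete 𝒞] (adj : U ⊣ G) :
    IsQFFunctor U ↔ SumsToIdRight U G ∧ SumsToIdLeft U G := by
  constructor
  · rintro ⟨L, R, ⟨hL⟩, ⟨hR⟩, h⟩
    have h' := h.congr (Iso.refl L) (hR.rightAdjointUniq adj)
    exact ⟨(divides_right_adjoint_iff hL).1 h'.1, (right_adjoint_divides_iff hL).1 h'.2⟩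
  · rintro ⟨h₁, h₂⟩
    have := h₁.isRightAdjoint
    let hL := Adjunction.ofIsRightAdjoint U
    exact ⟨_, G, ⟨hL⟩, ⟨adj⟩, (divides_right_adjoint_iff hL).2 h₁,
      (right_adjoint_divides_iff hL).2 h₂⟩

end Quasi

end QF

namespace QF

/-! ## Dual bases -/

section DualBasis

variable {R S M : Type u} [Ring R] [Ring S] [AddCommGroup M] [Module R M] [Module Sᵐᵒᵖ M]

theorem IsFGProjective.of_dualBasis {ι : Type*} [Fintype ι] (x : ι → M) (f : ι → M →ₗ[R] R)
    (h : ∀ m, ∑ i, f i m • x i = m) : IsFGProjective R M := by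
  classical
  have hs : (Fintype.linearCombination R x).comp (LinearMap.pi f) = LinearMap.id := by
    ext m
    simpa [Fintype.linearCombination_apply] using h m
  refine ⟨Module.Finite.of_surjective (Fintype.linearCombination R x) fun m => ⟨fun i => f i m, ?_⟩,
    Module.Projective.of_split _ _ hs⟩
  simpa [Fintype.linearCombination_apply] using h m

theorem IsFGProjective.exists_dualBasis (h : IsFGProjective R M) :
    ∃ (n : ℕ) (x : Fin n → M) (f : Fin n → M →ₗ[R] R), ∀ m, ∑ i, f i m • x i = m := by
  classical
  obtain ⟨h₁, h₂⟩ := h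
  obtain ⟨n, p, hp⟩ := Module.Finite.exists_fin' R M
  obtain ⟨s, hs⟩ := Module.projective_lifting_property p LinearMap.id hp
  refine ⟨n, fun i => p (Pi.single i 1), fun i => (LinearMap.proj i).comp s, fun m => ?_⟩
  have := LinearMap.congr_fun hs m
  simp only [LinearMap.comp_apply, LinearMap.id_apply] at this
  conv_rhs => rw [← this, ← Finset.univ_sum_single (s m), map_sum]
  refine Finset.sum_congr rfl fun i _ => ?_
  rw [← map_smul, ← Pi.single_smul, smul_eq_mul, mul_one]; rfl

/-- The map `op : S → Sᵐᵒᵖ` is linear over `Sᵐᵒᵖ`. -/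
def opLin (S : Type u) [Ring S] : S →ₗ[Sᵐᵒᵖ] Sᵐᵒᵖ where
  toFun := op
  map_add' _ _ := rfl
  map_smul' _ _ := rfl

/-- The map `unop : Sᵐᵒᵖ → S` is linear over `Sᵐᵒᵖ`. -/
def unopLin (S : Type u) [Ring S] : Sᵐᵒᵖ →ₗ[Sᵐᵒᵖ] S where
  toFun := unop
  map_add' _ _ := rfl
  map_smul' _ _ := rfl

theorem IsFGProjective.of_dualBasis_right {ι : Type*} [Fintype ι] (x : ι → M)
    (f : ι → M →ₗ[Sᵐᵒᵖ] S) (h : ∀ m, ∑ i, op (f i m) • x i = m) : IsFGProjective Sᵐᵒᵖ M :=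
  .of_dualBasis x (fun i => (opLin S).comp (f i)) h

theorem IsFGProjective.exists_dualBasis_right (h : IsFGProjective Sᵐᵒᵖ M) :
    ∃ (n : ℕ) (x : Fin n → M) (f : Fin n → M →ₗ[Sᵐᵒᵖ] S), ∀ m, ∑ i, op (f i m) • x i = m := by
  obtain ⟨n, x, f, h⟩ := h.exists_dualBasis
  exact ⟨n, x, fun i => (unopLin S).comp (f i), h⟩

theorem IsFGProjective.self : IsFGProjective R R :=
  ⟨inferInstance, inferInstance⟩

theorem IsFGProjective.self_op : IsFGProjective Sᵐᵒᵖ S :=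
  .of_dualBasis_right (fun _ : Unit => 1) (fun _ => LinearMap.id) fun m => by simp

theorem IsFGProjective.of_equiv {N : Type u} [AddCommGroup N] [Module R N] (e : M ≃ₗ[R] N)
    (h : IsFGProjective R M) : IsFGProjective R N := by
  obtain ⟨h₁, h₂⟩ := h
  exact ⟨Module.Finite.equiv e, Module.Projective.of_equiv e⟩

/-- A dual basis of M, with vectors and functionals exchanged, is a dual basis of the dual module.
-/
theorem LeftDual.map_dualBasis {n : ℕ} {x : Fin n → M} {f : Fin n → M →ₗ[R] R}
    (h : ∀ m, ∑ i, f i m • x i = m) (α : LeftDual R M) :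
    ∑ i, op (α (x i)) • (show LeftDual R M from f i) = α := by
  refine LeftDual.ext fun m => ?_
  change (∑ i, op (α (x i)) • (f i : M →ₗ[R] R)) m = _
  rw [LinearMap.sum_apply]
  conv_rhs => rw [← h m]
  refine Eq.trans ?_ (map_sum (show M →ₗ[R] R from α) _ _).symm
  exact Finset.sum_congr rfl fun i _ => ((show M →ₗ[R] R from α).map_smul _ _).symm

theorem RightDual.map_dualBasis {n : ℕ} {x : Fin n → M} {f : Fin n → M →ₗ[Sᵐᵒᵖ] S}
    (h : ∀ m, ∑ i, op (f i m) • x i = m) (α : RightDual S M) :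
    ∑ i, α (x i) • (show RightDual S M from f i) = α := by
  refine RightDual.ext fun m => ?_
  change (∑ i, α (x i) • (f i : M →ₗ[Sᵐᵒᵖ] S)) m = _
  rw [LinearMap.sum_apply]
  conv_rhs => rw [← h m]
  refine Eq.trans ?_ (map_sum (show M →ₗ[Sᵐᵒᵖ] S from α) _ _).symm
  exact Finset.sum_congr rfl fun i _ => ((show M →ₗ[Sᵐᵒᵖ] S from α).map_smul _ _).symm

theorem LeftDual.isFGProjective (h : IsFGProjective R M) : IsFGProjective Rᵐᵒᵖ (LeftDual R M) := by
  obtain ⟨n, x, f, h⟩ := h.exists_dualBasis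
  exact .of_dualBasis_right (ι := Fin n) f
    (fun i => { toFun := fun α => α (x i), map_add' := fun _ _ => rfl, map_smul' := fun _ _ => rfl })
    (map_dualBasis h)

theorem RightDual.isFGProjective (h : IsFGProjective Sᵐᵒᵖ M) :
    IsFGProjective S (RightDual S M) := by
  obtain ⟨n, x, f, h⟩ := h.exists_dualBasis_right
  exact .of_dualBasis (ι := Fin n) (M := RightDual S M) f
    (fun i => { toFun := fun α => α (x i), map_add' := fun _ _ => rfl, map_smul' := fun _ _ => rfl })
    (map_dualBasis h)

end DualBasis

/-! ## Divisibility and duality of bimodules -/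

/-- Isomorphisms of `(R, S)`-bimodules. -/
structure BimodEquiv (R S M N : Type u) [Ring R] [Ring S] [AddCommGroup M] [Module R M]
    [Module Sᵐᵒᵖ M] [AddCommGroup N] [Module R N] [Module Sᵐᵒᵖ N] extends M ≃ₗ[R] N where
  map_op_smul' : ∀ (s : Sᵐᵒᵖ) (m : M), toFun (s • m) = s • toFun m

section Bimodules

variable {R S M M' N N' P : Type u} [Ring R] [Ring S]
    [AddCommGroup M] [Module R M] [Module Sᵐᵒᵖ M] [SMulCommClass R Sᵐᵒᵖ M]
    [AddCommGroup M'] [Module R M'] [Module Sᵐᵒᵖ M'] [SMulCommClass R Sᵐᵒᵖ M']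
    [AddCommGroup N] [Module R N] [Module Sᵐᵒᵖ N] [SMulCommClass R Sᵐᵒᵖ N]
    [AddCommGroup N'] [Module R N'] [Module Sᵐᵒᵖ N'] [SMulCommClass R Sᵐᵒᵖ N']
    [AddCommGroup P] [Module R P] [Module Sᵐᵒᵖ P] [SMulCommClass R Sᵐᵒᵖ P]

theorem BimodDivides.exists_sum (h : BimodDivides R S M N) :
    ∃ (n : ℕ) (f : Fin n → M →ₗ[R] N) (g : Fin n → N →ₗ[R] M),
      (∀ i (s : Sᵐᵒᵖ) m, f i (s • m) = s • f i m) ∧ (∀ i (s : Sᵐᵒᵖ) m, g i (s • m) = s • g i m) ∧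
      ∀ m, ∑ i, g i (f i m) = m := by
  classical
  obtain ⟨n, -, φ, ψ, hφ, hψ, h⟩ := h
  refine ⟨n, fun i => (LinearMap.proj i).comp φ, fun i => ψ.comp (LinearMap.single R (fun _ => N) i),
    fun i s m => ?_, fun i s m => ?_, fun m => ?_⟩
  · simp [hφ]
  · simp only [LinearMap.comp_apply, LinearMap.single_apply, ← hψ, ← Pi.single_smul]
  · conv_rhs => rw [← h m, ← Finset.univ_sum_single (φ m), map_sum]
    rfl

theorem BimodDivides.of_sum {n : ℕ} (f : Fin n → M →ₗ[R] N) (g : Fin n → N →ₗ[R] M)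
    (hf : ∀ i (s : Sᵐᵒᵖ) m, f i (s • m) = s • f i m)
    (hg : ∀ i (s : Sᵐᵒᵖ) m, g i (s • m) = s • g i m)
    (h : ∀ m, ∑ i, g i (f i m) = m) : BimodDivides R S M N := by
  -- The zeroth component is zero; it only serves to make the number of copies positive.
  refine ⟨n + 1, n.succ_pos, LinearMap.pi (Fin.cons 0 f), ∑ i, (g i).comp (LinearMap.proj i.succ),
    fun s m => ?_, fun s x => ?_, fun m => ?_⟩
  · ext i
    refine Fin.cases ?_ (fun i => ?_) i
    · simp
    · simp [hf]
  · simp [LinearMap.sum_apply, hg, Finset.smul_sum]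
  · simpa [LinearMap.sum_apply] using h m

/-- The inverse of a bimodule isomorphism. -/
def BimodEquiv.symm (e : BimodEquiv R S M N) : BimodEquiv R S N M where
  __ := e.toLinearEquiv.symm
  map_op_smul' s m := by
    refine e.toLinearEquiv.injective ?_
    refine Eq.trans ?_ (e.map_op_smul' s _).symm
    refine (e.toLinearEquiv.apply_symm_apply _).trans ?_
    exact congrArg (s • ·) (e.toLinearEquiv.apply_symm_apply m).symm

/-- The identity isomorphism. -/
def BimodEquiv.refl : BimodEquiv R S M M where
  __ := LinearEquiv.refl R M
  map_op_smul' _ _ := rfl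

/-- A bimodule isomorphism as an isomorphism of right modules. -/
def BimodEquiv.toRightEquiv (e : BimodEquiv R S M N) : M ≃ₗ[Sᵐᵒᵖ] N where
  __ := e.toLinearEquiv.toEquiv
  map_add' := e.toLinearEquiv.map_add
  map_smul' := e.map_op_smul'

/-- The composite of bimodule isomorphisms. -/
def BimodEquiv.trans (e : BimodEquiv R S M N) (e' : BimodEquiv R S N P) : BimodEquiv R S M P where
  __ := e.toLinearEquiv.trans e'.toLinearEquiv
  map_op_smul' s m := (congrArg e'.toFun (e.map_op_smul' s m)).trans (e'.map_op_smul' s _)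

theorem BimodDivides.congr (e : BimodEquiv R S M M') (e' : BimodEquiv R S N N')
    (h : BimodDivides R S M N) : BimodDivides R S M' N' := by
  obtain ⟨n, f, g, hf, hg, h⟩ := h.exists_sum
  refine .of_sum (fun i => e'.toLinearMap ∘ₗ f i ∘ₗ e.symm.toLinearMap)
    (fun i => e.toLinearMap ∘ₗ g i ∘ₗ e'.symm.toLinearMap) (fun i s m => ?_) (fun i s m => ?_)
    fun m => ?_
  · exact (congrArg (fun t => e'.toFun (f i t)) (e.symm.map_op_smul' s m)).trans
      ((congrArg e'.toFun (hf i s _)).trans (e'.map_op_smul' s _))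
  · exact (congrArg (fun t => e.toFun (g i t)) (e'.symm.map_op_smul' s m)).trans
      ((congrArg e.toFun (hg i s _)).trans (e.map_op_smul' s _))
  · have : ∀ i, (e.toLinearMap ∘ₗ g i ∘ₗ e'.symm.toLinearMap)
        ((e'.toLinearMap ∘ₗ f i ∘ₗ e.symm.toLinearMap) m) =
        e.toLinearEquiv (g i (f i (e.toLinearEquiv.symm m))) := fun i =>
      congrArg (fun t => e.toLinearEquiv (g i t)) (e'.toLinearEquiv.symm_apply_apply _)
    simp_rw [this]
    rw [← map_sum, h, LinearEquiv.apply_symm_apply]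

theorem BimodSimilar.congr (e : BimodEquiv R S M M') (e' : BimodEquiv R S N N')
    (h : BimodSimilar R S M N) : BimodSimilar R S M' N' :=
  ⟨h.1.congr e e', h.2.congr e' e⟩

theorem BimodSimilar.symm (h : BimodSimilar R S M N) : BimodSimilar R S N M := ⟨h.2, h.1⟩

/-- A dual basis of N is pushed forward along each gᵢ and its functionals are pulled back along fᵢ;
the pairs form a dual basis of M. -/
theorem IsFGProjective.of_bimodDivides (h : BimodDivides R S M N) (hN : IsFGProjective R N) :
    IsFGProjective R M := by
  obtain ⟨n, f, g, -, -, h⟩ := h.exists_sum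
  obtain ⟨k, x, φ, hx⟩ := hN.exists_dualBasis
  refine .of_dualBasis (ι := Fin n × Fin k) (fun p => g p.1 (x p.2)) (fun p => φ p.2 ∘ₗ f p.1)
    fun m => ?_
  rw [Fintype.sum_prod_type]
  conv_rhs => rw [← h m]
  refine Finset.sum_congr rfl fun i _ => ?_
  conv_rhs => rw [← hx (f i m), map_sum]
  exact Finset.sum_congr rfl fun j _ => ((g i).map_smul _ _).symm

/-- A map of left modules compatible with right actions, as a map of right modules. -/
def toRightLin (f : M →ₗ[R] N) (hf : ∀ (s : Sᵐᵒᵖ) m, f (s • m) = s • f m) : M →ₗ[Sᵐᵒᵖ] N where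
  toFun := f
  map_add' := map_add f
  map_smul' := hf

theorem IsFGProjective.of_bimodDivides_right (h : BimodDivides R S M N)
    (hN : IsFGProjective Sᵐᵒᵖ N) : IsFGProjective Sᵐᵒᵖ M := by
  obtain ⟨n, f, g, hf, hg, h⟩ := h.exists_sum
  obtain ⟨k, x, φ, hx⟩ := hN.exists_dualBasis
  refine .of_dualBasis (ι := Fin n × Fin k) (fun p => g p.1 (x p.2))
    (fun p => φ p.2 ∘ₗ toRightLin (f p.1) (hf p.1)) fun m => ?_
  rw [Fintype.sum_prod_type]
  conv_rhs => rw [← h m]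
  refine Finset.sum_congr rfl fun i _ => ?_
  conv_rhs => rw [← hx (f i m), map_sum]
  exact Finset.sum_congr rfl fun j _ => (hg i _ _).symm

/-- The transpose of a bimodule map, between left duals. -/
def LeftDual.comap (f : M →ₗ[R] N) (hf : ∀ (s : Sᵐᵒᵖ) m, f (s • m) = s • f m) :
    LeftDual R N →ₗ[S] LeftDual R M where
  toFun α := (show N →ₗ[R] R from α) ∘ₗ f
  map_add' _ _ := rfl
  map_smul' s α := LeftDual.ext fun m => congrArg α (hf (op s) m).symm

/-- The transpose of a bimodule map, between right duals. -/
def RightDual.comap (f : M →ₗ[R] N) (hf : ∀ (s : Sᵐᵒᵖ) m, f (s • m) = s • f m) :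
    RightDual S N →ₗ[S] RightDual S M where
  toFun α := (show N →ₗ[Sᵐᵒᵖ] S from α) ∘ₗ toRightLin f hf
  map_add' _ _ := rfl
  map_smul' _ _ := rfl

/-- Transposition reverses composition, so the transposes of g and f, in this order, exhibit the
dual of M as a retract of a power of the dual of N. -/
theorem BimodDivides.leftDual (h : BimodDivides R S M N) :
    BimodDivides S R (LeftDual R M) (LeftDual R N) := by
  obtain ⟨n, f, g, hf, hg, h⟩ := h.exists_sum
  refine .of_sum (fun i => LeftDual.comap (g i) (hg i)) (fun i => LeftDual.comap (f i) (hf i))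
    (fun i s α => rfl) (fun i s α => rfl) fun α => LeftDual.ext fun m => ?_
  conv_rhs => rw [← h m]
  refine Eq.trans ?_ (map_sum (show M →ₗ[R] R from α) _ _).symm
  exact LinearMap.sum_apply _ _ _

theorem BimodDivides.rightDual (h : BimodDivides R S M N) :
    BimodDivides S R (RightDual S M) (RightDual S N) := by
  obtain ⟨n, f, g, hf, hg, h⟩ := h.exists_sum
  refine .of_sum (fun i => RightDual.comap (g i) (hg i)) (fun i => RightDual.comap (f i) (hf i))
    (fun i s α => RightDual.ext fun m => congrArg α ((g i).map_smul _ _).symm)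
    (fun i s α => RightDual.ext fun m => congrArg α ((f i).map_smul _ _).symm)
    fun α => RightDual.ext fun m => ?_
  conv_rhs => rw [← h m]
  refine Eq.trans ?_ (map_sum (show M →ₗ[Sᵐᵒᵖ] S from α) _ _).symm
  exact LinearMap.sum_apply _ _ _

theorem BimodSimilar.leftDual (h : BimodSimilar R S M N) :
    BimodSimilar S R (LeftDual R M) (LeftDual R N) := ⟨h.1.leftDual, h.2.leftDual⟩

theorem BimodSimilar.rightDual (h : BimodSimilar R S M N) :
    BimodSimilar S R (RightDual S M) (RightDual S N) := ⟨h.1.rightDual, h.2.rightDual⟩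

/-- Isomorphic bimodules have isomorphic left duals. -/
def BimodEquiv.leftDual (e : BimodEquiv R S M N) :
    BimodEquiv S R (LeftDual R N) (LeftDual R M) where
  __ := LeftDual.comap e.toLinearMap e.map_op_smul'
  invFun := LeftDual.comap e.symm.toLinearMap e.symm.map_op_smul'
  left_inv α := LeftDual.ext fun m => congrArg α (e.toLinearEquiv.apply_symm_apply m)
  right_inv α := LeftDual.ext fun m => congrArg α (e.toLinearEquiv.symm_apply_apply m)
  map_op_smul' _ _ := rfl

/-- Isomorphic bimodules have isomorphic right duals. -/
def BimodEquiv.rightDual (e : BimodEquiv R S M N) :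
    BimodEquiv S R (RightDual S N) (RightDual S M) where
  __ := RightDual.comap e.toLinearMap e.map_op_smul'
  invFun := RightDual.comap e.symm.toLinearMap e.symm.map_op_smul'
  left_inv α := RightDual.ext fun m => congrArg α (e.toLinearEquiv.apply_symm_apply m)
  right_inv α := RightDual.ext fun m => congrArg α (e.toLinearEquiv.symm_apply_apply m)
  map_op_smul' r α := RightDual.ext fun m =>
    congrArg α (e.toLinearEquiv.map_smul (unop r) m).symm

/-- Evaluation `M → (*M)*`. -/
def LeftDual.eval (R S M : Type u) [Ring R] [Ring S] [AddCommGroup M] [Module R M]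
    [Module Sᵐᵒᵖ M] [SMulCommClass R Sᵐᵒᵖ M] : M →ₗ[R] RightDual R (LeftDual R M) where
  toFun m := ({ toFun := fun α => α m, map_add' := fun _ _ => rfl, map_smul' := fun _ _ => rfl } :
    LeftDual R M →ₗ[Rᵐᵒᵖ] R)
  map_add' m m' := RightDual.ext fun α => (show M →ₗ[R] R from α).map_add m m'
  map_smul' r m := RightDual.ext fun α => (show M →ₗ[R] R from α).map_smul r m

/-- Evaluation `M → *(M*)`. -/
def RightDual.eval (R S M : Type u) [Ring R] [Ring S] [AddCommGroup M] [Module R M]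
    [Module Sᵐᵒᵖ M] [SMulCommClass R Sᵐᵒᵖ M] : M →ₗ[R] LeftDual S (RightDual S M) where
  toFun m := ({ toFun := fun α => α m, map_add' := fun _ _ => rfl, map_smul' := fun _ _ => rfl } :
    RightDual S M →ₗ[S] S)
  map_add' m m' := LeftDual.ext fun α => (show M →ₗ[Sᵐᵒᵖ] S from α).map_add m m'
  map_smul' _ _ := rfl

theorem LeftDual.eval_bijective (h : IsFGProjective R M) :
    Function.Bijective (LeftDual.eval R S M) := by
  obtain ⟨n, x, f, h⟩ := h.exists_dualBasis
  -- Injectivity: the coordinates fᵢ(m) determine m. Surjectivity: a functional Φ on the dual is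
  -- determined by its values on the fᵢ, which serve as coordinates of the preimage.
  refine ⟨fun m m' hm => ?_, fun Φ => ⟨∑ i, Φ (show LeftDual R M from f i) • x i, ?_⟩⟩
  · rw [← h m, ← h m']
    exact Finset.sum_congr rfl fun i _ => congrArg (· • x i)
      (congrArg (fun Φ : RightDual R (LeftDual R M) => Φ (show LeftDual R M from f i)) hm)
  · refine RightDual.ext fun α => ?_
    conv_rhs => rw [← LeftDual.map_dualBasis h α]
    refine Eq.trans ?_ (map_sum (show LeftDual R M →ₗ[Rᵐᵒᵖ] R from Φ) _ _).symm
    refine (map_sum (show M →ₗ[R] R from α) _ _).trans (Finset.sum_congr rfl fun i _ => ?_)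
    exact ((show M →ₗ[R] R from α).map_smul _ _).trans
      ((show LeftDual R M →ₗ[Rᵐᵒᵖ] R from Φ).map_smul _ _).symm

theorem RightDual.eval_bijective (h : IsFGProjective Sᵐᵒᵖ M) :
    Function.Bijective (RightDual.eval R S M) := by
  obtain ⟨n, x, f, h⟩ := h.exists_dualBasis_right
  refine ⟨fun m m' hm => ?_, fun Φ => ⟨∑ i, op (Φ (show RightDual S M from f i)) • x i, ?_⟩⟩
  · rw [← h m, ← h m']
    exact Finset.sum_congr rfl fun i _ => congrArg (fun s => op s • x i)
      (congrArg (fun Φ : LeftDual S (RightDual S M) => Φ (show RightDual S M from f i)) hm)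
  · refine LeftDual.ext fun α => ?_
    conv_rhs => rw [← RightDual.map_dualBasis h α]
    refine Eq.trans ?_ (map_sum (show RightDual S M →ₗ[S] S from Φ) _ _).symm
    refine (map_sum (show M →ₗ[Sᵐᵒᵖ] S from α) _ _).trans (Finset.sum_congr rfl fun i _ => ?_)
    exact ((show M →ₗ[Sᵐᵒᵖ] S from α).map_smul _ _).trans
      ((show RightDual S M →ₗ[S] S from Φ).map_smul _ _).symm

/-- A module which is finitely generated projective on the left is reflexive. -/
noncomputable def LeftDual.evalEquiv (h : IsFGProjective R M) :
    BimodEquiv R S M (RightDual R (LeftDual R M)) where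
  __ := LinearEquiv.ofBijective (LeftDual.eval R S M) (LeftDual.eval_bijective h)
  map_op_smul' _ _ := rfl

/-- A module which is finitely generated projective on the right is reflexive. -/
noncomputable def RightDual.evalEquiv (h : IsFGProjective Sᵐᵒᵖ M) :
    BimodEquiv R S M (LeftDual S (RightDual S M)) where
  __ := LinearEquiv.ofBijective (RightDual.eval R S M) (RightDual.eval_bijective h)
  map_op_smul' s m := LeftDual.ext fun α => (show M →ₗ[Sᵐᵒᵖ] S from α).map_smul s m

end Bimodules

/-! ### Duals of a ring as a module over itself -/

section SelfDual

variable {A S : Type u} [Ring A] [Ring S]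

/-- A left A-action on S commuting with right multiplication is left multiplication by the elements
a • 1. This makes the duals of S over itself computable for any such action. -/
theorem smul_one_mul_of_comm [Module A S] [SMulCommClass A Sᵐᵒᵖ S] (a : A) (x : S) :
    (a • (1 : S)) * x = a • x := by
  have := smul_comm a (op x) (1 : S)
  simpa using this.symm

theorem mul_op_smul_one_of_comm [Module Aᵐᵒᵖ S] [SMulCommClass S Aᵐᵒᵖ S] (a : Aᵐᵒᵖ) (x : S) :
    x * (a • (1 : S)) = a • x := by
  have := smul_comm x a (1 : S)
  simpa using this

variable [Module A S] [Module Aᵐᵒᵖ S] [SMulCommClass A Sᵐᵒᵖ S] [SMulCommClass S Aᵐᵒᵖ S]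

/-- `Hom_S(_S S, _S S) ≅ S`. -/
def LeftDual.selfEquiv (h : ∀ a : A, op a • (1 : S) = a • (1 : S)) :
    BimodEquiv A S (LeftDual S S) S where
  toFun f := f 1
  map_add' _ _ := rfl
  map_smul' a f := by
    change f (op a • 1) = a • f 1
    -- The action of a on the dual is precomposition with right multiplication by a; `h` trades it
    -- for left multiplication, which f respects.
    rw [h, ← smul_one_mul_of_comm a (f 1), ← smul_eq_mul]
    refine Eq.trans ?_ ((show S →ₗ[S] S from f).map_smul _ _)
    rw [smul_eq_mul, mul_one]; rfl
  invFun x := LinearMap.toSpanSingleton S S x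
  left_inv f := LeftDual.ext fun m => by
    refine ((show S →ₗ[S] S from f).map_smul m 1).symm.trans ?_
    rw [smul_eq_mul, mul_one]; rfl
  right_inv x := one_smul _ _
  map_op_smul' _ _ := rfl

/-- `Hom_S(S_S, S_S) ≅ S`. -/
def RightDual.selfEquiv (h : ∀ a : A, op a • (1 : S) = a • (1 : S)) :
    BimodEquiv S A (RightDual S S) S where
  toFun f := f 1
  map_add' _ _ := rfl
  map_smul' _ _ := rfl
  invFun x := ({ toFun := fun y => x * y
                 map_add' := fun _ _ => mul_add _ _ _
                 map_smul' := fun s y => (mul_assoc _ _ _).symm } : S →ₗ[Sᵐᵒᵖ] S)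
  left_inv f := RightDual.ext fun m => by
    refine ((show S →ₗ[Sᵐᵒᵖ] S from f).map_smul (op m) 1).symm.trans ?_
    rw [op_smul_eq_mul, one_mul]; rfl
  right_inv x := mul_one _
  map_op_smul' a f := by
    change f (unop a • 1) = a • f 1
    rw [← h, ← mul_op_smul_one_of_comm a (f 1), ← op_smul_eq_mul]
    refine Eq.trans ?_ ((show S →ₗ[Sᵐᵒᵖ] S from f).map_smul _ _)
    rw [op_smul_eq_mul, one_mul]; rfl

end SelfDual

end QF

namespace QF

/-! ## Quasi-Frobenius bimodules and extensions of the dual rings -/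

section DualRingBimodules

open Coring

variable {A C : Type u} [Ring A] [AddCommGroup C] [Module A C] [Module Aᵐᵒᵖ C]
  [SMulCommClass A Aᵐᵒᵖ C] [Coring A C]

namespace LeftDualRing

/-- This is the unit law f * 1 = f evaluated at c. -/
theorem counit_act (f : LeftDualRing A C) (c : C) : counit (act f c) = f c :=
  congrArg (fun g : LeftDualRing A C => g c) (mul_one f)

/-- Together with `smul_apply` this shows that the A-actions on `*C` obtained through `i` are the
usual ones on the dual of the bimodule C. -/
theorem op_smul_apply (a : A) (f : LeftDualRing A C) (c : C) : (op a • f) c = f c * a :=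
  congrArg (· * a) (counit_act f c)

theorem op_smul_one (a : A) : op a • (1 : LeftDualRing A C) = a • (1 : LeftDualRing A C) :=
  (one_mul (i A C a)).trans (mul_one (i A C a)).symm

/-- Hence linearity over `*C` on the right includes linearity over A on the right. -/
theorem act_i (a : A) (c : C) : act (i A C a) c = op a • c := by
  have key : ∀ x : BTensor A C C, contract (i A C a) x = op a • contract 1 x := by
    intro x
    induction x using BTensor.induction with
    | h0 => simp
    | hmk c d => exact mul_smul (op a) (op (counit d)) c
    | hadd x y hx hy => simp only [map_add, smul_add, hx, hy]
  exact (key _).trans (congrArg (op a • ·) (act_one c))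

theorem smul_apply (a : A) (f : LeftDualRing A C) (c : C) : (a • f) c = f (op a • c) :=
  congrArg f (act_i a c)

/-- `*C` is the left dual of the bimodule `C`. -/
def equivLeftDual : BimodEquiv (LeftDualRing A C) A (LeftDualRing A C) (LeftDual A C) where
  toFun f := f
  map_add' _ _ := rfl
  map_smul' _ _ := rfl
  invFun f := f
  left_inv _ := rfl
  right_inv _ := rfl
  map_op_smul' a f := LeftDual.ext fun c => op_smul_apply (unop a) f c

/-- `C` is the right dual of `*C`. -/
noncomputable def bidualEquiv (h : IsFGProjective A C) :
    BimodEquiv A (LeftDualRing A C) C (RightDual A (LeftDualRing A C)) :=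
  (LeftDual.evalEquiv h).trans equivLeftDual.rightDual

theorem isFGProjective_op (h : IsFGProjective A C) : IsFGProjective Aᵐᵒᵖ (LeftDualRing A C) :=
  (LeftDual.isFGProjective h).of_equiv
    equivLeftDual.symm.toRightEquiv

/-- The left dual of `*C` over itself is `*C`, and its right dual over A is C by reflexivity, so the
two duals to be compared are exactly the two bimodules on the right-hand side. -/
theorem isQFBimodule_self_iff (h : IsFGProjective A C) :
    IsQFBimodule (LeftDualRing A C) A (LeftDualRing A C) ↔
      BimodSimilar A (LeftDualRing A C) C (LeftDualRing A C) := by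
  constructor
  · rintro ⟨-, -, hs⟩
    exact (hs.congr (LeftDual.selfEquiv op_smul_one) (bidualEquiv h).symm).symm
  · intro hs
    exact ⟨.self, isFGProjective_op h,
      hs.symm.congr (LeftDual.selfEquiv op_smul_one).symm (bidualEquiv h)⟩

/-- The duals of C are `*C` and Hom(C, `*C`) over `*C`. Dualizing once more over `*C` gives back
`*C` and C. Conversely, C is finitely generated projective over `*C` because it divides the regular
module. -/
theorem isQFBimodule_iff (h : IsFGProjective A C) :
    IsQFBimodule A (LeftDualRing A C) C ↔
      BimodSimilar A (LeftDualRing A C) C (LeftDualRing A C) := by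
  constructor
  · rintro ⟨-, hC, hs⟩
    exact (hs.leftDual.congr (equivLeftDual.leftDual.trans (LeftDual.selfEquiv op_smul_one))
      (RightDual.evalEquiv hC).symm).symm
  · intro hs
    -- The right dual over `*C` sends C ~ `*C` to Hom(C, `*C`) ~ `*C`, and `*C` is the left dual of
    -- C over A.
    exact ⟨h, .of_bimodDivides_right hs.1 .self_op,
      hs.rightDual.symm.congr ((RightDual.selfEquiv op_smul_one).trans equivLeftDual)
        .refl⟩

/-- Applying the right dual over A to `*C` ~ Hom_A(`*C`, A) gives C ~ `*C`, by reflexivity of C and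
of `*C` as left A-modules. The left dual over A leads back, and `*C` is finitely generated
projective over A because it divides C. -/
theorem isQFExtension_iff (h : IsFGProjective A C) :
    IsQFExtension (i A C) ↔ BimodSimilar A (LeftDualRing A C) C (LeftDualRing A C) := by
  have hdef : IsQFExtension (i A C) ↔ IsFGProjective A (LeftDualRing A C) ∧
    BimodSimilar (LeftDualRing A C) A (LeftDualRing A C) (LeftDual A (LeftDualRing A C)) := Iff.rfl
  rw [hdef]
  constructor
  · rintro ⟨hS, hs⟩
    exact hs.rightDual.congr (bidualEquiv h).symm (LeftDual.evalEquiv hS).symm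
  · intro hs
    exact ⟨.of_bimodDivides hs.2 h, hs.leftDual.congr equivLeftDual.symm .refl⟩

end LeftDualRing

namespace RightDualRing

theorem counit_act (f : RightDualRing A C) (c : C) : counitR (act f c) = f c :=
  congrArg (fun g : RightDualRing A C => g c) (one_mul f)

theorem smul_apply (a : A) (f : RightDualRing A C) (c : C) : (a • f) c = a * f c :=
  congrArg (a * ·) (counit_act f c)

theorem op_smul_one (a : A) : op a • (1 : RightDualRing A C) = a • (1 : RightDualRing A C) :=
  (one_mul (i A C a)).trans (mul_one (i A C a)).symm

theorem act_i (a : A) (c : C) : act (i A C a) c = a • c := by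
  have key : ∀ x : BTensor A C C, contract (i A C a) x = a • contract 1 x := by
    intro x
    induction x using BTensor.induction with
    | h0 => simp
    | hmk c d => exact mul_smul a (counitR c) d
    | hadd x y hx hy => simp only [map_add, smul_add, hx, hy]
  rw [act_apply, key, ← act_apply, act_one]

theorem op_smul_apply (a : A) (f : RightDualRing A C) (c : C) : (op a • f) c = f (a • c) :=
  congrArg f (act_i a c)

/-- `C*` is the right dual of the bimodule `C`. -/
def equivRightDual : BimodEquiv A (RightDualRing A C) (RightDualRing A C) (RightDual A C) where
  toFun f := f
  map_add' _ _ := rfl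
  map_smul' a f := RightDual.ext fun c => smul_apply a f c
  invFun f := f
  left_inv _ := rfl
  right_inv _ := rfl
  map_op_smul' _ _ := rfl

/-- `C` is the left dual of `C*`. -/
noncomputable def bidualEquiv (h : IsFGProjective Aᵐᵒᵖ C) :
    BimodEquiv (RightDualRing A C) A C (LeftDual A (RightDualRing A C)) :=
  (RightDual.evalEquiv h).trans equivRightDual.leftDual

theorem isFGProjective (h : IsFGProjective Aᵐᵒᵖ C) : IsFGProjective A (RightDualRing A C) :=
  (RightDual.isFGProjective h).of_equiv equivRightDual.symm.toLinearEquiv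

theorem isQFBimodule_self_iff (h : IsFGProjective Aᵐᵒᵖ C) :
    IsQFBimodule A (RightDualRing A C) (RightDualRing A C) ↔
      BimodSimilar (RightDualRing A C) A C (RightDualRing A C) := by
  constructor
  · rintro ⟨-, -, hs⟩
    exact hs.congr (bidualEquiv h).symm (RightDual.selfEquiv op_smul_one)
  · intro hs
    exact ⟨isFGProjective h, .self_op,
      hs.congr (bidualEquiv h) (RightDual.selfEquiv op_smul_one).symm⟩

/-- The duals to compare are Hom(C, `C*`) over `C*` and `C*` itself; the right dual over `C*` sends
them to C and `C*`. -/
theorem isQFBimodule_iff (h : IsFGProjective Aᵐᵒᵖ C) :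
    IsQFBimodule (RightDualRing A C) A C ↔
      BimodSimilar (RightDualRing A C) A C (RightDualRing A C) := by
  constructor
  · rintro ⟨hC, -, hs⟩
    exact hs.rightDual.congr (LeftDual.evalEquiv hC).symm
      (equivRightDual.rightDual.trans (RightDual.selfEquiv op_smul_one))
  · intro hs
    exact ⟨.of_bimodDivides hs.1 .self, h,
      hs.leftDual.congr .refl ((LeftDual.selfEquiv op_smul_one).trans equivRightDual)⟩

/-- The left A-dual of `C*` is C by reflexivity, so no further dualization is needed on this side.
-/
theorem isQFExtension_iff (h : IsFGProjective Aᵐᵒᵖ C) :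
    IsQFExtension (i A C) ↔ BimodSimilar (RightDualRing A C) A C (RightDualRing A C) := by
  have hdef : IsQFExtension (i A C) ↔ IsFGProjective A (RightDualRing A C) ∧
    BimodSimilar (RightDualRing A C) A (RightDualRing A C) (LeftDual A (RightDualRing A C)) :=
    Iff.rfl
  rw [hdef]
  constructor
  · rintro ⟨-, hs⟩
    exact hs.symm.congr (bidualEquiv h).symm .refl
  · intro hs
    exact ⟨isFGProjective h, hs.symm.congr .refl (bidualEquiv h)⟩

end RightDualRing

end DualRingBimodules

end QF

namespace QF

/-! ## Frobenius forms on a coring -/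

section Forms

open Coring

/-- Functionals separate the points of a finitely generated projective module. This allows the
identity x₁ B(x₂, y) = B(x, y₁) y₂ to be tested by elements of `*C`. -/
theorem eq_of_leftDualRing_apply {A C : Type u} [Ring A] [AddCommGroup C] [Module A C]
    (h : IsFGProjective A C) {c c' : C}
    (hc : ∀ f : LeftDualRing A C, f c = f c') : c = c' := by
  obtain ⟨n, x, f, h⟩ := h.exists_dualBasis
  rw [← h c, ← h c']
  exact Finset.sum_congr rfl fun i _ => congrArg (· • x i) (hc (f i))

theorem eq_of_rightDualRing_apply {A C : Type u} [Ring A] [AddCommGroup C] [Module Aᵐᵒᵖ C]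
    (h : IsFGProjective Aᵐᵒᵖ C) {c c' : C}
    (hc : ∀ f : RightDualRing A C, f c = f c') : c = c' := by
  obtain ⟨n, x, f, h⟩ := h.exists_dualBasis_right
  rw [← h c, ← h c']
  exact Finset.sum_congr rfl fun i _ => congrArg (fun a => op a • x i) (hc (f i))

/-- Bilinear forms `C ⊗_A C → A` which are maps of `A`-bimodules. -/
structure BalancedForm (A C : Type u) [Ring A] [AddCommGroup C] [Module A C] [Module Aᵐᵒᵖ C] where
  form : C → C → A
  add_left : ∀ x x' y, form (x + x') y = form x y + form x' y
  add_right : ∀ x y y', form x (y + y') = form x y + form x y'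
  smul_left : ∀ (a : A) x y, form (a • x) y = a * form x y
  op_smul_right : ∀ (s : Aᵐᵒᵖ) x y, form x (s • y) = form x y * unop s
  balanced : ∀ (a : A) x y, form (op a • x) y = form x (a • y)

namespace BalancedForm

variable {A C : Type u} [Ring A] [AddCommGroup C] [Module A C] [Module Aᵐᵒᵖ C]

/-- The element `x ↦ B(x, y)` of `*C`. -/
def left (B : BalancedForm A C) (y : C) : LeftDualRing A C :=
  ({ toFun := fun x => B.form x y
     map_add' := fun x x' => B.add_left x x' y
     map_smul' := fun a x => B.smul_left a x y } : C →ₗ[A] A)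

/-- The element `y ↦ B(x, y)` of `C*`. -/
def right (B : BalancedForm A C) (x : C) : RightDualRing A C :=
  ({ toFun := fun y => B.form x y
     map_add' := fun y y' => B.add_right x y y'
     map_smul' := fun s y => B.op_smul_right s x y } : C →ₗ[Aᵐᵒᵖ] A)

variable [SMulCommClass A Aᵐᵒᵖ C] [Coring A C]

/-- Both sides are B(x, y₁) g(y₂). After testing by g, the Frobenius identity therefore reads B(-,
y) * g = B(-, y g), that is, linearity of y ↦ B(-, y) over `*C`. -/
theorem apply_act_right (B : BalancedForm A C) (g : LeftDualRing A C) (x y : C) :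
    g (RightDualRing.act (B.right x) y) = B.form x (LeftDualRing.act g y) := by
  have key : ∀ t : BTensor A C C, g.lin (RightDualRing.contract (B.right x) t) =
      (B.right x).lin (LeftDualRing.contract g t) := by
    intro t
    induction t using BTensor.induction with
    | h0 => simp
    | hmk c d =>
      exact (g.lin.map_smul _ _).trans ((B.right x).lin.map_smul (op (g d)) c).symm
    | hadd x y hx hy => simp only [map_add, hx, hy]
  rw [RightDualRing.act_apply]
  exact key _

/-- Both sides are g(x₁) B(x₂, y); tested by `C*`, the Frobenius identity is linearity of x ↦ B(x,
-) over `C*`. -/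
theorem apply_act_left (B : BalancedForm A C) (g : RightDualRing A C) (x y : C) :
    g (LeftDualRing.act (B.left y) x) = B.form (RightDualRing.act g x) y := by
  have key : ∀ t : BTensor A C C, g.lin (LeftDualRing.contract (B.left y) t) =
      (B.left y).lin (RightDualRing.contract g t) := by
    intro t
    induction t using BTensor.induction with
    | h0 => simp
    | hmk c d =>
      exact (g.lin.map_smul (op (B.form d y)) c).trans ((B.left y).lin.map_smul (g c) d).symm
    | hadd x y hx hy => simp only [map_add, hx, hy]
  rw [RightDualRing.act_apply]
  exact key _

end BalancedForm

/-- Balanced forms with `x₁ B(x₂, y) = B(x, y₁) y₂`. -/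
structure FrobeniusForm (A C : Type u) [Ring A] [AddCommGroup C] [Module A C] [Module Aᵐᵒᵖ C]
    [SMulCommClass A Aᵐᵒᵖ C] [Coring A C] extends BalancedForm A C where
  frobenius : ∀ x y, LeftDualRing.act (toBalancedForm.left y) x =
    RightDualRing.act (toBalancedForm.right x) y

variable (A C : Type u) [Ring A] [AddCommGroup C] [Module A C] [Module Aᵐᵒᵖ C]
  [SMulCommClass A Aᵐᵒᵖ C] [Coring A C]

/-- There are `A`-central `dᵢ` and Frobenius forms `Bᵢ` with `∑ Bᵢ(c, dᵢ) = ε(c)`. -/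
def CounitSumRight : Prop :=
  ∃ (n : ℕ) (d : Fin n → C) (B : Fin n → FrobeniusForm A C),
    (∀ i (a : A), a • d i = op a • d i) ∧ ∀ c, ∑ i, (B i).form c (d i) = counit c

/-- There are `A`-central `dᵢ` and Frobenius forms `Bᵢ` with `∑ Bᵢ(dᵢ, c) = ε(c)`. -/
def CounitSumLeft : Prop :=
  ∃ (n : ℕ) (d : Fin n → C) (B : Fin n → FrobeniusForm A C),
    (∀ i (a : A), a • d i = op a • d i) ∧ ∀ c, ∑ i, (B i).form (d i) c = counit c

variable {A C}

theorem LeftDualRing.sum_apply {n : ℕ} (f : Fin n → LeftDualRing A C) (c : C) :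
    (∑ i, f i) c = ∑ i, f i c :=
  LinearMap.sum_apply (M₂ := A) Finset.univ f c

theorem RightDualRing.sum_apply {n : ℕ} (f : Fin n → RightDualRing A C) (c : C) :
    (∑ i, f i) c = ∑ i, f i c :=
  LinearMap.sum_apply (M₂ := A) Finset.univ f c

theorem LeftDualRing.sum_act {n : ℕ} (f : Fin n → LeftDualRing A C) (c : C) :
    ∑ i, act (f i) c = act (∑ i, f i) c :=
  (Finset.sum_smul (f := fun i => op (f i)) (s := Finset.univ) (x := c)).symm.trans
    (congrArg (· • c) (map_sum (opAddEquiv (α := LeftDualRing A C)) f Finset.univ).symm)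

theorem RightDualRing.sum_act {n : ℕ} (f : Fin n → RightDualRing A C) (c : C) :
    ∑ i, act (f i) c = act (∑ i, f i) c :=
  (Finset.sum_smul (f := f) (s := Finset.univ) (x := c)).symm

theorem sum_left_eq_one {n : ℕ} {d : Fin n → C} {B : Fin n → FrobeniusForm A C}
    (h : ∀ c, ∑ i, (B i).form c (d i) = counit c) : ∑ i, (B i).left (d i) = 1 :=
  LeftDualRing.ext fun c => (LeftDualRing.sum_apply _ c).trans (h c)

theorem sum_right_eq_one {n : ℕ} {d : Fin n → C} {B : Fin n → FrobeniusForm A C}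
    (h : ∀ c, ∑ i, (B i).form (d i) c = counit c) : ∑ i, (B i).right (d i) = 1 :=
  RightDualRing.ext fun c => (RightDualRing.sum_apply _ c).trans ((h c).trans (counitR_eq c).symm)

/-! ### Finite generation and projectivity -/

theorem BTensor.exists_sum {A M N : Type u} [Ring A] [AddCommGroup M] [Module Aᵐᵒᵖ M]
    [AddCommGroup N] [Module A N] (t : BTensor A M N) :
    ∃ (ι : Type) (_ : Fintype ι) (x : ι → M) (y : ι → N), t = ∑ i, BTensor.mk A (x i) (y i) := by
  induction t using BTensor.induction with
  | h0 => exact ⟨Empty, inferInstance, Empty.elim, Empty.elim, by simp⟩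
  | hmk m n => exact ⟨Unit, inferInstance, fun _ => m, fun _ => n, by simp⟩
  | hadd s t hs ht =>
    obtain ⟨ι, _, x, y, rfl⟩ := hs
    obtain ⟨κ, _, x', y', rfl⟩ := ht
    exact ⟨ι ⊕ κ, inferInstance, Sum.elim x x', Sum.elim y y', by simp⟩

/-- By the counit property and the Frobenius identity, c = ∑ c₁ Bᵢ(c₂, dᵢ) = ∑ Bᵢ(c, dᵢ₁) dᵢ₂.
Writing each Δ(dᵢ) as a finite sum of pure tensors makes this a dual basis. -/
theorem CounitSumRight.isFGProjective (h : CounitSumRight A C) : IsFGProjective A C := by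
  obtain ⟨n, d, B, -, h⟩ := h
  choose ι hι x y hxy using fun i => BTensor.exists_sum (comul (d i) : BTensor A C C)
  refine .of_dualBasis (ι := Σ i, ι i) (fun p => y p.1 p.2) (fun p => (B p.1).left (x p.1 p.2))
    fun c => ?_
  rw [Fintype.sum_sigma]
  conv_rhs => rw [← LeftDualRing.act_one (A := A) c, ← sum_left_eq_one h, ← LeftDualRing.sum_act]
  refine Finset.sum_congr rfl fun i _ => ?_
  rw [(B i).frobenius, RightDualRing.act_apply, hxy, map_sum]
  rfl

/-- Read from the other side: c = ∑ Bᵢ(dᵢ, c₁) c₂ = ∑ dᵢ₁ Bᵢ(dᵢ₂, c). -/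
theorem CounitSumLeft.isFGProjective (h : CounitSumLeft A C) : IsFGProjective Aᵐᵒᵖ C := by
  obtain ⟨n, d, B, -, h⟩ := h
  choose ι hι x y hxy using fun i => BTensor.exists_sum (comul (d i) : BTensor A C C)
  refine .of_dualBasis_right (ι := Σ i, ι i) (fun p => x p.1 p.2)
    (fun p => (B p.1).right (y p.1 p.2)) fun c => ?_
  rw [Fintype.sum_sigma]
  conv_rhs => rw [← RightDualRing.act_one (A := A) c, ← sum_right_eq_one h, ← RightDualRing.sum_act]
  refine Finset.sum_congr rfl fun i _ => ?_
  rw [← (B i).frobenius]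
  refine Eq.trans ?_ (congrArg (LeftDualRing.contract ((B i).left c)) (hxy i)).symm
  rw [map_sum]
  rfl

/-! ### Bimodule maps between `C` and its duals -/

namespace LeftDualRing

/-- The Frobenius form `B(x, y) = f(y)(x)` of a bimodule map `f : C → *C`. -/
def formOf (h : IsFGProjective A C) (f : C →ₗ[A] LeftDualRing A C)
    (hf : ∀ (s : (LeftDualRing A C)ᵐᵒᵖ) c, f (s • c) = s • f c) : FrobeniusForm A C where
  form x y := f y x
  add_left x x' y := map_add (f y).lin x x'
  add_right x y y' := by rw [map_add]; rfl
  smul_left a x y := (f y).lin.map_smul a x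
  op_smul_right s x y := by
    -- The right A-action on C factors through `i`, so linearity of f over `*C` applies.
    have : s • y = op (i A C (unop s)) • y := (act_i (unop s) y).symm
    rw [this, hf]
    exact op_smul_apply (unop s) (f y) x
  balanced a x y :=
    (smul_apply a (f y) x).symm.trans (congrArg (fun t : LeftDualRing A C => t x) (f.map_smul a y).symm)
  frobenius x y := eq_of_leftDualRing_apply h fun g => by
    rw [BalancedForm.apply_act_right]
    exact (congrArg (fun t : LeftDualRing A C => t x) (hf (op g) y)).symm

/-- The bimodule map `y ↦ B(-, y)`. -/
def ofForm (B : FrobeniusForm A C) : C →ₗ[A] LeftDualRing A C where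
  toFun := B.left
  map_add' y y' := ext fun x => B.add_right x y y'
  map_smul' a y := ext fun x => (B.balanced a x y).symm.trans (smul_apply a (B.left y) x).symm

theorem ofForm_smul (B : FrobeniusForm A C) (s : (LeftDualRing A C)ᵐᵒᵖ) (c : C) :
    ofForm B (s • c) = s • ofForm B c := ext fun x => by
  change B.form x (act (unop s) c) = unop s (act (B.left c) x)
  rw [B.frobenius, BalancedForm.apply_act_right]

/-- The bimodule map `s ↦ d s`, for `d` central. -/
def mulLeft (d : C) (hd : ∀ a : A, a • d = op a • d) : LeftDualRing A C →ₗ[A] C where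
  toFun s := act s d
  map_add' s t := act_add s t d
  map_smul' a s := by
    change act (i A C a * s) d = a • act s d
    rw [act_mul, act_i, ← hd, map_smul]

theorem mulLeft_smul (d : C) (hd : ∀ a : A, a • d = op a • d) (s : (LeftDualRing A C)ᵐᵒᵖ)
    (t : LeftDualRing A C) : mulLeft d hd (s • t) = s • mulLeft d hd t :=
  act_mul t (unop s) d

/-- The unit of `*C` is central for the two A-actions, and bimodule maps preserve centrality. -/
theorem central_of_map (g : LeftDualRing A C →ₗ[A] C)
    (hg : ∀ (s : (LeftDualRing A C)ᵐᵒᵖ) t, g (s • t) = s • g t) (a : A) :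
    a • g 1 = op a • g 1 := by
  rw [← map_smul, ← op_smul_one]
  exact (hg (op (i A C a)) 1).trans (act_i a _)

theorem map_eq_act (g : LeftDualRing A C →ₗ[A] C)
    (hg : ∀ (s : (LeftDualRing A C)ᵐᵒᵖ) t, g (s • t) = s • g t) (s : LeftDualRing A C) :
    g s = act s (g 1) := by
  conv_lhs => rw [← one_mul s]
  exact hg (op s) 1

/-- A composite `*C` → C → `*C` built from d and B sends 1 to B(-, d). Being right `*C`-linear, a
sum of such composites is the identity as soon as it sends 1 to 1 = ε. -/
theorem self_divides_iff (h : IsFGProjective A C) :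
    BimodDivides A (LeftDualRing A C) (LeftDualRing A C) C ↔ CounitSumRight A C := by
  constructor
  · intro hs
    obtain ⟨n, f, g, hf, hg, hs⟩ := hs.exists_sum
    refine ⟨n, fun i => f i 1, fun i => formOf h (g i) (hg i),
      fun i => central_of_map (f i) (hf i), fun c => ?_⟩
    exact (sum_apply (fun i => g i (f i 1)) c).symm.trans
      (congrArg (fun t : LeftDualRing A C => t c) (hs 1))
  · rintro ⟨n, d, B, hd, hs⟩
    refine .of_sum (fun i => mulLeft (d i) (hd i)) (fun i => ofForm (B i))
      (fun i => mulLeft_smul (d i) (hd i)) (fun i => ofForm_smul (B i)) fun s => ?_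
    have : ∀ i, ofForm (B i) (mulLeft (d i) (hd i) s) = (B i).left (d i) * s := fun i =>
      ofForm_smul (B i) (op s) (d i)
    simp_rw [this]
    rw [← Finset.sum_mul, sum_left_eq_one hs, one_mul]

/-- A composite C → `*C` → C sends c to d₁ B(d₂, c) = B(d, c₁) c₂, and applying ε leaves B(d, c). -/
theorem divides_self_iff (h : IsFGProjective A C) :
    BimodDivides A (LeftDualRing A C) C (LeftDualRing A C) ↔ CounitSumLeft A C := by
  constructor
  · intro hs
    obtain ⟨n, f, g, hf, hg, hs⟩ := hs.exists_sum
    refine ⟨n, fun i => g i 1, fun i => formOf h (f i) (hf i),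
      fun i => central_of_map (g i) (hg i), fun c => ?_⟩
    conv_rhs => rw [← hs c, map_sum]
    refine Finset.sum_congr rfl fun i _ => ?_
    rw [map_eq_act (g i) (hg i), counit_act]; rfl
  · rintro ⟨n, d, B, hd, hs⟩
    refine .of_sum (fun i => ofForm (B i)) (fun i => mulLeft (d i) (hd i))
      (fun i => ofForm_smul (B i)) (fun i => mulLeft_smul (d i) (hd i)) fun c => ?_
    have : ∀ i, mulLeft (d i) (hd i) (ofForm (B i) c) = RightDualRing.act ((B i).right (d i)) c :=
      fun i => (B i).frobenius (d i) c
    simp_rw [this]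
    rw [RightDualRing.sum_act, sum_right_eq_one hs, RightDualRing.act_one]

end LeftDualRing

namespace RightDualRing

/-- The Frobenius form `B(x, y) = f(x)(y)` of a bimodule map `f : C → C*`. -/
def formOf (h : IsFGProjective Aᵐᵒᵖ C) (f : C →ₗ[RightDualRing A C] RightDualRing A C)
    (hf : ∀ (s : Aᵐᵒᵖ) c, f (s • c) = s • f c) : FrobeniusForm A C where
  form x y := f x y
  add_left x x' y := by rw [map_add]; rfl
  add_right x y y' := map_add (f x).lin y y'
  smul_left a x y := by
    have : a • x = i A C a • x := (act_i a x).symm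
    rw [this, map_smul]
    exact smul_apply a (f x) y
  op_smul_right s x y := (f x).lin.map_smul s y
  balanced a x y := by rw [hf, op_smul_apply]
  frobenius x y := eq_of_rightDualRing_apply h fun g => by
    rw [BalancedForm.apply_act_left]
    exact congrArg (fun t : RightDualRing A C => t y) (f.map_smul g x)

/-- The bimodule map `x ↦ B(x, -)`. -/
def ofForm (B : FrobeniusForm A C) : C →ₗ[RightDualRing A C] RightDualRing A C where
  toFun := B.right
  map_add' x x' := ext fun y => B.add_left x x' y
  map_smul' s x := ext fun y => by
    change B.form (act s x) y = s (act (B.right x) y)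
    rw [← B.frobenius, BalancedForm.apply_act_left]

theorem ofForm_op_smul (B : FrobeniusForm A C) (s : Aᵐᵒᵖ) (c : C) :
    ofForm B (s • c) = s • ofForm B c :=
  ext fun y => (B.balanced (unop s) c y).trans (op_smul_apply (unop s) (B.right c) y).symm

/-- The bimodule map `s ↦ s d`, for `d` central. -/
def mulRight (d : C) : RightDualRing A C →ₗ[RightDualRing A C] C :=
  LinearMap.toSpanSingleton _ _ d

theorem mulRight_op_smul (d : C) (hd : ∀ a : A, a • d = op a • d) (s : Aᵐᵒᵖ)
    (t : RightDualRing A C) : mulRight d (s • t) = s • mulRight d t := by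
  change act (t * i A C (unop s)) d = s • act t d
  rw [act_mul, act_i, hd, map_smul]; rfl

theorem central_of_map (g : RightDualRing A C →ₗ[RightDualRing A C] C)
    (hg : ∀ (s : Aᵐᵒᵖ) t, g (s • t) = s • g t) (a : A) : a • g 1 = op a • g 1 := by
  rw [← hg, op_smul_one]
  exact (act_i a _).symm.trans (g.map_smul (i A C a) 1).symm

theorem map_eq_act (g : RightDualRing A C →ₗ[RightDualRing A C] C) (s : RightDualRing A C) :
    g s = act s (g 1) := by
  conv_lhs => rw [← mul_one s]
  exact g.map_smul s 1

/-- Here 1 is sent to s ↦ B(d, s), with d in the left slot, because the maps C → `C*` are x ↦ B(x,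
-). So the two counit sums trade places compared with `*C`. -/
theorem self_divides_iff (h : IsFGProjective Aᵐᵒᵖ C) :
    BimodDivides (RightDualRing A C) A (RightDualRing A C) C ↔ CounitSumLeft A C := by
  constructor
  · intro hs
    obtain ⟨n, f, g, hf, hg, hs⟩ := hs.exists_sum
    refine ⟨n, fun i => f i 1, fun i => formOf h (g i) (hg i),
      fun i => central_of_map (f i) (hf i), fun c => ?_⟩
    exact (sum_apply (fun i => g i (f i 1)) c).symm.trans
      ((congrArg (fun t : RightDualRing A C => t c) (hs 1)).trans (counitR_eq c))
  · rintro ⟨n, d, B, hd, hs⟩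
    refine .of_sum (fun i => mulRight (d i)) (fun i => ofForm (B i))
      (fun i => mulRight_op_smul (d i) (hd i)) (fun i => ofForm_op_smul (B i)) fun s => ?_
    have : ∀ i, ofForm (B i) (mulRight (d i) s) = s * (B i).right (d i) := fun i =>
      (ofForm (B i)).map_smul s (d i)
    simp_rw [this]
    rw [← Finset.mul_sum, sum_right_eq_one hs, mul_one]

/-- The composite C → `C*` → C sends c to B(c, d₁) d₂ = c₁ B(c₂, d), and applying ε leaves B(c, d).
-/
theorem divides_self_iff (h : IsFGProjective Aᵐᵒᵖ C) :
    BimodDivides (RightDualRing A C) A C (RightDualRing A C) ↔ CounitSumRight A C := by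
  constructor
  · intro hs
    obtain ⟨n, f, g, hf, hg, hs⟩ := hs.exists_sum
    refine ⟨n, fun i => g i 1, fun i => formOf h (f i) (hf i),
      fun i => central_of_map (g i) (hg i), fun c => ?_⟩
    rw [← counitR_eq]
    conv_rhs => rw [← hs c, map_sum]
    refine Finset.sum_congr rfl fun i _ => ?_
    rw [map_eq_act (g i), counit_act]; rfl
  · rintro ⟨n, d, B, hd, hs⟩
    refine .of_sum (fun i => ofForm (B i)) (fun i => mulRight (d i))
      (fun i => ofForm_op_smul (B i)) (fun i => mulRight_op_smul (d i) (hd i)) fun c => ?_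
    have : ∀ i, mulRight (d i) (ofForm (B i) c) = LeftDualRing.act ((B i).left (d i)) c :=
      fun i => ((B i).frobenius c (d i)).symm
    simp_rw [this]
    rw [LeftDualRing.sum_act, sum_left_eq_one hs, LeftDualRing.act_one]

end RightDualRing

/-- The right-hand side mentions no dual ring, which is what links `*C` to `C*`. From right to left,
`CounitSumRight` supplies the projectivity on which the dictionary between bimodule maps and forms
depends. -/
theorem similar_leftDualRing_iff :
    IsFGProjective A C ∧ BimodSimilar A (LeftDualRing A C) C (LeftDualRing A C) ↔
      CounitSumRight A C ∧ CounitSumLeft A C := by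
  constructor
  · rintro ⟨h, h₁, h₂⟩
    exact ⟨(LeftDualRing.self_divides_iff h).1 h₂, (LeftDualRing.divides_self_iff h).1 h₁⟩
  · rintro ⟨h₁, h₂⟩
    have h := h₁.isFGProjective
    exact ⟨h, (LeftDualRing.divides_self_iff h).2 h₂, (LeftDualRing.self_divides_iff h).2 h₁⟩

theorem similar_rightDualRing_iff :
    IsFGProjective Aᵐᵒᵖ C ∧ BimodSimilar (RightDualRing A C) A C (RightDualRing A C) ↔
      CounitSumRight A C ∧ CounitSumLeft A C := by
  constructor
  · rintro ⟨h, h₁, h₂⟩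
    exact ⟨(RightDualRing.divides_self_iff h).1 h₁, (RightDualRing.self_divides_iff h).1 h₂⟩
  · rintro ⟨h₁, h₂⟩
    have h := h₂.isFGProjective
    exact ⟨h, (RightDualRing.divides_self_iff h).2 h₁, (RightDualRing.self_divides_iff h).2 h₂⟩

end Forms

end QF

namespace QF

theorem moduleCat_sum_apply {R : Type u} [Ring R] {M N : ModuleCat.{u} R} {ι : Type*}
    (s : Finset ι) (f : ι → (M ⟶ N)) (m : M) : (∑ i ∈ s, f i).hom m = ∑ i ∈ s, (f i).hom m := by
  rw [ModuleCat.hom_sum, LinearMap.sum_apply]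

/-! ## Additivity of the tensor product -/

namespace BTensor

variable {A M M' M'' N N' P : Type u} [Ring A]
  [AddCommGroup M] [Module Aᵐᵒᵖ M] [AddCommGroup M'] [Module Aᵐᵒᵖ M']
  [AddCommGroup N] [Module A N] [AddCommGroup N'] [Module A N'] [AddCommGroup P] [Module A P]

/-- `f ↦ f ⊗ g` as an additive map. -/
def mapLeftHom (M M' : Type u) [AddCommGroup M] [Module Aᵐᵒᵖ M] [AddCommGroup M'] [Module Aᵐᵒᵖ M']
    (g : N →ₗ[A] N') : (M →ₗ[Aᵐᵒᵖ] M') →+ (BTensor A M N →+ BTensor A M' N') :=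
  AddMonoidHom.mk' (fun f => map f g) fun f f' => hom_ext fun m n => mk_add_left A (f m) (f' m) (g n)

/-- `g ↦ f ⊗ g` as an additive map. -/
def mapRightHom (N N' : Type u) [AddCommGroup N] [Module A N] [AddCommGroup N'] [Module A N']
    (f : M →ₗ[Aᵐᵒᵖ] M') : (N →ₗ[A] N') →+ (BTensor A M N →+ BTensor A M' N') :=
  AddMonoidHom.mk' (fun g => map f g) fun g g' =>
    hom_ext fun m n => mk_add_right A (f m) (g n) (g' n)

theorem sum_map_left {ι : Type*} (s : Finset ι) (f : ι → M →ₗ[Aᵐᵒᵖ] M') (g : N →ₗ[A] N')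
    (t : BTensor A M N) : ∑ i ∈ s, map (f i) g t = map (∑ i ∈ s, f i) g t :=
  (AddMonoidHom.finsetSum_apply (fun i => map (f i) g) s t).symm.trans
    (DFunLike.congr_fun (map_sum (mapLeftHom M M' g) f s).symm t)

theorem sum_map_right {ι : Type*} (s : Finset ι) (f : M →ₗ[Aᵐᵒᵖ] M') (g : ι → N →ₗ[A] N')
    (t : BTensor A M N) : ∑ i ∈ s, map f (g i) t = map f (∑ i ∈ s, g i) t :=
  (AddMonoidHom.finsetSum_apply (fun i => map f (g i)) s t).symm.trans
    (DFunLike.congr_fun (map_sum (mapRightHom N N' f) g s).symm t)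

theorem rid_map (f : M →ₗ[Aᵐᵒᵖ] M') (g : N →ₗ[A] A) (t : BTensor A M N) :
    rid A M' (map f g t) = f (rid A M (map LinearMap.id g t)) := by
  induction t using BTensor.induction with
  | h0 => simp
  | hmk m n => exact (f.map_smul _ _).symm
  | hadd x y hx hy => simp only [map_add, hx, hy]

theorem lid_map (f : M →ₗ[Aᵐᵒᵖ] A) (g : N →ₗ[A] N') (t : BTensor A M N) :
    lid A N' (map f g t) = g (lid A N (map f LinearMap.id t)) := by
  induction t using BTensor.induction with
  | h0 => simp
  | hmk m n => exact (g.map_smul _ _).symm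
  | hadd x y hx hy => simp only [map_add, hx, hy]

/-- Every element of A ⊗ N is thus of the form 1 ⊗ n; this is how the central element of a
transformation is extracted. -/
theorem mk_one_lid (t : BTensor A A N) : mk A 1 (lid A N t) = t := by
  induction t using BTensor.induction with
  | h0 => simp
  | hmk a n => rw [lid_mk, ← mk_smul, op_smul_eq_mul, one_mul]
  | hadd x y hx hy => rw [map_add, mk_add_right, hx, hy]

theorem mk_rid_one (t : BTensor A M A) : mk A (rid A M t) 1 = t := by
  induction t using BTensor.induction with
  | h0 => simp
  | hmk m a => rw [rid_mk, mk_smul, smul_eq_mul, mul_one]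
  | hadd x y hx hy => rw [map_add, mk_add_left, hx, hy]

end BTensor

/-! ## The category of right comodules -/

namespace RightComodule

open BTensor Coring Limits

variable {A C : Type u} [Ring A] [AddCommGroup C] [Module A C] [Module Aᵐᵒᵖ C]
  [SMulCommClass A Aᵐᵒᵖ C]

theorem assoc_map_mapLin {N N' : Type u} [AddCommGroup N] [Module Aᵐᵒᵖ N] [AddCommGroup N']
    [Module Aᵐᵒᵖ N'] (f : N →ₗ[Aᵐᵒᵖ] N') (t : BTensor A (BTensor A N C) C) :
    assoc A N' C C (map (mapLin A C f) LinearMap.id t) =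
      map f LinearMap.id (assoc A N C C t) := by
  induction t using BTensor.induction with
  | h0 => simp
  | hmk x c =>
    induction x using BTensor.induction with
    | h0 => simp
    | hmk n d => rfl
    | hadd x y hx hy => simp only [mk_add_left, map_add, hx, hy]
  | hadd x y hx hy => simp only [map_add, hx, hy]

variable [Coring A C]

/-- The colinear maps, as a subgroup of the linear maps. -/
def colinearMaps (M N : RightComodule A C) : AddSubgroup (M.carrier →ₗ[Aᵐᵒᵖ] N.carrier) where
  carrier := {f | ∀ m, N.coact (f m) = map f LinearMap.id (M.coact m)}
  zero_mem' m := (map_zero N.coact).trans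
    (DFunLike.congr_fun (map_zero (mapLeftHom M.carrier N.carrier LinearMap.id)) (M.coact m)).symm
  add_mem' {f g} hf hg m := ((map_add N.coact _ _).trans (congrArg₂ (· + ·) (hf m) (hg m))).trans
    (DFunLike.congr_fun (map_add (mapLeftHom M.carrier N.carrier LinearMap.id) f g)
      (M.coact m)).symm
  neg_mem' {f} hf m := ((map_neg N.coact _).trans (congrArg Neg.neg (hf m))).trans
    (DFunLike.congr_fun (map_neg (mapLeftHom M.carrier N.carrier LinearMap.id) f) (M.coact m)).symm

/-- Morphisms of comodules are colinear maps. -/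
def homEquiv (M N : RightComodule A C) : (M ⟶ N) ≃ colinearMaps M N where
  toFun f := ⟨Hom.lin f, Hom.colinear f⟩
  invFun f := ⟨f.1, f.2⟩

instance (M N : RightComodule A C) : AddCommGroup (M ⟶ N) := (homEquiv M N).addCommGroup

/-- The underlying linear map, as an additive map. -/
def linHom (M N : RightComodule A C) : (M ⟶ N) →+ (M.carrier →ₗ[Aᵐᵒᵖ] N.carrier) where
  toFun := Hom.lin
  map_zero' := rfl
  map_add' _ _ := rfl

theorem linHom_sum_apply {M N : RightComodule A C} {ι : Type*} (s : Finset ι) (f : ι → (M ⟶ N))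
    (m : M.carrier) : linHom M N (∑ i ∈ s, f i) m = ∑ i ∈ s, Hom.lin (f i) m := by
  rw [map_sum, LinearMap.sum_apply]; rfl

instance : Preadditive (RightComodule A C) where
  add_comp _ _ _ f f' g := Hom.ext (LinearMap.comp_add (Hom.lin f) (Hom.lin f') (Hom.lin g))
  comp_add _ _ _ f g g' := Hom.ext (LinearMap.add_comp (Hom.lin f) (Hom.lin g') (Hom.lin g))

/-! ### Comodule structures on retracts of finite sums -/

section Glue

variable {J : Type} [Fintype J] (M : J → RightComodule A C) {N : Type u} [AddCommGroup N]
  [Module Aᵐᵒᵖ N] (p : ∀ j, (M j).carrier →ₗ[Aᵐᵒᵖ] N) (i : ∀ j, N →ₗ[Aᵐᵒᵖ] (M j).carrier)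

/-- The coaction induced on a retract of a finite sum of comodules. -/
def glueCoact : N →ₗ[Aᵐᵒᵖ] BTensor A N C :=
  ∑ j, mapLin A C (p j) ∘ₗ (M j).coact ∘ₗ i j

variable {M p i}

theorem glueCoact_apply (n : N) :
    glueCoact M p i n = ∑ j, map (p j) LinearMap.id ((M j).coact (i j n)) :=
  LinearMap.sum_apply _ _ _

/-- The hypothesis `hpi` says that every composite i_k p_j is colinear. It moves the sum inside one
tensor factor, where ∑ p_j i_j = 1 removes it. -/
theorem glueCoact_proj (hip : ∀ n, ∑ j, p j (i j n) = n)
    (hpi : ∀ j k m, (M k).coact (i k (p j m)) = map (i k ∘ₗ p j) LinearMap.id ((M j).coact m))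
    (k : J) (m : (M k).carrier) :
    glueCoact M p i (p k m) = map (p k) LinearMap.id ((M k).coact m) := by
  rw [glueCoact_apply]
  simp_rw [hpi, map_map, LinearMap.id_comp]
  rw [sum_map_left]
  congr 2
  ext x
  simpa [LinearMap.sum_apply] using hip (p k x)

theorem coact_glue_inj (hip : ∀ n, ∑ j, p j (i j n) = n)
    (hpi : ∀ j k m, (M k).coact (i k (p j m)) = map (i k ∘ₗ p j) LinearMap.id ((M j).coact m))
    (k : J) (n : N) :
    (M k).coact (i k n) = map (i k) LinearMap.id (glueCoact M p i n) := by
  conv_lhs => rw [← hip n, map_sum, map_sum]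
  rw [glueCoact_apply, map_sum]
  simp_rw [hpi, map_map, LinearMap.id_comp]

/-- A retract of a finite sum of comodules, as a comodule. -/
def glue (hip : ∀ n, ∑ j, p j (i j n) = n)
    (hpi : ∀ j k m, (M k).coact (i k (p j m)) = map (i k ∘ₗ p j) LinearMap.id ((M j).coact m)) :
    RightComodule A C where
  carrier := N
  coact := glueCoact M p i
  coassoc n := by
    rw [← hip n]
    simp only [map_sum]
    refine Finset.sum_congr rfl fun j _ => ?_
    rw [glueCoact_proj hip hpi, map_map, map_map]
    have h : glueCoact M p i ∘ₗ p j = mapLin A C (p j) ∘ₗ (M j).coact :=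
      LinearMap.ext (glueCoact_proj hip hpi j)
    have h' := congrArg (map (p j) LinearMap.id) ((M j).coassoc (i j n))
    rw [← assoc_map_mapLin, map_map, map_map] at h'
    rw [h]
    exact h'
  coact_counit n := by
    rw [← hip n]
    simp only [map_sum]
    refine Finset.sum_congr rfl fun j _ => ?_
    rw [glueCoact_proj hip hpi, map_map, LinearMap.id_comp, LinearMap.comp_id, rid_map,
      (M j).coact_counit]

end Glue

/-- The image of e is split off as a module; being a retract of M with colinear composite e, it
inherits a coaction by gluing over one index. -/
instance : IsIdempotentComplete (RightComodule A C) where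
  idempotents_split M e he := by
    have he' : Hom.lin e ∘ₗ Hom.lin e = Hom.lin e := congrArg Hom.lin he
    let p : M.carrier →ₗ[Aᵐᵒᵖ] LinearMap.range (Hom.lin e) := (Hom.lin e).rangeRestrict
    let i : LinearMap.range (Hom.lin e) →ₗ[Aᵐᵒᵖ] M.carrier := Submodule.subtype _
    have h₁ : ∀ n, p (i n) = n := by
      rintro ⟨_, x, rfl⟩
      exact Subtype.ext (LinearMap.congr_fun he' x)
    have h₂ : i ∘ₗ p = Hom.lin e := rfl
    have hip : ∀ n, ∑ j : Unit, p (i n) = n := fun n => by simpa using h₁ n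
    have hpi : ∀ j k : Unit, ∀ m, M.coact (i (p m)) = map (i ∘ₗ p) LinearMap.id (M.coact m) :=
      fun _ _ m => Hom.colinear e m
    refine ⟨glue (M := fun _ : Unit => M) hip hpi,
      ⟨i, fun n => coact_glue_inj (M := fun _ : Unit => M) hip hpi () n⟩,
      ⟨p, fun m => glueCoact_proj (M := fun _ : Unit => M) hip hpi () m⟩,
      Hom.ext (LinearMap.ext h₁), Hom.ext h₂⟩

instance : HasFiniteBiproducts (RightComodule A C) where
  out n :=
    { has_biproduct := fun M => by
        classical
        let p (j : Fin n) : (M j).carrier →ₗ[Aᵐᵒᵖ] (∀ j, (M j).carrier) :=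
          LinearMap.single _ (fun j => (M j).carrier) j
        let i (j : Fin n) : (∀ j, (M j).carrier) →ₗ[Aᵐᵒᵖ] (M j).carrier := LinearMap.proj j
        have hip : ∀ n, ∑ j, p j (i j n) = n := fun n => Finset.univ_sum_single n
        have hne : ∀ j k, j ≠ k → i k ∘ₗ p j = 0 := fun j k h => by
          ext x; simp [i, p, Pi.single_eq_of_ne h.symm]
        have heq : ∀ j, i j ∘ₗ p j = LinearMap.id := fun j => by ext x; simp [i, p]
        have hpi : ∀ j k m, (M k).coact (i k (p j m)) =
            map (i k ∘ₗ p j) LinearMap.id ((M j).coact m) := fun j k m => by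
          by_cases h : j = k
          · subst h
            rw [heq, map_id]
            exact congrArg (M j).coact (LinearMap.congr_fun (heq j) m)
          · rw [hne j k h]
            exact (congrArg (M k).coact (LinearMap.congr_fun (hne j k h) m)).trans
              ((map_zero _).trans (DFunLike.congr_fun
                (map_zero (mapLeftHom (M j).carrier (M k).carrier LinearMap.id))
                ((M j).coact m)).symm)
        let b : Bicone M :=
          { pt := glue hip hpi
            π := fun k => ⟨i k, coact_glue_inj hip hpi k⟩
            ι := fun k => ⟨p k, glueCoact_proj hip hpi k⟩
            ι_π := fun j k => by
              split_ifs with h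
              · subst h; exact Hom.ext (heq j)
              · exact Hom.ext (hne j k h) }
        exact hasBiproduct_of_total b (Hom.ext (LinearMap.ext fun n =>
          (linHom_sum_apply _ _ n).trans (hip n))) }

variable (A C)

instance : (forget A C).Additive where
  map_add := rfl

instance : (induction A C).Additive where
  map_add {N N'} f g := Hom.ext (LinearMap.ext fun t =>
    DFunLike.congr_fun (map_add (mapLeftHom (N := C) N N' LinearMap.id) f.hom g.hom) t)

theorem assoc_symm_comul_coact (M : RightComodule A C) (m : M.carrier) :
    (assoc A M.carrier C C).symm (map LinearMap.id comul (M.coact m)) =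
      map M.coact LinearMap.id (M.coact m) := by
  rw [← M.coassoc, AddEquiv.symm_apply_apply]

/-- The coaction as a colinear map `M → M ⊗ C`. -/
def coactHom (M : RightComodule A C) : M ⟶ induced A C M.carrier :=
  ⟨M.coact, assoc_symm_comul_coact A C M⟩

/-- The map `n ⊗ c ↦ n ε(c)`. -/
def counitLin (N : Type u) [AddCommGroup N] [Module Aᵐᵒᵖ N] : BTensor A N C →ₗ[Aᵐᵒᵖ] N where
  toFun t := rid A N (map LinearMap.id counit t)
  map_add' x y := by rw [map_add, map_add]
  map_smul' s t := by
    induction t using BTensor.induction with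
    | h0 => simp
    | hmk n c =>
      rw [op_smul_mk, map_mk, map_mk, rid_mk, rid_mk, counit_op_smul]
      exact mul_smul s _ _
    | hadd x y hx hy => simp only [smul_add, map_add, hx, hy]

theorem counitLin_map {N N' : Type u} [AddCommGroup N] [Module Aᵐᵒᵖ N] [AddCommGroup N']
    [Module Aᵐᵒᵖ N'] (f : N →ₗ[Aᵐᵒᵖ] N') (t : BTensor A N C) :
    counitLin A C N' (map f LinearMap.id t) = f (counitLin A C N t) := by
  change rid A N' (map LinearMap.id counit (map f LinearMap.id t)) = _
  rw [map_map, LinearMap.id_comp, LinearMap.comp_id, rid_map]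
  rfl

theorem map_counitLin_comul {N : Type u} [AddCommGroup N] [Module Aᵐᵒᵖ N] (t : BTensor A N C) :
    map (counitLin A C N) LinearMap.id ((assoc A N C C).symm (map LinearMap.id comul t)) = t := by
  induction t using BTensor.induction with
  | h0 => simp
  | hmk n c =>
    rw [map_mk, assoc_symm_mk, map_map]
    have key : ∀ x : BTensor A C C,
        map (counitLin A C N ∘ₗ mkRight n) (LinearMap.id ∘ₗ LinearMap.id) x =
          BTensor.mk A n (lid A C (map counitR LinearMap.id x)) := by
      intro x
      induction x using BTensor.induction with
      | h0 => simp
      | hmk d e =>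
        rw [map_mk, map_mk, lid_mk, ← mk_smul, counitR_eq]; rfl
      | hadd x y hx hy => simp only [map_add, mk_add_right, hx, hy]
    refine (key _).trans ?_
    rw [counit_comul]
  | hadd x y hx hy => simp only [map_add, hx, hy]

/-- The forgetful functor is left adjoint to induction. -/
def adjunction : forget A C ⊣ induction A C := Adjunction.mkOfUnitCounit
  { unit :=
      { app := fun M => coactHom A C M
        naturality := fun _ _ f => Hom.ext (LinearMap.ext fun m => Hom.colinear f m) }
    counit :=
      { app := fun N => ModuleCat.ofHom (counitLin A C N)
        naturality := fun _ _ f =>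
          ModuleCat.hom_ext (LinearMap.ext fun t => counitLin_map A C f.hom t) }
    left_triangle := NatTrans.ext (funext fun M =>
      ModuleCat.hom_ext (LinearMap.ext fun m : M.carrier => M.coact_counit m))
    right_triangle := NatTrans.ext (funext fun _ =>
      Hom.ext (LinearMap.ext fun t => map_counitLin_comul A C t)) }

/-- The coring as a right comodule over itself. -/
def regular : RightComodule A C where
  carrier := C
  coact := comulR
  coassoc c := by rw [comulR_eq]; exact Coring.coassoc c
  coact_counit c := by rw [comulR_eq]; exact comul_counit c

variable {A C}

/-- Left multiplication by `a`, as a colinear map. -/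
def lmulHom (a : A) : regular A C ⟶ regular A C :=
  ⟨DistribSMul.toLinearMap Aᵐᵒᵖ C a, fun c => comulR_smul A C a c⟩

/-- `c ↦ n ⊗ c`, as a colinear map. -/
def mkRightHom {N : Type u} [AddCommGroup N] [Module Aᵐᵒᵖ N] (n : N) :
    regular A C ⟶ induced A C N :=
  ⟨(mkRight n : C →ₗ[Aᵐᵒᵖ] BTensor A N C), fun c : C =>
    (assoc_symm_mk n (comul c)).trans (congrArg (map (mkRight n) LinearMap.id) (comulR_eq c).symm)⟩

/-! ### From natural transformations to forms -/

section Trans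

variable (θ : forget A C ⋙ induction A C ⟶ 𝟭 (RightComodule A C))

/-- The components `M ⊗ C → M` of a transformation. -/
def transLin (M : RightComodule A C) : BTensor A M.carrier C →ₗ[Aᵐᵒᵖ] M.carrier :=
  Hom.lin (θ.app M)

theorem coact_transLin (M : RightComodule A C) (t : BTensor A M.carrier C) :
    M.coact (transLin θ M t) = map (transLin θ M) LinearMap.id
      ((assoc A M.carrier C C).symm (map LinearMap.id comul t)) :=
  Hom.colinear (θ.app M) t

theorem transLin_map {M N : RightComodule A C} (f : M ⟶ N) (t : BTensor A M.carrier C) :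
    transLin θ N (map (Hom.lin f) LinearMap.id t) = Hom.lin f (transLin θ M t) :=
  LinearMap.congr_fun (congrArg Hom.lin (θ.naturality f)) t

/-- The map `C ⊗ C → C` of a transformation. -/
def transReg : BTensor A C C →ₗ[Aᵐᵒᵖ] C := transLin θ (regular A C)

/-- Left multiplication by a is an endomorphism of the regular comodule, so this is naturality of θ.
-/
theorem transReg_smul (a : A) (x y : C) :
    transReg θ (BTensor.mk A (a • x) y) = a • transReg θ (BTensor.mk A x y) :=
  transLin_map θ (lmulHom a) (BTensor.mk A x y)

/-- The component of a transformation at an induced comodule. -/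
def transInduced (N : Type u) [AddCommGroup N] [Module Aᵐᵒᵖ N] :
    BTensor A (BTensor A N C) C →ₗ[Aᵐᵒᵖ] BTensor A N C := transLin θ (induced A C N)

/-- Naturality along c ↦ n ⊗ c reduces θ on induced comodules to θ on the regular one. -/
theorem transInduced_mk {N : Type u} [AddCommGroup N] [Module Aᵐᵒᵖ N] (n : N) (x y : C) :
    transInduced θ N (BTensor.mk A (BTensor.mk A n x) y) =
      BTensor.mk A n (transReg θ (BTensor.mk A x y)) :=
  transLin_map θ (mkRightHom n) (BTensor.mk A x y)

/-- The map `x ↦ θ(x ⊗ y)`. -/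
def transLeft (y : C) : C →ₗ[A] C where
  toFun x := transReg θ (BTensor.mk A x y)
  map_add' x x' := by rw [mk_add_left, map_add]
  map_smul' a x := transReg_smul θ a x y

/-- Colinearity of θ_C gives Δθ(x ⊗ y) = θ(x ⊗ y₁) ⊗ y₂; the counit is then applied to the first
factor. -/
theorem transReg_eq_right (x y : C) : transReg θ (BTensor.mk A x y) =
    lid A C (map (counitR ∘ₗ transReg θ ∘ₗ mkRight x) LinearMap.id (comul y)) := by
  have h : comulR (transReg θ (BTensor.mk A x y)) =
      map (transReg θ) LinearMap.id (map (mkRight x) LinearMap.id (comul y)) :=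
    coact_transLin θ (regular A C) (BTensor.mk A x y)
  rw [← counit_comul (A := A) (transReg θ (BTensor.mk A x y)), ← comulR_eq, h, map_map, map_map]
  rfl

/-- Naturality of θ along the colinear map Δ : C → C ⊗ C gives Δθ(x ⊗ y) = x₁ ⊗ θ(x₂ ⊗ y); the
counit is applied to the second factor. -/
theorem transReg_eq_left (x y : C) : transReg θ (BTensor.mk A x y) =
    rid A C (map LinearMap.id (counit ∘ₗ transLeft θ y) (comul x)) := by
  have h₁ : ∀ t : BTensor A C C, transInduced θ C (BTensor.mk A t y) =
      map LinearMap.id (transLeft θ y) t := by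
    intro t
    induction t using BTensor.induction with
    | h0 => rw [mk_zero_left, map_zero, map_zero]
    | hmk x z => exact transInduced_mk θ x z y
    | hadd s t hs ht => rw [mk_add_left, map_add, map_add, hs, ht]
  have h₂ : comulR (transReg θ (BTensor.mk A x y)) =
      map LinearMap.id (transLeft θ y) (comulR x) :=
    (transLin_map θ (coactHom A C (regular A C)) (BTensor.mk A x y)).symm.trans (h₁ (comulR x))
  rw [← comul_counit (A := A) (transReg θ (BTensor.mk A x y)), ← comulR_eq, h₂, comulR_eq,
    map_map]
  rfl

/-- The Frobenius form `ε(θ(x ⊗ y))` of a transformation. -/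
def formOfTrans : FrobeniusForm A C where
  form x y := counit (transReg θ (BTensor.mk A x y))
  add_left x x' y := by rw [mk_add_left, map_add, map_add]
  add_right x y y' := by rw [mk_add_right, map_add, map_add]
  smul_left a x y := by rw [transReg_smul, map_smul]; rfl
  op_smul_right s x y := by rw [← op_smul_mk, map_smul, counit_op_smul]
  balanced a x y := by rw [mk_smul]
  frobenius x y := by
    -- Both sides of the Frobenius identity equal θ(x ⊗ y).
    refine Eq.trans (transReg_eq_left θ x y).symm ((transReg_eq_right θ x y).trans ?_)
    rw [RightDualRing.act_apply]
    refine congrArg (fun f => lid A C (map f LinearMap.id (comul y))) ?_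
    exact LinearMap.ext fun z => counitR_eq _

variable (δ : 𝟭 (ModuleCat.{u} Aᵐᵒᵖ) ⟶ induction A C ⋙ forget A C)

/-- The components `N → N ⊗ C` of a transformation. -/
def unitLin (N : Type u) [AddCommGroup N] [Module Aᵐᵒᵖ N] : N →ₗ[Aᵐᵒᵖ] BTensor A N C :=
  (δ.app (ModuleCat.of Aᵐᵒᵖ N)).hom

theorem unitLin_map {N N' : Type u} [AddCommGroup N] [Module Aᵐᵒᵖ N] [AddCommGroup N']
    [Module Aᵐᵒᵖ N'] (f : N →ₗ[Aᵐᵒᵖ] N') (n : N) :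
    unitLin δ N' (f n) = map f LinearMap.id (unitLin δ N n) :=
  LinearMap.congr_fun (congrArg ModuleCat.Hom.hom (δ.naturality (ModuleCat.ofHom f))) n

/-- The element `d` with `δ(n) = n ⊗ d`. -/
def elementOfTrans : C := lid A C (unitLin δ A 1)

/-- The map `a ↦ n a`. -/
def spanRight {N : Type u} [AddCommGroup N] [Module Aᵐᵒᵖ N] (n : N) : A →ₗ[Aᵐᵒᵖ] N where
  toFun a := op a • n
  map_add' a b := by rw [MulOpposite.op_add, add_smul]
  map_smul' s a := mul_smul s (op a) n

/-- Each n is the image of 1 under a linear map A → N, so naturality determines δ by its value at 1.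
-/
theorem unitLin_apply {N : Type u} [AddCommGroup N] [Module Aᵐᵒᵖ N] (n : N) :
    unitLin δ N n = BTensor.mk A n (elementOfTrans δ) := by
  have h := unitLin_map δ (spanRight n) 1
  rw [← mk_one_lid (unitLin δ A 1), map_mk] at h
  change unitLin δ N (op (1 : A) • n) = BTensor.mk A (op (1 : A) • n) (elementOfTrans δ) at h
  rwa [MulOpposite.op_one, one_smul] at h

/-- Linearity of δ on A equates a ⊗ d = 1 ⊗ a d with (1 ⊗ d) a = 1 ⊗ d a. -/
theorem elementOfTrans_central (a : A) :
    a • elementOfTrans δ = op a • elementOfTrans δ := by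
  have h := (unitLin δ A).map_smul (op a) 1
  rw [unitLin_apply, unitLin_apply, mk_smul, op_smul_mk] at h
  simpa using congrArg (lid A C) h

end Trans

/-- At the regular comodule the triangle sum reads ∑ θᵢ(c ⊗ dᵢ) = c; applying ε gives the counit
sum. -/
theorem counitSumRight_of_sumsToId (h : SumsToIdRight (forget A C) (induction A C)) :
    CounitSumRight A C := by
  obtain ⟨n, δ, θ, h⟩ := h
  refine ⟨n, fun i => elementOfTrans (δ i), fun i => formOfTrans (θ i),
    fun i => elementOfTrans_central (δ i), fun c => ?_⟩
  have h' := LinearMap.congr_fun (congrArg ModuleCat.Hom.hom (h (regular A C))) c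
  have h'' : ∑ i, transReg (θ i) (unitLin (δ i) C c) = c :=
    (moduleCat_sum_apply Finset.univ (fun i => (δ i).app ((forget A C).obj (regular A C)) ≫
      (forget A C).map ((θ i).app (regular A C))) c).symm.trans h'
  conv_rhs => rw [← h'', map_sum]
  simp_rw [unitLin_apply]
  rfl

/-- At the module A the triangle composite sends 1 ⊗ c to 1 ⊗ dᵢ ⊗ c and then to 1 ⊗ θᵢ(dᵢ ⊗ c), so
the central element lands in the left slot. -/
theorem counitSumLeft_of_sumsToId (h : SumsToIdLeft (forget A C) (induction A C)) :
    CounitSumLeft A C := by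
  obtain ⟨n, δ, θ, h⟩ := h
  refine ⟨n, fun i => elementOfTrans (δ i), fun i => formOfTrans (θ i),
    fun i => elementOfTrans_central (δ i), fun c => ?_⟩
  have h' := LinearMap.congr_fun (congrArg (linHom (induced A C A) (induced A C A))
    (h (ModuleCat.of Aᵐᵒᵖ A))) (BTensor.mk A (1 : A) c)
  have h'' : ∑ i, transInduced (θ i) A (BTensor.mk A (unitLin (δ i) A 1) c) =
      BTensor.mk A 1 c := (linHom_sum_apply _ _ _).symm.trans h'
  simp_rw [unitLin_apply, transInduced_mk] at h''
  have h₃ := congrArg (lid A C) h''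
  rw [map_sum] at h₃
  simp_rw [lid_mk, one_smul] at h₃
  conv_rhs => rw [← h₃, map_sum]
  rfl

/-! ### From forms to natural transformations -/

section Forms

theorem coact_rid (M : RightComodule A C) (f : LeftDualRing A C) (t : BTensor A M.carrier C) :
    M.coact (rid A M.carrier (map LinearMap.id f.lin t)) =
      map LinearMap.id (LeftDualRing.contract f)
        (assoc A M.carrier C C (map M.coact LinearMap.id t)) := by
  induction t using BTensor.induction with
  | h0 => simp
  | hmk m x =>
    rw [map_mk, rid_mk, map_smul, map_mk, assoc_mk, map_map]
    change op (f x) • M.coact m =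
      map LinearMap.id (LeftDualRing.contract f ∘ₗ mkLeft x) (M.coact m)
    induction M.coact m using BTensor.induction with
    | h0 => simp
    | hmk m y => rfl
    | hadd x y hx hy => rw [smul_add, map_add, hx, hy]
  | hadd x y hx hy => simp only [map_add, hx, hy]

/-- By coassociativity both sides are m₀ ⊗ m₁ f(m₂). -/
theorem coact_rid_coact (M : RightComodule A C) (f : LeftDualRing A C) (m : M.carrier) :
    M.coact (rid A M.carrier (map LinearMap.id f.lin (M.coact m))) =
      map LinearMap.id (LeftDualRing.act f) (M.coact m) := by
  rw [coact_rid, M.coassoc, map_map]; rfl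

variable (B : FrobeniusForm A C)

/-- The map `m ⊗ c ↦ m₀ B(m₁, c)`. -/
def pairLin (M : RightComodule A C) : BTensor A M.carrier C →ₗ[Aᵐᵒᵖ] M.carrier where
  toFun := lift (biadd
      (fun m c => rid A M.carrier (map LinearMap.id (B.left c).lin (M.coact m)))
      (fun m m' c => by rw [map_add, map_add, map_add])
      (fun m c c' => by
        have h : (B.left (c + c')).lin = (B.left c).lin + (B.left c').lin :=
          LinearMap.ext fun x => B.add_right x c c'
        rw [h, ← map_add]
        exact congrArg (rid A M.carrier) (DFunLike.congr_fun
          (map_add (mapRightHom C A (LinearMap.id (M := M.carrier))) _ _) (M.coact m))))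
    (fun m a c => by
      change rid A M.carrier (map LinearMap.id (B.left c).lin (M.coact (op a • m))) =
        rid A M.carrier (map LinearMap.id (B.left (a • c)).lin (M.coact m))
      rw [map_smul]
      induction M.coact m using BTensor.induction with
      | h0 => simp
      | hmk m x => exact congrArg (fun b => op b • m) (B.balanced a x c)
      | hadd x y hx hy => simp only [smul_add, map_add, hx, hy])
  map_add' := map_add _
  map_smul' s t := by
    induction t using BTensor.induction with
    | h0 => simp
    | hmk m c =>
      change rid A M.carrier (map LinearMap.id (B.left (s • c)).lin (M.coact m)) =
        s • rid A M.carrier (map LinearMap.id (B.left c).lin (M.coact m))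
      induction M.coact m using BTensor.induction with
      | h0 => simp
      | hmk m x =>
        refine (congrArg (fun b => op b • m) (B.op_smul_right s x c)).trans ?_
        exact mul_smul s _ _
      | hadd x y hx hy => simp only [smul_add, map_add, hx, hy]
    | hadd x y hx hy => simp only [smul_add, map_add, hx, hy]

theorem pairLin_mk (M : RightComodule A C) (m : M.carrier) (c : C) :
    pairLin B M (BTensor.mk A m c) =
      rid A M.carrier (map LinearMap.id (B.left c).lin (M.coact m)) := rfl

/-- The map `x ↦ ∑ B(x, yᵢ) zᵢ`, additively in `∑ yᵢ ⊗ zᵢ`. -/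
def contractLeft : BTensor A C C →+ (C →ₗ[A] C) :=
  lift (biadd (fun y z => (B.left y).lin.smulRight z)
      (fun y y' z => LinearMap.ext fun x =>
        (congrArg (· • z) (B.add_right x y y')).trans (add_smul _ _ _))
      (fun _ _ _ => LinearMap.ext fun _ => smul_add _ _ _))
    (fun y a z => LinearMap.ext fun x =>
      (congrArg (· • z) (B.op_smul_right (op a) x y)).trans (mul_smul _ _ _))

/-- This is the Frobenius identity x₁ B(x₂, c) = B(x, c₁) c₂ as an equality of maps in x, the form
in which it enters the colinearity of `pairLin`. -/
theorem contractLeft_comul (c : C) : contractLeft B (comul c) = LeftDualRing.act (B.left c) := by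
  refine LinearMap.ext fun x => ?_
  rw [B.frobenius, RightDualRing.act_apply]
  induction (comul c : BTensor A C C) using BTensor.induction with
  | h0 => simp
  | hmk y z => rfl
  | hadd s t hs ht => rw [map_add, map_add, LinearMap.add_apply, hs, ht]

/-- Stated for an arbitrary tensor in place of Δ(c) so that it can be checked on y ⊗ z, where it is
m₀ B(m₁, y) ⊗ z = m₀ ⊗ B(m₁, y) z. -/
theorem map_pairLin_mkRight (M : RightComodule A C) (m : M.carrier) (t : BTensor A C C) :
    map (pairLin B M) LinearMap.id (map (mkRight m) LinearMap.id t) =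
      map LinearMap.id (contractLeft B t) (M.coact m) := by
  induction t using BTensor.induction with
  | h0 =>
    rw [map_zero, map_zero, map_zero]
    exact (DFunLike.congr_fun (map_zero (mapRightHom C C (LinearMap.id (M := M.carrier))))
      (M.coact m)).symm
  | hmk y z =>
    rw [map_mk, map_mk, mkRight_apply, pairLin_mk]
    induction M.coact m using BTensor.induction with
    | h0 => simp
    | hmk m x => exact mk_smul A m _ z
    | hadd s t hs ht => rw [map_add, map_add, map_add, mk_add_left, hs, ht]
  | hadd s t hs ht =>
    rw [map_add, map_add, map_add, hs, ht]
    exact (DFunLike.congr_fun (map_add (mapRightHom C C (LinearMap.id (M := M.carrier))) _ _)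
      (M.coact m)).symm

/-- The coaction of m₀ B(m₁, c) is m₀ ⊗ m₁ B(m₂, c) = m₀ ⊗ B(m₁, c₁) c₂ = m₀ B(m₁, c₁) ⊗ c₂, the
middle equality being the Frobenius identity. -/
theorem coact_pairLin (M : RightComodule A C) (t : BTensor A M.carrier C) :
    M.coact (pairLin B M t) = map (pairLin B M) LinearMap.id
      ((assoc A M.carrier C C).symm (map LinearMap.id comul t)) := by
  induction t using BTensor.induction with
  | h0 => simp
  | hmk m c =>
    rw [pairLin_mk, coact_rid_coact, map_mk, assoc_symm_mk, LinearMap.id_apply,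
      map_pairLin_mkRight, contractLeft_comul]
  | hadd s t hs ht => simp only [map_add, hs, ht]

theorem pairLin_map {M N : RightComodule A C} (f : M ⟶ N) (t : BTensor A M.carrier C) :
    pairLin B N (map (Hom.lin f) LinearMap.id t) = Hom.lin f (pairLin B M t) := by
  induction t using BTensor.induction with
  | h0 => simp
  | hmk m c =>
    rw [map_mk, LinearMap.id_apply, pairLin_mk, pairLin_mk, Hom.colinear, map_map,
      LinearMap.id_comp, LinearMap.comp_id, rid_map]
  | hadd s t hs ht => simp only [map_add, hs, ht]

/-- The transformation `m ⊗ c ↦ m₀ B(m₁, c)`. -/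
def transOfForm : forget A C ⋙ induction A C ⟶ 𝟭 (RightComodule A C) where
  app M := ⟨pairLin B M, coact_pairLin B M⟩
  naturality _ _ f := Hom.ext (LinearMap.ext fun t => pairLin_map B f t)

/-- The map `n ↦ n ⊗ d`, for `d` central. -/
def mkCentral (d : C) (hd : ∀ a : A, a • d = op a • d) (N : Type u) [AddCommGroup N]
    [Module Aᵐᵒᵖ N] : N →ₗ[Aᵐᵒᵖ] BTensor A N C where
  toFun n := BTensor.mk A n d
  map_add' n n' := mk_add_left A n n' d
  map_smul' s n := (mk_smul A n (unop s) d).trans (congrArg (BTensor.mk A n) (hd (unop s)))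

/-- The transformation `n ↦ n ⊗ d`. -/
def transOfCentral (d : C) (hd : ∀ a : A, a • d = op a • d) :
    𝟭 (ModuleCat.{u} Aᵐᵒᵖ) ⟶ induction A C ⋙ forget A C where
  app N := ModuleCat.ofHom (mkCentral d hd N)
  naturality _ _ _ := rfl

/-- The map `pairLin` of an induced comodule. -/
def pairInduced (N : Type u) [AddCommGroup N] [Module Aᵐᵒᵖ N] :
    BTensor A (BTensor A N C) C →ₗ[Aᵐᵒᵖ] BTensor A N C := pairLin B (induced A C N)

theorem pairInduced_mk {N : Type u} [AddCommGroup N] [Module Aᵐᵒᵖ N] (n : N) (d c : C) :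
    pairInduced B N (BTensor.mk A (BTensor.mk A n d) c) =
      BTensor.mk A n (RightDualRing.act (B.right d) c) := by
  rw [← B.frobenius]
  exact (pairLin_map B (mkRightHom n) (BTensor.mk A d c)).trans
    (congrArg (fun t => BTensor.mk A n (rid A C (map LinearMap.id (B.left c).lin t)))
      (comulR_eq d))

end Forms

theorem sumsToIdRight_of_counitSum (h : CounitSumRight A C) :
    SumsToIdRight (forget A C) (induction A C) := by
  obtain ⟨n, d, B, hd, h⟩ := h
  refine ⟨n, fun i => transOfCentral (d i) (hd i), fun i => transOfForm (B i), fun M => ?_⟩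
  refine ModuleCat.hom_ext (LinearMap.ext fun m => ?_)
  rw [ModuleCat.hom_sum, LinearMap.sum_apply]
  change ∑ i, rid A M.carrier (map LinearMap.id ((B i).left (d i)).lin (M.coact m)) = m
  rw [← map_sum, sum_map_right]
  -- The composite at M is m ↦ ∑ m₀ Bᵢ(m₁, dᵢ), so the counit sum reduces the claim to the counit
  -- law of M.
  have h₁ : ∑ i, ((B i).left (d i)).lin = counit := LinearMap.ext fun c =>
    (LinearMap.sum_apply _ _ _).trans (h c)
  rw [h₁]
  exact M.coact_counit m

theorem sumsToIdLeft_of_counitSum (h : CounitSumLeft A C) :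
    SumsToIdLeft (forget A C) (induction A C) := by
  obtain ⟨n, d, B, hd, h⟩ := h
  refine ⟨n, fun i => transOfCentral (d i) (hd i), fun i => transOfForm (B i), fun N => ?_⟩
  have key : ∀ t : BTensor A N C, ∑ i, pairInduced (B i) N
      (map (mkCentral (d i) (hd i) N) LinearMap.id t) = t := by
    intro t
    induction t using BTensor.induction with
    | h0 => simp
    | hmk x c =>
      refine (Finset.sum_congr rfl fun i _ => pairInduced_mk (B i) x (d i) c).trans ?_
      -- The composite sends x ⊗ c to ∑ x ⊗ Bᵢ(dᵢ, c₁) c₂, and ∑ Bᵢ(dᵢ, -) = ε.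
      have h₁ : ∑ i, RightDualRing.act ((B i).right (d i)) c = c := by
        rw [RightDualRing.sum_act, sum_right_eq_one h, RightDualRing.act_one]
      exact (map_sum (mkRight (A := A) x) _ _).symm.trans (congrArg (BTensor.mk A x) h₁)
    | hadd s t hs ht =>
      simp only [map_add, Finset.sum_add_distrib] at hs ht ⊢
      rw [hs, ht]
  exact Hom.ext (LinearMap.ext fun t => (linHom_sum_apply _ _ t).trans (key t))

theorem sumsToId_iff :
    SumsToIdRight (forget A C) (induction A C) ∧ SumsToIdLeft (forget A C) (induction A C) ↔
      CounitSumRight A C ∧ CounitSumLeft A C :=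
  and_congr ⟨counitSumRight_of_sumsToId, sumsToIdRight_of_counitSum⟩
    ⟨counitSumLeft_of_sumsToId, sumsToIdLeft_of_counitSum⟩

theorem induction_isQFFunctor_iff :
    IsQFFunctor (induction A C) ↔ CounitSumRight A C ∧ CounitSumLeft A C :=
  (Adjunction.isQFFunctor_right_iff (adjunction A C)).trans sumsToId_iff

theorem forget_isQFFunctor_iff :
    IsQFFunctor (forget A C) ↔ CounitSumRight A C ∧ CounitSumLeft A C :=
  (Adjunction.isQFFunctor_left_iff (adjunction A C)).trans sumsToId_iff

end RightComodule

end QF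

namespace QF

/-! ## The category of left comodules -/

namespace LeftComodule

open BTensor Coring Limits

variable {A C : Type u} [Ring A] [AddCommGroup C] [Module A C] [Module Aᵐᵒᵖ C]
  [SMulCommClass A Aᵐᵒᵖ C] [Coring A C]

/-- The colinear maps, as a subgroup of the linear maps. -/
def colinearMaps (M N : LeftComodule A C) : AddSubgroup (M.carrier →ₗ[A] N.carrier) where
  carrier := {f | ∀ m, N.coact (f m) = map LinearMap.id f (M.coact m)}
  zero_mem' m := (map_zero N.coact).trans
    (DFunLike.congr_fun (map_zero (mapRightHom M.carrier N.carrier LinearMap.id)) (M.coact m)).symm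
  add_mem' {f g} hf hg m := ((map_add N.coact _ _).trans (congrArg₂ (· + ·) (hf m) (hg m))).trans
    (DFunLike.congr_fun (map_add (mapRightHom M.carrier N.carrier LinearMap.id) f g)
      (M.coact m)).symm
  neg_mem' {f} hf m := ((map_neg N.coact _).trans (congrArg Neg.neg (hf m))).trans
    (DFunLike.congr_fun (map_neg (mapRightHom M.carrier N.carrier LinearMap.id) f) (M.coact m)).symm

/-- Morphisms of comodules are colinear maps. -/
def homEquiv (M N : LeftComodule A C) : (M ⟶ N) ≃ colinearMaps M N where
  toFun f := ⟨Hom.lin f, Hom.colinear f⟩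
  invFun f := ⟨f.1, f.2⟩

instance (M N : LeftComodule A C) : AddCommGroup (M ⟶ N) := (homEquiv M N).addCommGroup

/-- The underlying linear map, as an additive map. -/
def linHom (M N : LeftComodule A C) : (M ⟶ N) →+ (M.carrier →ₗ[A] N.carrier) where
  toFun := Hom.lin
  map_zero' := rfl
  map_add' _ _ := rfl

theorem linHom_sum_apply {M N : LeftComodule A C} {ι : Type*} (s : Finset ι) (f : ι → (M ⟶ N))
    (m : M.carrier) : linHom M N (∑ i ∈ s, f i) m = ∑ i ∈ s, Hom.lin (f i) m := by
  rw [map_sum, LinearMap.sum_apply]; rfl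

instance : Preadditive (LeftComodule A C) where
  add_comp _ _ _ f f' g := Hom.ext (LinearMap.comp_add (Hom.lin f) (Hom.lin f') (Hom.lin g))
  comp_add _ _ _ f g g' := Hom.ext (LinearMap.add_comp (Hom.lin f) (Hom.lin g') (Hom.lin g))

/-! ### Left comodule structures on retracts of finite sums -/

section Glue

variable {J : Type} [Fintype J] (M : J → LeftComodule A C) {N : Type u} [AddCommGroup N]
  [Module A N] (p : ∀ j, (M j).carrier →ₗ[A] N) (i : ∀ j, N →ₗ[A] (M j).carrier)

/-- The coaction induced on a retract of a finite sum of comodules. -/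
def glueCoact : N →ₗ[A] BTensor A C N :=
  ∑ j, mapLin A C (p j) ∘ₗ (M j).coact ∘ₗ i j

variable {M p i}

theorem glueCoact_apply (n : N) :
    glueCoact M p i n = ∑ j, map LinearMap.id (p j) ((M j).coact (i j n)) :=
  LinearMap.sum_apply _ _ _

theorem glueCoact_proj (hip : ∀ n, ∑ j, p j (i j n) = n)
    (hpi : ∀ j k m, (M k).coact (i k (p j m)) = map LinearMap.id (i k ∘ₗ p j) ((M j).coact m))
    (k : J) (m : (M k).carrier) :
    glueCoact M p i (p k m) = map LinearMap.id (p k) ((M k).coact m) := by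
  rw [glueCoact_apply]
  simp_rw [hpi, map_map, LinearMap.id_comp]
  rw [sum_map_right]
  congr 2
  ext x
  simpa [LinearMap.sum_apply] using hip (p k x)

theorem coact_glue_inj (hip : ∀ n, ∑ j, p j (i j n) = n)
    (hpi : ∀ j k m, (M k).coact (i k (p j m)) = map LinearMap.id (i k ∘ₗ p j) ((M j).coact m))
    (k : J) (n : N) :
    (M k).coact (i k n) = map LinearMap.id (i k) (glueCoact M p i n) := by
  conv_lhs => rw [← hip n, map_sum, map_sum]
  rw [glueCoact_apply, map_sum]
  simp_rw [hpi, map_map, LinearMap.id_comp]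

/-- A retract of a finite sum of comodules, as a comodule. -/
def glue (hip : ∀ n, ∑ j, p j (i j n) = n)
    (hpi : ∀ j k m, (M k).coact (i k (p j m)) = map LinearMap.id (i k ∘ₗ p j) ((M j).coact m)) :
    LeftComodule A C where
  carrier := N
  coact := glueCoact M p i
  coassoc n := by
    rw [← hip n]
    simp only [map_sum]
    refine Finset.sum_congr rfl fun j _ => ?_
    rw [glueCoact_proj hip hpi]
    refine (mapLin_colinear A C (p j) _).trans ?_
    rw [(M j).coassoc, map_map, map_map]
    have h : glueCoact M p i ∘ₗ p j = mapLin A C (p j) ∘ₗ (M j).coact :=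
      LinearMap.ext (glueCoact_proj hip hpi j)
    rw [h]
  coact_counit n := by
    rw [← hip n]
    simp only [map_sum]
    refine Finset.sum_congr rfl fun j _ => ?_
    rw [glueCoact_proj hip hpi, map_map, LinearMap.id_comp, LinearMap.comp_id, lid_map,
      (M j).coact_counit]

end Glue

instance : IsIdempotentComplete (LeftComodule A C) where
  idempotents_split M e he := by
    have he' : Hom.lin e ∘ₗ Hom.lin e = Hom.lin e := congrArg Hom.lin he
    let p : M.carrier →ₗ[A] LinearMap.range (Hom.lin e) := (Hom.lin e).rangeRestrict
    let i : LinearMap.range (Hom.lin e) →ₗ[A] M.carrier := Submodule.subtype _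
    have h₁ : ∀ n, p (i n) = n := by
      rintro ⟨_, x, rfl⟩
      exact Subtype.ext (LinearMap.congr_fun he' x)
    have h₂ : i ∘ₗ p = Hom.lin e := rfl
    have hip : ∀ n, ∑ j : Unit, p (i n) = n := fun n => by simpa using h₁ n
    have hpi : ∀ j k : Unit, ∀ m, M.coact (i (p m)) = map LinearMap.id (i ∘ₗ p) (M.coact m) :=
      fun _ _ m => Hom.colinear e m
    refine ⟨glue (M := fun _ : Unit => M) hip hpi,
      ⟨i, fun n => coact_glue_inj (M := fun _ : Unit => M) hip hpi () n⟩,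
      ⟨p, fun m => glueCoact_proj (M := fun _ : Unit => M) hip hpi () m⟩,
      Hom.ext (LinearMap.ext h₁), Hom.ext h₂⟩

instance : HasFiniteBiproducts (LeftComodule A C) where
  out n :=
    { has_biproduct := fun M => by
        classical
        let p (j : Fin n) : (M j).carrier →ₗ[A] (∀ j, (M j).carrier) :=
          LinearMap.single _ (fun j => (M j).carrier) j
        let i (j : Fin n) : (∀ j, (M j).carrier) →ₗ[A] (M j).carrier := LinearMap.proj j
        have hip : ∀ n, ∑ j, p j (i j n) = n := fun n => Finset.univ_sum_single n
        have hne : ∀ j k, j ≠ k → i k ∘ₗ p j = 0 := fun j k h => by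
          ext x; simp [i, p, Pi.single_eq_of_ne h.symm]
        have heq : ∀ j, i j ∘ₗ p j = LinearMap.id := fun j => by ext x; simp [i, p]
        have hpi : ∀ j k m, (M k).coact (i k (p j m)) =
            map LinearMap.id (i k ∘ₗ p j) ((M j).coact m) := fun j k m => by
          by_cases h : j = k
          · subst h
            rw [heq, map_id]
            exact congrArg (M j).coact (LinearMap.congr_fun (heq j) m)
          · rw [hne j k h]
            exact (congrArg (M k).coact (LinearMap.congr_fun (hne j k h) m)).trans
              ((map_zero _).trans (DFunLike.congr_fun
                (map_zero (mapRightHom (M j).carrier (M k).carrier LinearMap.id))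
                ((M j).coact m)).symm)
        let b : Bicone M :=
          { pt := glue hip hpi
            π := fun k => ⟨i k, coact_glue_inj hip hpi k⟩
            ι := fun k => ⟨p k, glueCoact_proj hip hpi k⟩
            ι_π := fun j k => by
              split_ifs with h
              · subst h; exact Hom.ext (heq j)
              · exact Hom.ext (hne j k h) }
        exact hasBiproduct_of_total b (Hom.ext (LinearMap.ext fun n =>
          (linHom_sum_apply _ _ n).trans (hip n))) }

variable (A C)

instance : (forget A C).Additive where
  map_add := rfl

instance : (induction A C).Additive where
  map_add {N N'} f g := Hom.ext (LinearMap.ext fun t =>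
    DFunLike.congr_fun (map_add (mapRightHom (M := C) N N' LinearMap.id) f.hom g.hom) t)

/-- The coaction as a colinear map `M → C ⊗ M`. -/
def coactHom (M : LeftComodule A C) : M ⟶ induced A C M.carrier :=
  ⟨M.coact, M.coassoc⟩

/-- The map `c ⊗ n ↦ ε(c) n`. -/
def counitLin (N : Type u) [AddCommGroup N] [Module A N] : BTensor A C N →ₗ[A] N where
  toFun t := lid A N (map counitR LinearMap.id t)
  map_add' x y := by rw [map_add, map_add]
  map_smul' a t := by
    induction t using BTensor.induction with
    | h0 => simp
    | hmk c n =>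
      rw [smul_mk, map_mk, map_mk, lid_mk, lid_mk, counitR_eq, counitR_eq, map_smul]
      exact mul_smul a _ _
    | hadd x y hx hy => simp only [smul_add, map_add, hx, hy]

theorem counitLin_map {N N' : Type u} [AddCommGroup N] [Module A N] [AddCommGroup N']
    [Module A N'] (f : N →ₗ[A] N') (t : BTensor A C N) :
    counitLin A C N' (map LinearMap.id f t) = f (counitLin A C N t) := by
  change lid A N' (map counitR LinearMap.id (map LinearMap.id f t)) = _
  rw [map_map, LinearMap.id_comp, LinearMap.comp_id, lid_map]
  rfl

theorem map_counitLin_comul {N : Type u} [AddCommGroup N] [Module A N] (t : BTensor A C N) :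
    map LinearMap.id (counitLin A C N) (assoc A C C N (map comulR LinearMap.id t)) = t := by
  induction t using BTensor.induction with
  | h0 => simp
  | hmk c n =>
    rw [map_mk, assoc_mk, map_map]
    have key : ∀ x : BTensor A C C,
        map (LinearMap.id ∘ₗ LinearMap.id) (counitLin A C N ∘ₗ mkLeft n) x =
          BTensor.mk A (rid A C (map LinearMap.id counit x)) n := by
      intro x
      induction x using BTensor.induction with
      | h0 => simp
      | hmk d e =>
        rw [map_mk, map_mk, rid_mk, mk_smul, ← counitR_eq]; rfl
      | hadd x y hx hy => simp only [map_add, mk_add_left, hx, hy]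
    refine (key _).trans ?_
    rw [comulR_eq, comul_counit]
  | hadd x y hx hy => simp only [map_add, hx, hy]

/-- The forgetful functor is left adjoint to induction. -/
def adjunction : forget A C ⊣ induction A C := Adjunction.mkOfUnitCounit
  { unit :=
      { app := fun M => coactHom A C M
        naturality := fun _ _ f => Hom.ext (LinearMap.ext fun m => Hom.colinear f m) }
    counit :=
      { app := fun N => ModuleCat.ofHom (counitLin A C N)
        naturality := fun _ _ f =>
          ModuleCat.hom_ext (LinearMap.ext fun t => counitLin_map A C f.hom t) }
    left_triangle := NatTrans.ext (funext fun M =>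
      ModuleCat.hom_ext (LinearMap.ext fun m : M.carrier => M.coact_counit m))
    right_triangle := NatTrans.ext (funext fun _ =>
      Hom.ext (LinearMap.ext fun t => map_counitLin_comul A C t)) }

/-- The coring as a left comodule over itself. -/
def regular : LeftComodule A C where
  carrier := C
  coact := comul
  coassoc c := Coring.coassoc c
  coact_counit c := counit_comul c

variable {A C}

/-- Right multiplication by `a`, as a colinear map. -/
def rmulHom (s : Aᵐᵒᵖ) : regular A C ⟶ regular A C :=
  ⟨(rmul C s : C →ₗ[A] C), fun c : C => comul_op_smul A C s c⟩

/-- `c ↦ c ⊗ n`, as a colinear map. -/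
def mkLeftHom {N : Type u} [AddCommGroup N] [Module A N] (n : N) :
    regular A C ⟶ induced A C N :=
  ⟨(mkLeft n : C →ₗ[A] BTensor A C N), fun c : C =>
    (assoc_mk (comulR c) n).trans (congrArg (map LinearMap.id (mkLeft n)) (comulR_eq c))⟩

/-! ### From natural transformations to forms -/

section Trans

variable (θ : forget A C ⋙ induction A C ⟶ 𝟭 (LeftComodule A C))

/-- The components `C ⊗ M → M` of a transformation. -/
def transLin (M : LeftComodule A C) : BTensor A C M.carrier →ₗ[A] M.carrier :=
  Hom.lin (θ.app M)

theorem coact_transLin (M : LeftComodule A C) (t : BTensor A C M.carrier) :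
    M.coact (transLin θ M t) = map LinearMap.id (transLin θ M)
      (assoc A C C M.carrier (map comulR LinearMap.id t)) :=
  Hom.colinear (θ.app M) t

theorem transLin_map {M N : LeftComodule A C} (f : M ⟶ N) (t : BTensor A C M.carrier) :
    transLin θ N (map LinearMap.id (Hom.lin f) t) = Hom.lin f (transLin θ M t) :=
  LinearMap.congr_fun (congrArg Hom.lin (θ.naturality f)) t

/-- The map `C ⊗ C → C` of a transformation. -/
def transReg : BTensor A C C →ₗ[A] C := transLin θ (regular A C)

theorem transReg_op_smul (s : Aᵐᵒᵖ) (x y : C) :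
    transReg θ (BTensor.mk A x (s • y)) = s • transReg θ (BTensor.mk A x y) :=
  transLin_map θ (rmulHom s) (BTensor.mk A x y)

/-- The component of a transformation at an induced comodule. -/
def transInduced (N : Type u) [AddCommGroup N] [Module A N] :
    BTensor A C (BTensor A C N) →ₗ[A] BTensor A C N := transLin θ (induced A C N)

theorem transInduced_mk {N : Type u} [AddCommGroup N] [Module A N] (n : N) (x y : C) :
    transInduced θ N (BTensor.mk A x (BTensor.mk A y n)) =
      BTensor.mk A (transReg θ (BTensor.mk A x y)) n :=
  transLin_map θ (mkLeftHom n) (BTensor.mk A x y)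

/-- The map `y ↦ θ(x ⊗ y)`. -/
def transRight (x : C) : C →ₗ[Aᵐᵒᵖ] C where
  toFun y := transReg θ (BTensor.mk A x y)
  map_add' y y' := by rw [mk_add_right, map_add]
  map_smul' s y := transReg_op_smul θ s x y

/-- For left comodules the two sources trade places: this formula comes from colinearity of θ_C, and
`transReg_eq_right` from naturality along Δ. -/
theorem transReg_eq_left (x y : C) : transReg θ (BTensor.mk A x y) =
    rid A C (map LinearMap.id (counit ∘ₗ transReg θ ∘ₗ mkLeft y) (comul x)) := by
  have h : comul (transReg θ (BTensor.mk A x y)) =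
      map LinearMap.id (transReg θ) (map LinearMap.id (mkLeft y) (comulR x)) :=
    coact_transLin θ (regular A C) (BTensor.mk A x y)
  rw [← comul_counit (A := A) (transReg θ (BTensor.mk A x y)), h, map_map, map_map, comulR_eq]
  rfl

theorem transReg_eq_right (x y : C) : transReg θ (BTensor.mk A x y) =
    lid A C (map (counitR ∘ₗ transRight θ x) LinearMap.id (comul y)) := by
  have h₁ : ∀ t : BTensor A C C, transInduced θ C (BTensor.mk A x t) =
      map (transRight θ x) LinearMap.id t := by
    intro t
    induction t using BTensor.induction with
    | h0 => rw [mk_zero_right, map_zero, map_zero]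
    | hmk z y => exact transInduced_mk θ y x z
    | hadd s t hs ht => rw [mk_add_right, map_add, map_add, hs, ht]
  have h₂ : comul (transReg θ (BTensor.mk A x y)) =
      map (transRight θ x) LinearMap.id (comul y) :=
    (transLin_map θ (coactHom A C (regular A C)) (BTensor.mk A x y)).symm.trans (h₁ (comul y))
  rw [← counit_comul (A := A) (transReg θ (BTensor.mk A x y)), h₂, map_map]
  rfl

/-- The Frobenius form `ε(θ(x ⊗ y))` of a transformation. -/
def formOfTrans : FrobeniusForm A C where
  form x y := counit (transReg θ (BTensor.mk A x y))
  add_left x x' y := by rw [mk_add_left, map_add, map_add]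
  add_right x y y' := by rw [mk_add_right, map_add, map_add]
  smul_left a x y := by rw [← smul_mk, map_smul, map_smul]; rfl
  op_smul_right s x y := by rw [transReg_op_smul, counit_op_smul]
  balanced a x y := by rw [mk_smul]
  frobenius x y := by
    refine Eq.trans (transReg_eq_left θ x y).symm ((transReg_eq_right θ x y).trans ?_)
    rw [RightDualRing.act_apply]
    refine congrArg (fun f => lid A C (map f LinearMap.id (comul y))) ?_
    exact LinearMap.ext fun z => counitR_eq _

variable (δ : 𝟭 (ModuleCat.{u} A) ⟶ induction A C ⋙ forget A C)

/-- The components `N → C ⊗ N` of a transformation. -/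
def unitLin (N : Type u) [AddCommGroup N] [Module A N] : N →ₗ[A] BTensor A C N :=
  (δ.app (ModuleCat.of A N)).hom

theorem unitLin_map {N N' : Type u} [AddCommGroup N] [Module A N] [AddCommGroup N']
    [Module A N'] (f : N →ₗ[A] N') (n : N) :
    unitLin δ N' (f n) = map LinearMap.id f (unitLin δ N n) :=
  LinearMap.congr_fun (congrArg ModuleCat.Hom.hom (δ.naturality (ModuleCat.ofHom f))) n

/-- The element `d` with `δ(n) = d ⊗ n`. -/
def elementOfTrans : C := rid A C (unitLin δ A 1)

theorem unitLin_apply {N : Type u} [AddCommGroup N] [Module A N] (n : N) :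
    unitLin δ N n = BTensor.mk A (elementOfTrans δ) n := by
  have h := unitLin_map δ (LinearMap.toSpanSingleton A N n) 1
  rw [← mk_rid_one (unitLin δ A 1), map_mk] at h
  change unitLin δ N ((1 : A) • n) = BTensor.mk A (elementOfTrans δ) ((1 : A) • n) at h
  rwa [one_smul] at h

theorem elementOfTrans_central (a : A) :
    a • elementOfTrans δ = op a • elementOfTrans δ := by
  have h := (unitLin δ A).map_smul a 1
  rw [unitLin_apply, unitLin_apply, ← mk_smul, smul_mk] at h
  simpa using (congrArg (rid A C) h).symm

end Trans

/-- For left comodules δ is n ↦ d ⊗ n, so the triangle at the regular comodule is ∑ θᵢ(dᵢ ⊗ c) = c,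
with the central element on the left. Hence the two counit sums trade places compared with right
comodules. -/
theorem counitSumLeft_of_sumsToId (h : SumsToIdRight (forget A C) (induction A C)) :
    CounitSumLeft A C := by
  obtain ⟨n, δ, θ, h⟩ := h
  refine ⟨n, fun i => elementOfTrans (δ i), fun i => formOfTrans (θ i),
    fun i => elementOfTrans_central (δ i), fun c => ?_⟩
  have h' := LinearMap.congr_fun (congrArg ModuleCat.Hom.hom (h (regular A C))) c
  have h'' : ∑ i, transReg (θ i) (unitLin (δ i) C c) = c :=
    (moduleCat_sum_apply Finset.univ (fun i => (δ i).app ((forget A C).obj (regular A C)) ≫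
      (forget A C).map ((θ i).app (regular A C))) c).symm.trans h'
  conv_rhs => rw [← h'', map_sum]
  simp_rw [unitLin_apply]
  rfl

theorem counitSumRight_of_sumsToId (h : SumsToIdLeft (forget A C) (induction A C)) :
    CounitSumRight A C := by
  obtain ⟨n, δ, θ, h⟩ := h
  refine ⟨n, fun i => elementOfTrans (δ i), fun i => formOfTrans (θ i),
    fun i => elementOfTrans_central (δ i), fun c => ?_⟩
  have h' := LinearMap.congr_fun (congrArg (linHom (induced A C A) (induced A C A))
    (h (ModuleCat.of A A))) (BTensor.mk A c (1 : A))
  have h'' : ∑ i, transInduced (θ i) A (BTensor.mk A c (unitLin (δ i) A 1)) =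
      BTensor.mk A c 1 := (linHom_sum_apply _ _ _).symm.trans h'
  simp_rw [unitLin_apply, transInduced_mk] at h''
  have h₃ := congrArg (rid A C) h''
  rw [map_sum] at h₃
  simp_rw [rid_mk, MulOpposite.op_one, one_smul] at h₃
  conv_rhs => rw [← h₃, map_sum]
  rfl

/-! ### From forms to natural transformations -/

section Forms

theorem coact_lid (M : LeftComodule A C) (f : RightDualRing A C) (t : BTensor A C M.carrier) :
    M.coact (lid A M.carrier (map f.lin LinearMap.id t)) =
      map (RightDualRing.contract f) LinearMap.id
        ((assoc A C C M.carrier).symm (map LinearMap.id M.coact t)) := by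
  induction t using BTensor.induction with
  | h0 => simp
  | hmk x m =>
    rw [map_mk, lid_mk, map_smul, map_mk, assoc_symm_mk, map_map]
    change f x • M.coact m =
      map (RightDualRing.contract f ∘ₗ mkRight x) LinearMap.id (M.coact m)
    induction M.coact m using BTensor.induction with
    | h0 => simp
    | hmk y m => rfl
    | hadd x y hx hy => rw [smul_add, map_add, hx, hy]
  | hadd x y hx hy => simp only [map_add, hx, hy]

/-- By coassociativity both sides are f(m₋₂) m₋₁ ⊗ m₀. -/
theorem coact_lid_coact (M : LeftComodule A C) (f : RightDualRing A C) (m : M.carrier) :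
    M.coact (lid A M.carrier (map f.lin LinearMap.id (M.coact m))) =
      map (RightDualRing.act f) LinearMap.id (M.coact m) := by
  rw [coact_lid, ← M.coassoc, AddEquiv.symm_apply_apply, map_map]; rfl

variable (B : FrobeniusForm A C)

/-- The map `c ⊗ m ↦ B(c, m₋₁) m₀`. -/
def pairLin (M : LeftComodule A C) : BTensor A C M.carrier →ₗ[A] M.carrier where
  toFun := lift (biadd
      (fun c m => lid A M.carrier (map (B.right c).lin LinearMap.id (M.coact m)))
      (fun c c' m => by
        have h : (B.right (c + c')).lin = (B.right c).lin + (B.right c').lin :=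
          LinearMap.ext fun x => B.add_left c c' x
        rw [h, ← map_add]
        exact congrArg (lid A M.carrier) (DFunLike.congr_fun
          (map_add (mapLeftHom C A (LinearMap.id (M := M.carrier))) _ _) (M.coact m)))
      (fun c m m' => by rw [map_add, map_add, map_add]))
    (fun c a m => by
      change lid A M.carrier (map (B.right (op a • c)).lin LinearMap.id (M.coact m)) =
        lid A M.carrier (map (B.right c).lin LinearMap.id (M.coact (a • m)))
      rw [map_smul]
      induction M.coact m using BTensor.induction with
      | h0 => simp
      | hmk x m => exact congrArg (· • m) (B.balanced a c x)
      | hadd x y hx hy => simp only [smul_add, map_add, hx, hy])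
  map_add' := map_add _
  map_smul' a t := by
    induction t using BTensor.induction with
    | h0 => simp
    | hmk c m =>
      change lid A M.carrier (map (B.right (a • c)).lin LinearMap.id (M.coact m)) =
        a • lid A M.carrier (map (B.right c).lin LinearMap.id (M.coact m))
      induction M.coact m using BTensor.induction with
      | h0 => simp
      | hmk x m =>
        refine (congrArg (· • m) (B.smul_left a c x)).trans ?_
        exact mul_smul a _ _
      | hadd x y hx hy => simp only [smul_add, map_add, hx, hy]
    | hadd x y hx hy => simp only [smul_add, map_add, hx, hy]

theorem pairLin_mk (M : LeftComodule A C) (m : M.carrier) (c : C) :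
    pairLin B M (BTensor.mk A c m) =
      lid A M.carrier (map (B.right c).lin LinearMap.id (M.coact m)) := rfl

/-- The map `x ↦ ∑ yᵢ B(zᵢ, x)`, additively in `∑ yᵢ ⊗ zᵢ`. -/
def contractRight : BTensor A C C →+ (C →ₗ[Aᵐᵒᵖ] C) :=
  lift (biadd (fun y z => (opLin A ∘ₗ (B.right z).lin).smulRight y)
      (fun _ _ _ => LinearMap.ext fun _ => smul_add _ _ _)
      (fun y z z' => LinearMap.ext fun x =>
        (congrArg (fun b => op b • y) (B.add_left z z' x)).trans (add_smul _ _ _)))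
    (fun y a z => LinearMap.ext fun x =>
      (mul_smul _ _ _).symm.trans (congrArg (fun b => op b • y) (B.smul_left a z x)).symm)

theorem contractRight_comul (c : C) :
    contractRight B (comul c) = RightDualRing.act (B.right c) := by
  refine LinearMap.ext fun x => ?_
  rw [← B.frobenius]
  change _ = LeftDualRing.contract (B.left x) (comul c)
  induction (comul c : BTensor A C C) using BTensor.induction with
  | h0 => simp
  | hmk y z => rfl
  | hadd s t hs ht => rw [map_add, map_add, LinearMap.add_apply, hs, ht]

theorem map_pairLin_mkLeft (M : LeftComodule A C) (m : M.carrier) (t : BTensor A C C) :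
    map LinearMap.id (pairLin B M) (map LinearMap.id (mkLeft m) t) =
      map (contractRight B t) LinearMap.id (M.coact m) := by
  induction t using BTensor.induction with
  | h0 =>
    rw [map_zero, map_zero, map_zero]
    exact (DFunLike.congr_fun (map_zero (mapLeftHom C C (LinearMap.id (M := M.carrier))))
      (M.coact m)).symm
  | hmk y z =>
    rw [map_mk, map_mk, mkLeft_apply, pairLin_mk]
    induction M.coact m using BTensor.induction with
    | h0 => simp
    | hmk x m => exact (mk_smul A y _ m).symm
    | hadd s t hs ht => rw [map_add, map_add, map_add, mk_add_right, hs, ht]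
  | hadd s t hs ht =>
    rw [map_add, map_add, map_add, hs, ht]
    exact (DFunLike.congr_fun (map_add (mapLeftHom C C (LinearMap.id (M := M.carrier))) _ _)
      (M.coact m)).symm

/-- The coaction of B(c, m₋₁) m₀ is B(c, m₋₂) m₋₁ ⊗ m₀ = c₁ B(c₂, m₋₁) ⊗ m₀ = c₁ ⊗ B(c₂, m₋₁) m₀,
again by the Frobenius identity. -/
theorem coact_pairLin (M : LeftComodule A C) (t : BTensor A C M.carrier) :
    M.coact (pairLin B M t) = map LinearMap.id (pairLin B M)
      (assoc A C C M.carrier (map comulR LinearMap.id t)) := by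
  induction t using BTensor.induction with
  | h0 => simp
  | hmk c m =>
    rw [pairLin_mk, coact_lid_coact, map_mk, assoc_mk, LinearMap.id_apply,
      map_pairLin_mkLeft, comulR_eq, contractRight_comul]
  | hadd s t hs ht => simp only [map_add, hs, ht]

theorem pairLin_map {M N : LeftComodule A C} (f : M ⟶ N) (t : BTensor A C M.carrier) :
    pairLin B N (map LinearMap.id (Hom.lin f) t) = Hom.lin f (pairLin B M t) := by
  induction t using BTensor.induction with
  | h0 => simp
  | hmk c m =>
    rw [map_mk, LinearMap.id_apply, pairLin_mk, pairLin_mk, Hom.colinear, map_map,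
      LinearMap.id_comp, LinearMap.comp_id, lid_map]
  | hadd s t hs ht => simp only [map_add, hs, ht]

/-- The transformation `c ⊗ m ↦ B(c, m₋₁) m₀`. -/
def transOfForm : forget A C ⋙ induction A C ⟶ 𝟭 (LeftComodule A C) where
  app M := ⟨pairLin B M, coact_pairLin B M⟩
  naturality _ _ f := Hom.ext (LinearMap.ext fun t => pairLin_map B f t)

/-- The map `n ↦ d ⊗ n`, for `d` central. -/
def mkCentral (d : C) (hd : ∀ a : A, a • d = op a • d) (N : Type u) [AddCommGroup N]
    [Module A N] : N →ₗ[A] BTensor A C N where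
  toFun n := BTensor.mk A d n
  map_add' n n' := mk_add_right A d n n'
  map_smul' a n := (mk_smul A d a n).symm.trans (congrArg (BTensor.mk A · n) (hd a).symm)

/-- The transformation `n ↦ d ⊗ n`. -/
def transOfCentral (d : C) (hd : ∀ a : A, a • d = op a • d) :
    𝟭 (ModuleCat.{u} A) ⟶ induction A C ⋙ forget A C where
  app N := ModuleCat.ofHom (mkCentral d hd N)
  naturality _ _ _ := rfl

/-- The map `pairLin` of an induced comodule. -/
def pairInduced (N : Type u) [AddCommGroup N] [Module A N] :
    BTensor A C (BTensor A C N) →ₗ[A] BTensor A C N := pairLin B (induced A C N)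

theorem pairInduced_mk {N : Type u} [AddCommGroup N] [Module A N] (n : N) (d c : C) :
    pairInduced B N (BTensor.mk A c (BTensor.mk A d n)) =
      BTensor.mk A (LeftDualRing.act (B.left d) c) n := by
  rw [B.frobenius, RightDualRing.act_apply]
  exact pairLin_map B (mkLeftHom n) (BTensor.mk A c d)

end Forms

theorem sumsToIdRight_of_counitSum (h : CounitSumLeft A C) :
    SumsToIdRight (forget A C) (induction A C) := by
  obtain ⟨n, d, B, hd, h⟩ := h
  refine ⟨n, fun i => transOfCentral (d i) (hd i), fun i => transOfForm (B i), fun M => ?_⟩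
  refine ModuleCat.hom_ext (LinearMap.ext fun m => ?_)
  rw [ModuleCat.hom_sum, LinearMap.sum_apply]
  change ∑ i, lid A M.carrier (map ((B i).right (d i)).lin LinearMap.id (M.coact m)) = m
  rw [← map_sum, sum_map_left]
  have h₁ : ∑ i, ((B i).right (d i)).lin = counitR := LinearMap.ext fun c =>
    (LinearMap.sum_apply _ _ _).trans ((h c).trans (counitR_eq c).symm)
  rw [h₁]
  exact M.coact_counit m

theorem sumsToIdLeft_of_counitSum (h : CounitSumRight A C) :
    SumsToIdLeft (forget A C) (induction A C) := by
  obtain ⟨n, d, B, hd, h⟩ := h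
  refine ⟨n, fun i => transOfCentral (d i) (hd i), fun i => transOfForm (B i), fun N => ?_⟩
  have key : ∀ t : BTensor A C N, ∑ i, pairInduced (B i) N
      (map LinearMap.id (mkCentral (d i) (hd i) N) t) = t := by
    intro t
    induction t using BTensor.induction with
    | h0 => simp
    | hmk c x =>
      refine (Finset.sum_congr rfl fun i _ => pairInduced_mk (B i) x (d i) c).trans ?_
      have h₁ : ∑ i, LeftDualRing.act ((B i).left (d i)) c = c := by
        rw [LeftDualRing.sum_act, sum_left_eq_one h, LeftDualRing.act_one]
      exact (map_sum (mkLeft (A := A) x) _ _).symm.trans (congrArg (BTensor.mk A · x) h₁)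
    | hadd s t hs ht =>
      simp only [map_add, Finset.sum_add_distrib] at hs ht ⊢
      rw [hs, ht]
  exact Hom.ext (LinearMap.ext fun t => (linHom_sum_apply _ _ t).trans (key t))

/-- The final `and_comm` undoes the interchange of sides; only the conjunction agrees with the one
for right comodules. -/
theorem sumsToId_iff :
    SumsToIdRight (forget A C) (induction A C) ∧ SumsToIdLeft (forget A C) (induction A C) ↔
      CounitSumRight A C ∧ CounitSumLeft A C :=
  (and_congr ⟨counitSumLeft_of_sumsToId, sumsToIdRight_of_counitSum⟩
    ⟨counitSumRight_of_sumsToId, sumsToIdLeft_of_counitSum⟩).trans and_comm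

theorem induction_isQFFunctor_iff :
    IsQFFunctor (induction A C) ↔ CounitSumRight A C ∧ CounitSumLeft A C :=
  (Adjunction.isQFFunctor_right_iff (adjunction A C)).trans sumsToId_iff

theorem forget_isQFFunctor_iff :
    IsQFFunctor (forget A C) ↔ CounitSumRight A C ∧ CounitSumLeft A C :=
  (Adjunction.isQFFunctor_left_iff (adjunction A C)).trans sumsToId_iff

end LeftComodule

end QF

/-- The equivalent characterizations of quasi-Frobenius corings. -/
theorem theorem7p5 (A C : Type u) [Ring A] [AddCommGroup C] [Module A C] [Module Aᵐᵒᵖ C]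
    [SMulCommClass A Aᵐᵒᵖ C] [QF.Coring A C] (hflat : QF.IsFlatLeft A C) :
    List.TFAE [
      QF.IsQFFunctor (QF.RightComodule.induction A C),
      QF.IsQFFunctor (QF.LeftComodule.induction A C),
      QF.IsFGProjective A C ∧ QF.BimodSimilar A (QF.LeftDualRing A C) C (QF.LeftDualRing A C),
      QF.IsFGProjective Aᵐᵒᵖ C ∧
        QF.BimodSimilar (QF.RightDualRing A C) A C (QF.RightDualRing A C),
      QF.IsFGProjective A C ∧ QF.IsQFFunctor (QF.RightComodule.forget A C),
      QF.IsFGProjective A C ∧ QF.IsQFExtension (QF.LeftDualRing.i A C),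
      QF.IsQFBimodule A (QF.LeftDualRing A C) C,
      QF.IsFGProjective A C ∧ QF.IsQFBimodule (QF.LeftDualRing A C) A (QF.LeftDualRing A C),
      QF.IsFGProjective Aᵐᵒᵖ C ∧ QF.IsQFFunctor (QF.LeftComodule.forget A C),
      QF.IsFGProjective Aᵐᵒᵖ C ∧ QF.IsQFExtension (QF.RightDualRing.i A C),
      QF.IsQFBimodule (QF.RightDualRing A C) A C,
      QF.IsFGProjective Aᵐᵒᵖ C ∧
        QF.IsQFBimodule A (QF.RightDualRing A C) (QF.RightDualRing A C)] := by
  tfae_have 1 ↔ 3 :=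
    QF.RightComodule.induction_isQFFunctor_iff.trans QF.similar_leftDualRing_iff.symm
  tfae_have 2 ↔ 3 :=
    QF.LeftComodule.induction_isQFFunctor_iff.trans QF.similar_leftDualRing_iff.symm
  tfae_have 3 ↔ 4 :=
    QF.similar_leftDualRing_iff.trans QF.similar_rightDualRing_iff.symm
  tfae_have 5 ↔ 3 := by
    rw [QF.RightComodule.forget_isQFFunctor_iff, QF.similar_leftDualRing_iff]
    -- The projectivity conjunct is automatic, since the counit sum provides a dual basis.
    exact and_iff_right_of_imp fun h => h.1.isFGProjective
  tfae_have 6 ↔ 3 := and_congr_right QF.LeftDualRing.isQFExtension_iff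
  tfae_have 7 ↔ 3 :=
    -- Projectivity over A is part of the definition of a quasi-Frobenius bimodule; it is split off
    -- so that `isQFBimodule_iff` applies.
    (and_iff_right_of_imp fun h => h.1).symm.trans (and_congr_right QF.LeftDualRing.isQFBimodule_iff)
  tfae_have 8 ↔ 3 := and_congr_right QF.LeftDualRing.isQFBimodule_self_iff
  tfae_have 9 ↔ 4 := by
    rw [QF.LeftComodule.forget_isQFFunctor_iff, QF.similar_rightDualRing_iff]
    exact and_iff_right_of_imp fun h => h.2.isFGProjective
  tfae_have 10 ↔ 4 := and_congr_right QF.RightDualRing.isQFExtension_iff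
  tfae_have 11 ↔ 4 :=
    (and_iff_right_of_imp fun h => h.2.1).symm.trans
      (and_congr_right QF.RightDualRing.isQFBimodule_iff)
  tfae_have 12 ↔ 4 := and_congr_right QF.RightDualRing.isQFBimodule_self_iff
  tfae_finish
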